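/- Let $\mathbf{Dia}$ be a domain of diagram shapes, i.e. a class of small categories containing all finite posets and closed under isomorphism, binary products, coproducts, full subcategories and the slices $J_{/k}$, $J_{k/}$ of functors $u\colon J\to K$ (for instance all small categories, or all posets). Let $\mathbb D$ be a pointed derivator on $\mathbf{Dia}$, that is, a strict 2-functor $\mathbf{Dia}^{\mathrm{op}}\to\mathbf{CAT}$ satisfying (Der1)–(Der4) such that $\mathbb D(e)$ has a zero object, where $e$ is the final category. Let $B\in\mathbf{Dia}$, let $i\colon A\to B$ be the inclusion of a full subcategory, let $\mathbb D^B$ be the shifted prederivator $K\mapsto\mathbb D(B\times K)$, and let $\mathbb D^{B,A}\subset\mathbb D^B$ be the vanishing subprederivator, where $\mathbb D^{B,A}(K)$ is the full subcategory of those $X\in\mathbb D(B\times K)$ for which $(i\times\mathrm{id}_K)^*X$ is a zero object. Then there is a localization of $\mathbb D^B$ with essential image $\mathbb D^{B,A}$: the inclusion $\iota\colon\mathbb D^{B,A}\to\mathbb D^B$ admits a left adjoint morphism of prederivators $F$ (unit and counit being modifications) such that, for $L=\iota F$ and the unit $\eta\colon\mathrm{id}\to L$, both $\eta_L$ and $L\eta$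 are isomodifications and, for every $K$, the essential image of $L_K$ is $\mathbb D^{B,A}(K)$. This localization is the cofiber of the coherent counit, in the following sense. Let $\overline A\subset B\times[1]$ be the full subcategory on the objects $(a,0)$, $a\in A$, and $(b,1)$, $b\in B$ (the mapping cylinder of $i$), let $\bar\imath\colon\overline A\to B\times[1]$ be the inclusion and $p\colon B\times[1]\to B$ the projection. The morphism $\bar\imath_!\,\bar\imath^*p^*\colon\mathbb D^B\to\mathbb D^{B\times[1]}$ is a coherent version of the counit: the arrow underlying its value at $X$ is isomorphic to the counit $i_!i^*X\to X$ of the adjunction $i_!\dashv i^*$, with target identified with $X$. Then $L$ is isomorphic to the composite of this morphism with the cofiber morphism $\mathbb D^{B\times[1]}\to\mathbb D^B$, which extends an arrow by zero to the span $(0,1)\leftarrow(0,0)\to(1,0)$ by right Kan extension, extends the result to the square $[1]\times[1]$ by left Kan extension, and evaluates at $(1,1)$. Under this isomorphism $\eta_X\colon X\to LX$ is the edge $(1,0)\to(1,1)$ of the resulting square. Consequently $\mathbb D^{B,A}$ is a pointed derivator. -/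

import Mathlib

open CategoryTheory CategoryTheory.Limits

universe w v u

namespace Derivators

/-! ### Domains of diagram shapes -/

/-- A domain `Dia` of diagram shapes: a class of small categories which contains all finite posets
and is closed under isomorphism, binary products, coproducts, full subcategories and the slices
`J_{/k}`, `J_{k/}` of functors `u : J ⥤ K`.  Both the class of all small categories and the class
of all posets are of this kind. -/
structure DiagramDomain where
  /-- the small category `K` belongs to the domain -/
  mem : ∀ (K : Type w) [Category.{w} K], Prop
  mem_of_iso : ∀ {J K : Type w} [Category.{w} J] [Category.{w} K] (F : J ⥤ K) (G : K ⥤ J),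
    F ⋙ G = 𝟭 J → G ⋙ F = 𝟭 K → mem J → mem K
  mem_finite_poset : ∀ (P : Type w) [PartialOrder P] [Finite P], mem P
  mem_prod : ∀ {J K : Type w} [Category.{w} J] [Category.{w} K], mem J → mem K → mem (J × K)
  mem_sigma : ∀ {I : Type w} (K : I → Type w) [∀ i, Category.{w} (K i)],
    (∀ i, mem (K i)) → mem (Σ i, K i)
  mem_full : ∀ {K : Type w} [Category.{w} K] (P : ObjectProperty K), mem K → mem P.FullSubcategory
  mem_costructuredArrow : ∀ {J K : Type w} [Category.{w} J] [Category.{w} K] (u : J ⥤ K) (k : K),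
    mem J → mem K → mem (CostructuredArrow u k)
  mem_structuredArrow : ∀ {J K : Type w} [Category.{w} J] [Category.{w} K] (u : J ⥤ K) (k : K),
    mem J → mem K → mem (StructuredArrow k u)

/-- The small categories belonging to a domain of diagram shapes. -/
structure Shape (Dia : DiagramDomain.{w}) where
  /-- the underlying type of objects -/
  carrier : Type w
  [cat : Category.{w} carrier]
  mem : Dia.mem carrier

attribute [instance] Shape.cat

instance (Dia : DiagramDomain.{w}) : CoeSort (Shape Dia) (Type w) := ⟨Shape.carrier⟩

/-- The two-element poset `0 < 1`. -/
def Two : Type w := ULift.{w} (Fin 2)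

instance : PartialOrder Two.{w} := PartialOrder.lift ULift.down ULift.down_injective

instance : Finite Two.{w} := inferInstanceAs (Finite (ULift.{w} (Fin 2)))

/-- The object `0`. -/
def Two.zero : Two.{w} := ULift.up 0

/-- The object `1`. -/
def Two.one : Two.{w} := ULift.up 1

/-- The arrow `0 ⟶ 1`. -/
def Two.arrow : Two.zero.{w} ⟶ Two.one :=
  homOfLE (show (0 : Fin 2) ≤ 1 from Fin.zero_le _)

namespace Shape

variable {Dia : DiagramDomain.{w}}

/-- The final category `e`. -/
abbrev point (Dia : DiagramDomain.{w}) : Shape Dia where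
  carrier := Discrete PUnit.{w + 1}
  mem := Dia.mem_of_iso (J := PUnit.{w + 1}) ((Functor.const _).obj ⟨PUnit.unit⟩)
    ((Functor.const _).obj PUnit.unit) rfl rfl (Dia.mem_finite_poset _)

/-- The arrow category `[1]`. -/
abbrev arrow (Dia : DiagramDomain.{w}) : Shape Dia where
  carrier := Two.{w}
  mem := Dia.mem_finite_poset _

/-- The product of two shapes. -/
abbrev prod (J K : Shape Dia) : Shape Dia where
  carrier := J × K
  mem := Dia.mem_prod J.mem K.mem

/-- The coproduct of a family of shapes. -/
abbrev sigma {I : Type w} (K : I → Shape Dia) : Shape Dia where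
  carrier := Σ i, (K i).carrier
  mem := Dia.mem_sigma _ fun i => (K i).mem

/-- The full subcategory of a shape given by a class of objects. -/
abbrev full (K : Shape Dia) (P : ObjectProperty K) : Shape Dia where
  carrier := P.FullSubcategory
  mem := Dia.mem_full P K.mem

/-- The slice category `J_{/k}`. -/
abbrev sliceOver {J K : Shape Dia} (u : J ⥤ K) (k : K) : Shape Dia where
  carrier := CostructuredArrow u k
  mem := Dia.mem_costructuredArrow u k J.mem K.mem

/-- The slice category `J_{k/}`. -/
abbrev sliceUnder {J K : Shape Dia} (u : J ⥤ K) (k : K) : Shape Dia where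
  carrier := StructuredArrow k u
  mem := Dia.mem_structuredArrow u k J.mem K.mem

/-- The functor `u × v : J × K ⥤ J' × K'`. -/
abbrev prodMap {J J' K K' : Shape Dia} (t : J ⥤ J') (s : K ⥤ K') : J.prod K ⥤ J'.prod K' :=
  Functor.prod t s

/-- The transformation `α × β`. -/
abbrev prodNat {J J' K K' : Shape Dia} {t t' : J ⥤ J'} {s s' : K ⥤ K'} (α : t ⟶ t') (β : s ⟶ s') :
    prodMap t s ⟶ prodMap t' s' :=
  NatTrans.prod α β

/-- The functor `e ⥤ K` classifying an object. -/
def pt {K : Shape Dia} (k : K) : point Dia ⥤ K := (Functor.const (Discrete PUnit.{w + 1})).obj k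

/-- The projection `π : K ⥤ e`. -/
def toPoint (K : Shape Dia) : K ⥤ point Dia :=
  (Functor.const K.carrier).obj (⟨PUnit.unit⟩ : Discrete PUnit.{w + 1})

/-- The projection `pr : J_{/k} ⥤ J`. -/
def overProj {J K : Shape Dia} (u : J ⥤ K) (k : K) : sliceOver u k ⥤ J :=
  CostructuredArrow.proj u k

/-- The projection `pr : J_{k/} ⥤ J`. -/
def underProj {J K : Shape Dia} (u : J ⥤ K) (k : K) : sliceUnder u k ⥤ J :=
  StructuredArrow.proj k u

/-- The transformation `u ∘ pr ⟶ k ∘ π` on `J_{/k}`, with value `f : u j ⟶ k` at `(j, f)`. -/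
def overNat {J K : Shape Dia} (u : J ⥤ K) (k : K) :
    overProj u k ⋙ u ⟶ toPoint (sliceOver u k) ⋙ pt k where
  app x := CostructuredArrow.hom x
  naturality _ _ f := (CostructuredArrow.w f).trans (Category.comp_id _).symm

/-- The transformation `k ∘ π ⟶ u ∘ pr` on `J_{k/}`, with value `f : k ⟶ u j` at `(j, f)`. -/
def underNat {J K : Shape Dia} (u : J ⥤ K) (k : K) :
    toPoint (sliceUnder u k) ⋙ pt k ⟶ underProj u k ⋙ u where
  app x := StructuredArrow.hom x
  naturality _ _ f := (Category.id_comp _).trans (StructuredArrow.w f).symm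

end Shape

/-! ### Prederivators -/

/-- A prederivator with domain `Dia`: a strict 2-functor `Diaᵒᵖ ⥤ CAT`, reversing functors and
preserving the direction of natural transformations. -/
structure Prederivator (Dia : DiagramDomain.{w}) where
  /-- the category `𝔻(K)` -/
  level : Shape Dia → Type u
  [cat : ∀ K, Category.{v} (level K)]
  /-- the restriction functor `u^* : 𝔻(K) ⥤ 𝔻(J)` -/
  pull : ∀ {J K : Shape Dia}, (J ⥤ K) → (level K ⥤ level J)
  /-- the transformation `α^* : u^* ⟶ v^*` -/
  pullNat : ∀ {J K : Shape Dia} {u v : J ⥤ K}, (u ⟶ v) → (pull u ⟶ pull v)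
  pull_id : ∀ K : Shape Dia, pull (𝟭 K) = 𝟭 (level K)
  pull_comp : ∀ {I J K : Shape Dia} (t : I ⥤ J) (u : J ⥤ K), pull (t ⋙ u) = pull u ⋙ pull t
  pullNat_id : ∀ {J K : Shape Dia} (u : J ⥤ K), pullNat (𝟙 u) = 𝟙 (pull u)
  pullNat_comp : ∀ {J K : Shape Dia} {u₁ u₂ u₃ : J ⥤ K} (α : u₁ ⟶ u₂) (β : u₂ ⟶ u₃),
    pullNat (α ≫ β) = pullNat α ≫ pullNat β
  pullNat_whiskerLeft : ∀ {I J K : Shape Dia} (t : I ⥤ J) {u₁ u₂ : J ⥤ K} (α : u₁ ⟶ u₂),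
    pullNat (Functor.whiskerLeft t α) =
      eqToHom (pull_comp t u₁) ≫ Functor.whiskerRight (pullNat α) (pull t) ≫
        eqToHom (pull_comp t u₂).symm
  pullNat_whiskerRight : ∀ {I J K : Shape Dia} {t₁ t₂ : I ⥤ J} (α : t₁ ⟶ t₂) (u : J ⥤ K),
    pullNat (Functor.whiskerRight α u) =
      eqToHom (pull_comp t₁ u) ≫ Functor.whiskerLeft (pull u) (pullNat α) ≫
        eqToHom (pull_comp t₂ u).symm

attribute [instance] Prederivator.cat

variable {Dia : DiagramDomain.{w}}

namespace Prederivator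

variable (D : Prederivator.{w, v, u} Dia)

theorem pull_comp_obj {I J K : Shape Dia} (t : I ⥤ J) (u : J ⥤ K) (X : D.level K) :
    (D.pull (t ⋙ u)).obj X = (D.pull t).obj ((D.pull u).obj X) :=
  Functor.congr_obj (D.pull_comp t u) X

theorem pull_comp_map {I J K : Shape Dia} (t : I ⥤ J) (u : J ⥤ K) {X Y : D.level K} (f : X ⟶ Y) :
    (D.pull (t ⋙ u)).map f = eqToHom (D.pull_comp_obj t u X) ≫
      (D.pull t).map ((D.pull u).map f) ≫ eqToHom (D.pull_comp_obj t u Y).symm :=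
  Functor.congr_hom (D.pull_comp t u) f

theorem pull_id_obj (K : Shape Dia) (X : D.level K) : (D.pull (𝟭 K)).obj X = X :=
  Functor.congr_obj (D.pull_id K) X

theorem pull_id_map (K : Shape Dia) {X Y : D.level K} (f : X ⟶ Y) :
    (D.pull (𝟭 K)).map f = eqToHom (D.pull_id_obj K X) ≫ f ≫ eqToHom (D.pull_id_obj K Y).symm :=
  Functor.congr_hom (D.pull_id K) f

theorem pullNat_whiskerLeft_app {I J K : Shape Dia} (t : I ⥤ J) {u₁ u₂ : J ⥤ K} (α : u₁ ⟶ u₂)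
    (X : D.level K) :
    (D.pullNat (Functor.whiskerLeft t α)).app X = eqToHom (D.pull_comp_obj t u₁ X) ≫
      (D.pull t).map ((D.pullNat α).app X) ≫ eqToHom (D.pull_comp_obj t u₂ X).symm := by
  rw [D.pullNat_whiskerLeft]
  simp [eqToHom_app]

theorem pullNat_whiskerRight_app {I J K : Shape Dia} {t₁ t₂ : I ⥤ J} (α : t₁ ⟶ t₂) (u : J ⥤ K)
    (X : D.level K) :
    (D.pullNat (Functor.whiskerRight α u)).app X = eqToHom (D.pull_comp_obj t₁ u X) ≫
      (D.pullNat α).app ((D.pull u).obj X) ≫ eqToHom (D.pull_comp_obj t₂ u X).symm := by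
  rw [D.pullNat_whiskerRight]
  simp [eqToHom_app]

/-- A transformation `δ : u₂ ∘ t ⟶ s ∘ u₁` in `Dia` induces `δ^* : t^* u₂^* ⟶ u₁^* s^*`. -/
def square {J₁ J₂ K₁ K₂ : Shape Dia} {t : J₁ ⥤ J₂} {u₁ : J₁ ⥤ K₁} {u₂ : J₂ ⥤ K₂} {s : K₁ ⥤ K₂}
    (δ : t ⋙ u₂ ⟶ u₁ ⋙ s) : D.pull u₂ ⋙ D.pull t ⟶ D.pull s ⋙ D.pull u₁ :=
  eqToHom (D.pull_comp t u₂).symm ≫ D.pullNat δ ≫ eqToHom (D.pull_comp u₁ s)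

/-- The left mate `δ_! : u₁_! t^* X ⟶ s^* u₂_! X` of `δ : u₂ ∘ t ⟶ s ∘ u₁`, for given left
adjoints of `u₁^*` and `u₂^*`. -/
def leftMate {J₁ J₂ K₁ K₂ : Shape Dia} {t : J₁ ⥤ J₂} {u₁ : J₁ ⥤ K₁} {u₂ : J₂ ⥤ K₂} {s : K₁ ⥤ K₂}
    (δ : t ⋙ u₂ ⟶ u₁ ⋙ s) {l₁ : D.level J₁ ⥤ D.level K₁} (adj₁ : l₁ ⊣ D.pull u₁)
    {l₂ : D.level J₂ ⥤ D.level K₂} (adj₂ : l₂ ⊣ D.pull u₂) (X : D.level J₂) :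
    l₁.obj ((D.pull t).obj X) ⟶ (D.pull s).obj (l₂.obj X) :=
  (adj₁.homEquiv _ _).symm
    ((D.pull t).map (adj₂.unit.app X) ≫ (D.square δ).app (l₂.obj X))

/-- The right mate `δ_* : u₁^* s_* X ⟶ t_* u₂^* X` of `δ : u₁ ∘ t ⟶ s ∘ u₂`, for given right
adjoints of `t^*` and `s^*`. -/
def rightMate {J₁ J₂ K₁ K₂ : Shape Dia} {t : J₁ ⥤ J₂} {u₁ : J₂ ⥤ K₂} {u₂ : J₁ ⥤ K₁} {s : K₁ ⥤ K₂}
    (δ : t ⋙ u₁ ⟶ u₂ ⋙ s) {r₁ : D.level J₁ ⥤ D.level J₂} (adj₁ : D.pull t ⊣ r₁)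
    {r₂ : D.level K₁ ⥤ D.level K₂} (adj₂ : D.pull s ⊣ r₂) (X : D.level K₁) :
    (D.pull u₁).obj (r₂.obj X) ⟶ r₁.obj ((D.pull u₂).obj X) :=
  adj₁.homEquiv _ _
    ((D.square δ).app (r₂.obj X) ≫ (D.pull u₂).map (adj₂.counit.app X))

/-- The axioms (Der1)-(Der4) of a derivator.  In (Der4) the canonical maps are required to be
isomorphisms for all choices of the adjoints, whose existence is (Der3). -/
structure IsDerivator : Prop where
  der1 : ∀ {I : Type w} (K : I → Shape Dia),
    (Functor.pi' fun i => D.pull (J := K i) (K := Shape.sigma K)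
      (Sigma.incl (C := fun i => (K i).carrier) i)).IsEquivalence
  der2 : ∀ {K : Shape Dia} {X Y : D.level K} (f : X ⟶ Y),
    IsIso f ↔ ∀ k : K, IsIso ((D.pull (Shape.pt k)).map f)
  der3_left : ∀ {J K : Shape Dia} (u : J ⥤ K), (D.pull u).IsRightAdjoint
  der3_right : ∀ {J K : Shape Dia} (u : J ⥤ K), (D.pull u).IsLeftAdjoint
  der4_left : ∀ {J K : Shape Dia} (u : J ⥤ K) (k : K)
    {lu : D.level J ⥤ D.level K} (adj : lu ⊣ D.pull u)
    {lπ : D.level (Shape.sliceOver u k) ⥤ D.level (Shape.point Dia)}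
    (adjπ : lπ ⊣ D.pull (Shape.toPoint (Shape.sliceOver u k))) (X : D.level J),
    IsIso (D.leftMate (Shape.overNat u k) adjπ adj X)
  der4_right : ∀ {J K : Shape Dia} (u : J ⥤ K) (k : K)
    {ru : D.level J ⥤ D.level K} (adj : D.pull u ⊣ ru)
    {rπ : D.level (Shape.sliceUnder u k) ⥤ D.level (Shape.point Dia)}
    (adjπ : D.pull (Shape.toPoint (Shape.sliceUnder u k)) ⊣ rπ) (X : D.level J),
    IsIso (D.rightMate (Shape.underNat u k) adjπ adj X)

/-- A (pre)derivator is pointed if its base `𝔻(e)` has a zero object. -/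
def IsPointed : Prop := HasZeroObject (D.level (Shape.point Dia))

/-- The shifted prederivator `𝔻^B`, with `𝔻^B(K) = 𝔻(B × K)`. -/
abbrev shift (B : Shape Dia) : Prederivator.{w, v, u} Dia where
  level K := D.level (B.prod K)
  pull t := D.pull (Shape.prodMap (𝟭 B) t)
  pullNat α := D.pullNat (Shape.prodNat (𝟙 (𝟭 B)) α)
  pull_id K := D.pull_id (B.prod K)
  pull_comp t s := D.pull_comp (Shape.prodMap (𝟭 B) t) (Shape.prodMap (𝟭 B) s)
  pullNat_id t := D.pullNat_id (Shape.prodMap (𝟭 B) t)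
  pullNat_comp α β := by
    rw [← D.pullNat_comp]
    congr 1
    ext x
    · exact (Category.comp_id _).symm
    · rfl
  pullNat_whiskerLeft t _ _ α :=
    D.pullNat_whiskerLeft (Shape.prodMap (𝟭 B) t) (Shape.prodNat (𝟙 (𝟭 B)) α)
  pullNat_whiskerRight {_ _ _ t₁ t₂} α t := by
    have h : Shape.prodNat (𝟙 (𝟭 B.carrier)) (Functor.whiskerRight α t) =
        Functor.whiskerRight (Shape.prodNat (𝟙 (𝟭 B.carrier)) α) (Shape.prodMap (𝟭 B) t) := rfl
    exact (congrArg D.pullNat h).trans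
      (D.pullNat_whiskerRight (Shape.prodNat (𝟙 (𝟭 B)) α) (Shape.prodMap (𝟭 B) t))

section Sub

variable {C : Type u} [Category.{v} C] (P : ObjectProperty C)

theorem eqToHom_conj {X X' Y Y' Z T : C} {a : X ⟶ Y} {b : X' ⟶ Y'} {e₁ : Z = X} {e₂ : Y = T}
    {e₃ : Z = X'} {e₄ : Y' = T}
    (h : eqToHom e₁ ≫ a ≫ eqToHom e₂ = eqToHom e₃ ≫ b ≫ eqToHom e₄) (p : Y = Y') (q : X = X') :
    a ≫ eqToHom p = eqToHom q ≫ b := by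
  subst e₁ e₂ q p
  simpa using h

theorem eqToHom_full_hom {X Y : P.FullSubcategory} (h : X = Y) :
    (eqToHom h).hom = eqToHom (congrArg ObjectProperty.FullSubcategory.obj h) := by
  subst h; rfl

end Sub

/-- The full subprederivator given by a class of objects in each `𝔻(K)` that is closed under
restriction. -/
abbrev sub (P : ∀ K, ObjectProperty (D.level K))
    (hP : ∀ {J K : Shape Dia} (t : J ⥤ K) (X : D.level K), P K X → P J ((D.pull t).obj X)) :
    Prederivator.{w, v, u} Dia where
  level K := (P K).FullSubcategory
  pull t := (P _).lift ((P _).ι ⋙ D.pull t) fun X => hP t X.obj X.property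
  pullNat α :=
    { app := fun X => ObjectProperty.homMk ((D.pullNat α).app X.obj)
      naturality := fun _ _ f => ObjectProperty.hom_ext _ ((D.pullNat α).naturality f.hom) }
  pull_id K := by
    refine CategoryTheory.Functor.ext (fun X => ObjectProperty.FullSubcategory.ext (D.pull_id_obj K X.obj)) ?_
    intro X Y f
    apply ObjectProperty.hom_ext
    simp [D.pull_id_map]
  pull_comp t s := by
    refine CategoryTheory.Functor.ext (fun X => ObjectProperty.FullSubcategory.ext (D.pull_comp_obj t s X.obj)) ?_
    intro X Y f
    apply ObjectProperty.hom_ext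
    simp [D.pull_comp_map]
  pullNat_id t := by
    ext X
    simp [D.pullNat_id]
  pullNat_comp α β := by
    ext X
    simp [D.pullNat_comp]
  pullNat_whiskerLeft t _ _ α := by
    ext X
    simp [eqToHom_app, D.pullNat_whiskerLeft_app]
  pullNat_whiskerRight α t := by
    ext X
    simp [eqToHom_app, D.pullNat_whiskerRight_app]

end Prederivator

/-! ### Morphisms, modifications, adjunctions -/

/-- A morphism of prederivators: a pseudonatural transformation, with structure isomorphisms
`γ_u : u^* Φ_K ⟶ Φ_J u^*`. -/
structure Mor (D E : Prederivator.{w, v, u} Dia) where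
  /-- the functor `Φ_K : 𝔻(K) ⥤ 𝔼(K)` -/
  app : ∀ K : Shape Dia, D.level K ⥤ E.level K
  /-- the structure isomorphism `γ_u` -/
  γ : ∀ {J K : Shape Dia} (t : J ⥤ K), app K ⋙ E.pull t ≅ D.pull t ⋙ app J
  γ_id : ∀ (K : Shape Dia) (X : D.level K),
    (γ (𝟭 K)).hom.app X = eqToHom (E.pull_id_obj K ((app K).obj X)) ≫
      (app K).map (eqToHom (D.pull_id_obj K X).symm)
  γ_comp : ∀ {I J K : Shape Dia} (t : I ⥤ J) (s : J ⥤ K) (X : D.level K),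
    (γ (t ⋙ s)).hom.app X = eqToHom (E.pull_comp_obj t s ((app K).obj X)) ≫
      (E.pull t).map ((γ s).hom.app X) ≫ (γ t).hom.app ((D.pull s).obj X) ≫
        (app I).map (eqToHom (D.pull_comp_obj t s X).symm)
  γ_naturality : ∀ {J K : Shape Dia} {t s : J ⥤ K} (α : t ⟶ s) (X : D.level K),
    (E.pullNat α).app ((app K).obj X) ≫ (γ s).hom.app X =
      (γ t).hom.app X ≫ (app J).map ((D.pullNat α).app X)

/-- A modification between morphisms of prederivators. -/
@[ext]
structure Modification {D E : Prederivator.{w, v, u} Dia} (Φ Ψ : Mor D E) where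
  /-- the transformation `ρ_K : Φ_K ⟶ Ψ_K` -/
  app : ∀ K : Shape Dia, Φ.app K ⟶ Ψ.app K
  comm : ∀ {J K : Shape Dia} (t : J ⥤ K) (X : D.level K),
    (E.pull t).map ((app K).app X) ≫ (Ψ.γ t).hom.app X =
      (Φ.γ t).hom.app X ≫ (app J).app ((D.pull t).obj X)

namespace Mor

/-- Morphisms of prederivators and modifications form a category; its isomorphisms are the
isomodifications. -/
instance (D E : Prederivator.{w, v, u} Dia) : Category (Mor D E) where
  Hom := Modification
  id Φ := { app := fun K => 𝟙 (Φ.app K), comm := by intros; simp }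
  comp ρ σ :=
    { app := fun K => ρ.app K ≫ σ.app K
      comm := by
        intro J K t X
        have h₁ := ρ.comm t X
        have h₂ := σ.comm t X
        simp only [NatTrans.comp_app, Functor.map_comp, Category.assoc]
        rw [h₂, reassoc_of% h₁] }
  id_comp _ := by ext; simp
  comp_id _ := by ext; simp
  assoc _ _ _ := by ext; simp

variable {D E F : Prederivator.{w, v, u} Dia}

/-- The identity morphism. -/
def id (D : Prederivator.{w, v, u} Dia) : Mor D D where
  app K := 𝟭 (D.level K)
  γ t := Iso.refl (D.pull t)
  γ_id K X := by simp
  γ_comp t s X := by simp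
  γ_naturality α X := by simp

/-- The composite `Ψ Φ : 𝔻 ⟶ 𝔽` of `Φ : 𝔻 ⟶ 𝔼` and `Ψ : 𝔼 ⟶ 𝔽`. -/
def comp (Φ : Mor D E) (Ψ : Mor E F) : Mor D F where
  app K := Φ.app K ⋙ Ψ.app K
  γ {J K} t :=
    (Functor.isoWhiskerLeft (Φ.app K) (Ψ.γ t) ≪≫
      Functor.isoWhiskerRight (Φ.γ t) (Ψ.app J) :
        Φ.app K ⋙ (Ψ.app K ⋙ F.pull t) ≅ (D.pull t ⋙ Φ.app J) ⋙ Ψ.app J)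
  γ_id K X := by
    simp [Φ.γ_id, Ψ.γ_id, eqToHom_map]
  γ_comp t s X := by
    have h := (Ψ.γ t).hom.naturality ((Φ.γ s).hom.app X)
    simp only [Functor.comp_obj, Functor.comp_map] at h
    simp [Φ.γ_comp, Ψ.γ_comp, eqToHom_map, reassoc_of% h]
  γ_naturality {J K t s} α X := by
    have h₁ := Ψ.γ_naturality α ((Φ.app K).obj X)
    have h₂ := Φ.γ_naturality α X
    simp [reassoc_of% h₁, ← Functor.map_comp, h₂]

end Mor

/-- An adjunction `Φ ⊣ Ψ` between morphisms of prederivators: unit and counit are modifications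
satisfying the triangle identities. -/
structure MorAdjunction {D E : Prederivator.{w, v, u} Dia} (Φ : Mor D E) (Ψ : Mor E D) where
  /-- the unit `id ⟶ Ψ Φ` -/
  unit : Mor.id D ⟶ Φ.comp Ψ
  /-- the counit `Φ Ψ ⟶ id` -/
  counit : Ψ.comp Φ ⟶ Mor.id E
  left_triangle : ∀ (K : Shape Dia) (X : D.level K),
    (Φ.app K).map ((unit.app K).app X) ≫ (counit.app K).app ((Φ.app K).obj X) =
      𝟙 ((Φ.app K).obj X)
  right_triangle : ∀ (K : Shape Dia) (Y : E.level K),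
    (unit.app K).app ((Ψ.app K).obj Y) ≫ (Ψ.app K).map ((counit.app K).app Y) =
      𝟙 ((Ψ.app K).obj Y)

/-- `(L, η)` is a localization morphism: `η_L` and `L η` are isomodifications. -/
def IsLocalization {D : Prederivator.{w, v, u} Dia} (L : Mor D D) (η : Mor.id D ⟶ L) : Prop :=
  ∀ (K : Shape Dia) (X : D.level K),
    IsIso ((η.app K).app ((L.app K).obj X)) ∧ IsIso ((L.app K).map ((η.app K).app X))

namespace Prederivator

variable (D : Prederivator.{w, v, u} Dia)

/-- The inclusion of a full subprederivator. -/
def subIncl (P : ∀ K, ObjectProperty (D.level K))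
    (hP : ∀ {J K : Shape Dia} (t : J ⥤ K) (X : D.level K), P K X → P J ((D.pull t).obj X)) :
    Mor (D.sub P hP) D where
  app K := (P K).ι
  γ {J K} t := Iso.refl ((P K).ι ⋙ D.pull t)
  γ_id K X := by
    have h : (P K).ι.map (eqToHom ((D.sub P hP).pull_id_obj K X).symm) =
        eqToHom (D.pull_id_obj K X.obj).symm := eqToHom_full_hom _ _
    rw [h]
    simp
  γ_comp {I J K} t s X := by
    have h : (P I).ι.map (eqToHom ((D.sub P hP).pull_comp_obj t s X).symm) =
        eqToHom (D.pull_comp_obj t s X.obj).symm := eqToHom_full_hom _ _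
    rw [h]
    simp
  γ_naturality {J K t s} α X :=
    (Category.comp_id ((D.pullNat α).app X.obj)).trans
      (Category.id_comp ((D.pullNat α).app X.obj)).symm

/-- The strict morphism `u^* : 𝔻^K ⟶ 𝔻^J` induced by `u : J ⥤ K`. -/
def pullMor {J K : Shape Dia} (t : J ⥤ K) : Mor (D.shift K) (D.shift J) where
  app M := D.pull (Shape.prodMap t (𝟭 M))
  γ {M N} s := eqToIso
    ((D.pull_comp (Shape.prodMap (𝟭 J) s) (Shape.prodMap t (𝟭 N))).symm.trans
      (D.pull_comp (Shape.prodMap t (𝟭 M)) (Shape.prodMap (𝟭 K) s)))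
  γ_id M X := by
    simp [eqToHom_app, eqToHom_map]
  γ_comp s r X := by
    simp [eqToHom_app, eqToHom_map]
  γ_naturality {M N s s'} α X := by
    have h₁ := D.pullNat_whiskerRight_app (Shape.prodNat (𝟙 (𝟭 J.carrier)) α)
      (Shape.prodMap t (𝟭 N)) X
    have h₂ := D.pullNat_whiskerLeft_app (Shape.prodMap t (𝟭 M))
      (Shape.prodNat (𝟙 (𝟭 K.carrier)) α) X
    have h : Functor.whiskerRight (Shape.prodNat (𝟙 (𝟭 J.carrier)) α) (Shape.prodMap t (𝟭 N)) =
        Functor.whiskerLeft (Shape.prodMap t (𝟭 M)) (Shape.prodNat (𝟙 (𝟭 K.carrier)) α) := by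
      ext x
      · exact t.map_id x.1
      · rfl
    rw [eqToIso.hom, eqToIso.hom, eqToHom_app, eqToHom_app]
    exact eqToHom_conj (h₁.symm.trans
      ((congrArg (fun β => (D.pullNat β).app X) h).trans h₂)) _ _

/-! ### Kan extensions in a derivator, vanishing objects -/

namespace IsDerivator

variable {D}

/-- The left Kan extension functor `u_!`. -/
noncomputable def lan (hD : D.IsDerivator) {J K : Shape Dia} (t : J ⥤ K) : D.level J ⥤ D.level K :=
  haveI := hD.der3_left t
  (D.pull t).leftAdjoint

/-- The adjunction `u_! ⊣ u^*`. -/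
noncomputable def lanAdj (hD : D.IsDerivator) {J K : Shape Dia} (t : J ⥤ K) : hD.lan t ⊣ D.pull t :=
  haveI := hD.der3_left t
  Adjunction.ofIsRightAdjoint (D.pull t)

/-- The right Kan extension functor `u_*`. -/
noncomputable def ran (hD : D.IsDerivator) {J K : Shape Dia} (t : J ⥤ K) : D.level J ⥤ D.level K :=
  haveI := hD.der3_right t
  (D.pull t).rightAdjoint

/-- The adjunction `u^* ⊣ u_*`. -/
noncomputable def ranAdj (hD : D.IsDerivator) {J K : Shape Dia} (t : J ⥤ K) : D.pull t ⊣ hD.ran t :=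
  haveI := hD.der3_right t
  Adjunction.ofIsLeftAdjoint (D.pull t)

theorem isZero_pull (hD : D.IsDerivator) {J K : Shape Dia} (t : J ⥤ K) {X : D.level K} (hX : IsZero X) :
    IsZero ((D.pull t).obj X) where
  unique_to Y :=
    ⟨{ default := ((hD.ranAdj t).homEquiv X Y).symm (hX.to_ _)
       uniq := fun _ => ((hD.ranAdj t).homEquiv X Y).injective (hX.eq_of_src _ _) }⟩
  unique_from Y :=
    ⟨{ default := (hD.lanAdj t).homEquiv Y X (hX.from_ _)
       uniq := fun _ => ((hD.lanAdj t).homEquiv Y X).symm.injective (hX.eq_of_tgt _ _) }⟩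

end IsDerivator

/-- `X ∈ 𝔻(B × K)` vanishes on the full subcategory `A` of `B`: the restriction `(i × id_K)^* X`
along the inclusion `i` of `A` is a zero object. -/
def Vanishes {B : Shape Dia} (A : ObjectProperty B) (K : Shape Dia) :
    ObjectProperty ((D.shift B).level K) :=
  fun X => IsZero ((D.pull (J := (B.full A).prod K) (K := B.prod K)
    (Shape.prodMap (J := B.full A) A.ι (𝟭 K))).obj X)

theorem IsDerivator.vanishes_pull {D : Prederivator.{w, v, u} Dia} (hD : D.IsDerivator)
    {B : Shape Dia} (A : ObjectProperty B) {J K : Shape Dia} (t : J ⥤ K)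
    (X : (D.shift B).level K) (hX : D.Vanishes A K X) :
    D.Vanishes A J (((D.shift B).pull t).obj X) := by
  have h := hD.isZero_pull (Shape.prodMap (𝟭 (B.full A)) t) hX
  have e₁ := D.pull_comp_obj (Shape.prodMap (𝟭 (B.full A)) t)
    (Shape.prodMap (J := B.full A) (J' := B) A.ι (𝟭 K)) X
  have e₂ := D.pull_comp_obj (Shape.prodMap (J := B.full A) (J' := B) A.ι (𝟭 J))
    (Shape.prodMap (𝟭 B) t) X
  exact (congrArg IsZero (e₁.symm.trans e₂)).mp h

/-- The vanishing subprederivator `𝔻^{B,A}` of `𝔻^B`: the full subprederivator with `𝔻^{B,A}(K)`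
consisting of the `X ∈ 𝔻(B × K)` which restrict to zero on `A × K`. -/
abbrev vanishing (hD : D.IsDerivator) {B : Shape Dia} (A : ObjectProperty B) :
    Prederivator.{w, v, u} Dia :=
  (D.shift B).sub (fun K => D.Vanishes A K) (hD.vanishes_pull A)

/-- The inclusion `𝔻^{B,A} ⟶ 𝔻^B`. -/
def vanishingIncl (hD : D.IsDerivator) {B : Shape Dia} (A : ObjectProperty B) :
    Mor (D.vanishing hD A) (D.shift B) :=
  (D.shift B).subIncl (fun K => D.Vanishes A K) (hD.vanishes_pull A)

end Prederivator

/-! ### The coherent counit and its cofiber -/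

namespace Shape

/-- The commutative square `[1] × [1]`. -/
abbrev square (Dia : DiagramDomain.{w}) : Shape Dia := (arrow Dia).prod (arrow Dia)

/-- The span `(0,1) ⟵ (0,0) ⟶ (1,0)`, the full subcategory of `[1] × [1]` without `(1,1)`. -/
abbrev span (Dia : DiagramDomain.{w}) : Shape Dia :=
  (square Dia).full fun x => x ≠ (Two.one, Two.one)

/-- The inclusion of the span into the square. -/
abbrev spanIncl (Dia : DiagramDomain.{w}) : span Dia ⥤ square Dia :=
  ObjectProperty.ι (C := Two.{w} × Two.{w}) fun x => x ≠ (Two.one, Two.one)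

/-- The horizontal arrow `(0,0) ⟶ (1,0)` of the square. -/
abbrev top (Dia : DiagramDomain.{w}) : arrow Dia ⥤ square Dia :=
  Functor.prod' (𝟭 Two.{w}) ((Functor.const _).obj Two.zero)

theorem zero_ne_one : Two.zero.{w} ≠ Two.one := fun h =>
  absurd (congrArg ULift.down h) (by decide)

/-- The horizontal arrow `(0,0) ⟶ (1,0)` of the span. -/
abbrev spanTop (Dia : DiagramDomain.{w}) : arrow Dia ⥤ span Dia :=
  ObjectProperty.lift _ (top Dia) fun _ h => zero_ne_one (congrArg Prod.snd h)

/-- The functor `b ↦ (b, c)` from `B` to `B × C`. -/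
abbrev slot (B : Shape Dia) {C : Shape Dia} (c : C) : B ⥤ B.prod C :=
  Functor.prod' (𝟭 B.carrier) ((Functor.const B.carrier).obj c)

/-- The transformation with components `(b, c) ⟶ (b, c')` induced by `c ⟶ c'`. -/
abbrev slotNat (B : Shape Dia) {C : Shape Dia} {c c' : C} (f : c ⟶ c') :
    slot B c ⟶ slot B c' :=
  NatTrans.prod' (𝟙 (𝟭 B.carrier)) ((Functor.const B.carrier).map f)

variable {B : Shape Dia} (A : ObjectProperty B)

/-- The inclusion `i` of the full subcategory `A` of `B`. -/
abbrev fullIncl : B.full A ⥤ B := A.ι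

/-- The mapping cylinder of the inclusion of the full subcategory `A` of `B`: the full subcategory
of `B × [1]` on the objects `(a, 0)` with `a` in `A` and `(b, 1)` with `b` in `B`. -/
abbrev cyl : Shape Dia :=
  (B.prod (arrow Dia)).full fun x => A x.1 ∨ x.2 = Two.one

/-- The inclusion `ī` of the mapping cylinder into `B × [1]`. -/
abbrev cylIncl : cyl A ⥤ B.prod (arrow Dia) :=
  ObjectProperty.ι (C := B.carrier × Two.{w}) fun x => A x.1 ∨ x.2 = Two.one

/-- The projection `q = p ī` of the mapping cylinder to `B`, where `p : B × [1] ⥤ B`. -/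
abbrev cylProj : cyl A ⥤ B := cylIncl A ⋙ CategoryTheory.Prod.fst B.carrier Two.{w}

/-- The inclusion `b ↦ (b, 1)` of `B` into the mapping cylinder. -/
abbrev cylEnd : B ⥤ cyl A :=
  ObjectProperty.lift _ (slot B (C := arrow Dia) Two.one) fun _ => Or.inr rfl

end Shape

open Shape

variable {D : Prederivator.{w, v, u} Dia} (hD : D.IsDerivator) {B : Shape Dia}
  (A : ObjectProperty B)

/-- The map `t^* W X ⟶ X` obtained from `ī^* W X ⟶ q^* X` by restriction along the inclusion
`b ↦ (b, 1)` of `B` into the mapping cylinder; here `t : B ⥤ B × [1]` is `b ↦ (b, 1)`. -/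
def targetMap {W : Mor (D.shift B) (D.shift (B.prod (arrow Dia)))}
    (ρ : W.comp (D.pullMor (cylIncl A)) ⟶ D.pullMor (cylProj A))
    (K : Shape Dia) (X : D.level (B.prod K)) :
    (D.pull (prodMap (slot B (C := arrow Dia) Two.one) (𝟭 K))).obj ((W.app K).obj X) ⟶ X :=
  eqToHom (D.pull_comp_obj (prodMap (cylEnd A) (𝟭 K)) (prodMap (cylIncl A) (𝟭 K)) _) ≫
    (D.pull (prodMap (cylEnd A) (𝟭 K))).map ((ρ.app K).app X) ≫
    eqToHom ((D.pull_comp_obj (prodMap (cylEnd A) (𝟭 K)) (prodMap (cylProj A) (𝟭 K)) X).symm.trans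
      (D.pull_id_obj (B.prod K) X))

/-- `W : 𝔻^B ⟶ 𝔻^{B × [1]}` is the coherent counit `X ↦ (i_! i^* X ⟶ X)` of the inclusion `i` of
the full subcategory `A` of `B`: it is `ī_! ī^* p^*`, that is, the left Kan extension along `ī` of
the strict morphism `q^* = ī^* p^*`, and its underlying incoherent diagram is the counit of the
adjunction `i_! ⊣ i^*`. -/
structure CoherentCounit (W : Mor (D.shift B) (D.shift (B.prod (arrow Dia)))) where
  /-- an isomodification `ī^* W ≅ q^*` -/
  restr : W.comp (D.pullMor (cylIncl A)) ≅ D.pullMor (cylProj A)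
  /-- the induced map `ī_! q^* X ⟶ W X` is an isomorphism -/
  isIso_lan : ∀ (K : Shape Dia) (X : D.level (B.prod K)),
    IsIso (((hD.lanAdj (prodMap (cylIncl A) (𝟭 K))).homEquiv _ _).symm
      ((restr.inv.app K).app X))
  /-- the source `s^* W` of the underlying arrow is `i_! i^*` -/
  source : ∀ K : Shape Dia,
    W.app K ⋙ D.pull (prodMap (slot B (C := arrow Dia) Two.zero) (𝟭 K)) ≅
      D.pull (prodMap (fullIncl A) (𝟭 K)) ⋙ hD.lan (prodMap (fullIncl A) (𝟭 K))
  /-- the underlying arrow `s^* W X ⟶ t^* W X ≅ X` is the counit `i_! i^* X ⟶ X`; here the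
  identification of `t^* W X` with `X` is the restriction of `ī^* W X ≅ q^* X` along the
  inclusion `b ↦ (b, 1)` of `B` into the mapping cylinder -/
  underlying : ∀ (K : Shape Dia) (X : D.level (B.prod K)),
    (source K).hom.app X ≫ (hD.lanAdj (prodMap (fullIncl A) (𝟭 K))).counit.app X =
      (D.pullNat (prodNat (slotNat B (C := arrow Dia) Two.arrow) (𝟙 (𝟭 K)))).app
          ((W.app K).obj X) ≫
        targetMap A restr.hom K X

/-- `(L, η)` is the cofiber of the coherent counit of the inclusion of `A` in `B`.  The datum is a
morphism `Q : 𝔻^B ⟶ 𝔻^{B × [1] × [1]}` whose value at `X` is the coherent square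
```
  i_! i^* X ⟶  X
      |        |
      v        v
      0   ⟶   L X
```
obtained from the coherent counit (its upper edge) by extension by zero to the span, that is, by
right Kan extension, and then by left Kan extension to the square; `η` is its right edge. -/
structure CofiberOfCounit (L : Mor (D.shift B) (D.shift B)) (η : Mor.id (D.shift B) ⟶ L) where
  /-- the cofiber square of the coherent counit -/
  Q : Mor (D.shift B) (D.shift (B.prod (square Dia)))
  /-- the upper edge is the coherent counit -/
  counit : CoherentCounit hD A (Q.comp (D.pullMor (prodMap (𝟭 B) (top Dia))))
  /-- the restriction of `Q X` to the span is the extension by zero of its upper edge -/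
  extension_by_zero : ∀ (K : Shape Dia) (X : D.level (B.prod K)),
    IsIso ((hD.ranAdj (prodMap (prodMap (𝟭 B) (spanTop Dia)) (𝟭 K))).unit.app
      ((D.pull (prodMap (prodMap (𝟭 B) (spanIncl Dia)) (𝟭 K))).obj ((Q.app K).obj X)))
  /-- the square `Q X` is the left Kan extension of its restriction to the span -/
  cocartesian : ∀ (K : Shape Dia) (X : D.level (B.prod K)),
    IsIso ((hD.lanAdj (prodMap (prodMap (𝟭 B) (spanIncl Dia)) (𝟭 K))).counit.app
      ((Q.app K).obj X))
  /-- `L` is the lower right corner -/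
  corner : Q.comp (D.pullMor (slot B (C := square Dia) (Two.one, Two.one))) ≅ L
  /-- `η` is the right edge `X ⟶ L X` -/
  right_edge : ∀ (K : Shape Dia) (X : D.level (B.prod K)),
    (eqToHom (D.pull_comp_obj (prodMap (slot B (C := arrow Dia) Two.one) (𝟭 K))
          (prodMap (prodMap (𝟭 B) (top Dia)) (𝟭 K)) ((Q.app K).obj X)) ≫
        targetMap A counit.restr.hom K X) ≫ (η.app K).app X =
      (D.pullNat (prodNat (slotNat B (C := square Dia)
          ((𝟙 Two.one, Two.arrow) : (Two.one, Two.zero) ⟶ (Two.one, Two.one))) (𝟙 (𝟭 K)))).app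
          ((Q.app K).obj X) ≫
        (corner.hom.app K).app X

end Derivators

open Derivators

/-! The cofiber square `Q X` is produced by only two Kan extensions. The diagram `q^* X` on the
mapping cylinder is first extended to the right, to `cofibShape`, which adds the objects `(b,
(0,1))`. No arrow leads from these into the cylinder, so the new values are limits over the empty
category, hence zero. The result is then extended to the left, to all of `B × [1] × [1]`. Both
inclusions are fully faithful, so `Q X` restricts to `X` at `(1,0)` and to `0` at `(0,1)`; its value
at `(1,1)` is `L X`. The prescribed description of `Q X` follows by base change. The upper edge is
`ī_! q^* X` (`univL_restrInv`) and its source is `i_! i^* X` (`univL_startHom`), because the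
inclusions involved contain every object with an arrow into the relevant part. Cancelling a factor
of the composite `cofibShape ⥤ B × span ⥤ B × [1] × [1]` shows that `Q X` is extended from the span
(`isLan_span_cofibSquare`).

Two facts make `L` a reflection onto the vanishing objects.

`L X` vanishes on `A` (`vanishes_cofiber`). At `a` in `A` the left extension is the colimit of the
span at `a`, whose arrow `(0,0) ⟶ (1,0)` is invertible and whose corner `(0,1)` is zero. All
parallel maps from such a span to a constant diagram agree, so the identity of the colimit is zero.

If `Y` vanishes on `A`, then precomposition with `X ⟶ L X` is bijective on maps into `Y`
(`bijective_cofiberUnit_comp`). With `p : B × [1] × [1] ⥤ B` the projection, maps `Q X ⟶ p^* Y` are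
computed in two ways. Restriction to `(1,1)` loses nothing, since `b ↦ (b, (1,1))` is right adjoint
to `p`. Restriction to `(1,0)` loses nothing either: one passes to `cofibShape` since `Q X` is a
left extension, then to the corners `(1,0)` and `(0,1)` since `p^* Y` is a right extension from
them, then to `(1,0)` since `Q X` is zero at `(0,1)`. Naturality along `(1,0) ⟶ (1,1)` compares the
two. The adjunction, the localization property and the essential image are then formal.

For the derivator axioms, Kan extension in the variable `K` commutes with restriction to `A`
(`exactL_prod_right`, `exactR_prod_right`) and sends zero to zero, so the vanishing objects are
closed under the Kan extensions of the shifted derivator.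

The method throughout is to replace chosen adjoints by universal arrows (`UnivL`, `UnivR`) and base
change isomorphisms by exact squares (`ExactL`, `ExactR`), which preserve universality. Exactness is
checked at points by (Der2), and at a point it follows from (Der4) together with an adjunction of
slice categories (`FinalAt.exactL`, `InitialAt.exactR`). -/

namespace Derivators

/-! ### Universal arrows as a choice-free form of adjoints -/

section Universal

universe v₁ v₂ u₁ u₂

variable {C : Type u₁} [Category.{v₁} C] {E : Type u₂} [Category.{v₂} E] (U : C ⥤ E)

/-- `e : X ⟶ U Y` is a universal arrow from `X` to `U`. -/
def UnivL {X : E} {Y : C} (e : X ⟶ U.obj Y) : Prop :=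
  ∀ Z : C, Function.Bijective fun g : Y ⟶ Z => e ≫ U.map g

/-- `e : U Y ⟶ X` is a universal arrow from `U` to `X`. -/
def UnivR {X : E} {Y : C} (e : U.obj Y ⟶ X) : Prop :=
  ∀ Z : C, Function.Bijective fun g : Z ⟶ Y => U.map g ≫ e

variable {U}

theorem UnivL.hom_ext {X : E} {Y Z : C} {e : X ⟶ U.obj Y} (h : UnivL U e) {f g : Y ⟶ Z}
    (w : e ≫ U.map f = e ≫ U.map g) : f = g :=
  (h Z).1 w

theorem UnivR.hom_ext {X : E} {Y Z : C} {e : U.obj Y ⟶ X} (h : UnivR U e) {f g : Z ⟶ Y}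
    (w : U.map f ≫ e = U.map g ≫ e) : f = g :=
  (h Z).1 w

theorem UnivL.exists_desc {X : E} {Y Z : C} {e : X ⟶ U.obj Y} (h : UnivL U e)
    (f : X ⟶ U.obj Z) : ∃ g : Y ⟶ Z, e ≫ U.map g = f :=
  (h Z).2 f

theorem UnivR.exists_lift {X : E} {Y Z : C} {e : U.obj Y ⟶ X} (h : UnivR U e)
    (f : U.obj Z ⟶ X) : ∃ g : Z ⟶ Y, U.map g ≫ e = f :=
  (h Z).2 f

theorem UnivL.iso_comp {X X' : E} {Y : C} {e : X ⟶ U.obj Y} (h : UnivL U e) (i : X' ⟶ X)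
    [IsIso i] : UnivL U (i ≫ e) := fun Z =>
  ⟨fun f g w => h.hom_ext ((cancel_epi i).1 (by simpa using w)), fun f => by
    obtain ⟨g, hg⟩ := h.exists_desc (inv i ≫ f)
    exact ⟨g, by simp [hg]⟩⟩

theorem UnivR.comp_iso {X X' : E} {Y : C} {e : U.obj Y ⟶ X} (h : UnivR U e) (i : X ⟶ X')
    [IsIso i] : UnivR U (e ≫ i) := fun Z =>
  ⟨fun f g w => h.hom_ext ((cancel_mono i).1 (by simpa using w)), fun f => by
    obtain ⟨g, hg⟩ := h.exists_lift (f ≫ inv i)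
    exact ⟨g, by simp [reassoc_of% hg]⟩⟩

theorem UnivL.comp_map {X : E} {Y Y' : C} {e : X ⟶ U.obj Y} (h : UnivL U e) (i : Y ⟶ Y')
    [IsIso i] : UnivL U (e ≫ U.map i) := fun Z =>
  ⟨fun f g w => (cancel_epi i).1 (h.hom_ext (by simpa using w)), fun f => by
    obtain ⟨g, hg⟩ := h.exists_desc f
    exact ⟨inv i ≫ g, by simp [hg]⟩⟩

theorem UnivR.map_comp {X : E} {Y Y' : C} {e : U.obj Y ⟶ X} (h : UnivR U e) (i : Y' ⟶ Y)
    [IsIso i] : UnivR U (U.map i ≫ e) := fun Z =>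
  ⟨fun f g w => (cancel_mono i).1 (h.hom_ext (by simpa using w)), fun f => by
    obtain ⟨g, hg⟩ := h.exists_lift f
    exact ⟨g ≫ inv i, by simpa using hg⟩⟩

/-- Two universal arrows out of the same object differ by a unique isomorphism. This is how
universality is turned back into invertibility of a comparison map. -/
theorem UnivL.isIso_of_comp_map {X : E} {Y Y' : C} {e : X ⟶ U.obj Y} (h : UnivL U e)
    {g : Y ⟶ Y'} (h' : UnivL U (e ≫ U.map g)) : IsIso g := by
  obtain ⟨k, hk⟩ := h'.exists_desc e
  rw [Category.assoc, ← U.map_comp] at hk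
  refine ⟨k, h.hom_ext (by simpa using hk), h'.hom_ext ?_⟩
  simp only [Category.assoc, ← U.map_comp, Category.comp_id]
  simp only [U.map_comp] at hk ⊢
  rw [reassoc_of% hk]

theorem UnivR.isIso_of_map_comp {X : E} {Y Y' : C} {e : U.obj Y ⟶ X} (h : UnivR U e)
    {g : Y' ⟶ Y} (h' : UnivR U (U.map g ≫ e)) : IsIso g := by
  obtain ⟨k, hk⟩ := h'.exists_lift e
  refine ⟨k, h'.hom_ext ?_, h.hom_ext (by simpa using hk)⟩
  simp only [U.map_comp, U.map_id, Category.assoc, Category.id_comp]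
  rw [hk]

theorem UnivL.of_comp_map {X : E} {Y Y' : C} {e : X ⟶ U.obj Y} (i : Y ⟶ Y') [IsIso i]
    (h : UnivL U (e ≫ U.map i)) : UnivL U e := by
  simpa using h.comp_map (inv i)

theorem UnivR.of_map_comp {X : E} {Y Y' : C} {e : U.obj Y ⟶ X} (i : Y' ⟶ Y) [IsIso i]
    (h : UnivR U (U.map i ≫ e)) : UnivR U e := by
  simpa using h.map_comp (inv i)

theorem UnivL.of_iso_comp {X X' : E} {Y : C} {e : X ⟶ U.obj Y} (i : X' ⟶ X)
    [IsIso i] (h : UnivL U (i ≫ e)) : UnivL U e := by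
  simpa using h.iso_comp (inv i)

theorem UnivR.of_comp_iso {X X' : E} {Y : C} {e : U.obj Y ⟶ X} (i : X ⟶ X')
    [IsIso i] (h : UnivR U (e ≫ i)) : UnivR U e := by
  simpa using h.comp_iso (inv i)

/-- An invertible unit lets `X` be replaced by `U.obj Y`, so that being a Kan extension becomes a
property of `Y` alone. -/
theorem UnivL.map_id_of_isIso {X : E} {Y : C} {e : X ⟶ U.obj Y} (h : UnivL U e) [IsIso e] :
    UnivL U (𝟙 (U.obj Y)) := by
  simpa using h.iso_comp (inv e)

theorem UnivR.map_id_of_isIso {X : E} {Y : C} {e : U.obj Y ⟶ X} (h : UnivR U e) [IsIso e] :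
    UnivR U (𝟙 (U.obj Y)) := by
  simpa using h.comp_iso (inv e)

theorem univL_id_iff {Y : C} :
    UnivL U (𝟙 (U.obj Y)) ↔ ∀ Z, Function.Bijective fun g : Y ⟶ Z => U.map g := by
  simp [UnivL]

theorem univR_id_iff {Y : C} :
    UnivR U (𝟙 (U.obj Y)) ↔ ∀ Z, Function.Bijective fun g : Z ⟶ Y => U.map g := by
  simp [UnivR]

/-- Maps out of `Y` correspond to maps out of the zero object `X`, so the identity of `Y` factors
through zero. -/
theorem UnivL.isZero {X : E} {Y : C} {e : X ⟶ U.obj Y} (h : UnivL U e) (hX : IsZero X)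
    [HasZeroObject C] : IsZero Y := by
  have : (𝟙 Y) = (isZero_zero C).from_ Y ≫ (isZero_zero C).to_ Y :=
    h.hom_ext (hX.eq_of_src _ _)
  exact (isZero_zero C).of_iso ⟨(isZero_zero C).from_ Y, (isZero_zero C).to_ Y, this.symm,
    (isZero_zero C).eq_of_src _ _⟩

theorem UnivR.isZero {X : E} {Y : C} {e : U.obj Y ⟶ X} (h : UnivR U e) (hX : IsZero X)
    [HasZeroObject C] : IsZero Y := by
  have : (𝟙 Y) = (isZero_zero C).from_ Y ≫ (isZero_zero C).to_ Y :=
    h.hom_ext (hX.eq_of_tgt _ _)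
  exact (isZero_zero C).of_iso ⟨(isZero_zero C).from_ Y, (isZero_zero C).to_ Y, this.symm,
    (isZero_zero C).eq_of_src _ _⟩

theorem univL_unit {l : E ⥤ C} (adj : l ⊣ U) (X : E) : UnivL U (adj.unit.app X) := fun Z => by
  have h : (fun g : l.obj X ⟶ Z => adj.unit.app X ≫ U.map g) = adj.homEquiv X Z :=
    funext fun g => (adj.homEquiv_unit X Z g).symm
  exact h ▸ (adj.homEquiv X Z).bijective

theorem univR_counit {r : E ⥤ C} (adj : U ⊣ r) (X : E) : UnivR U (adj.counit.app X) := fun Z => by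
  have h : (fun g : Z ⟶ r.obj X => U.map g ≫ adj.counit.app X) = (adj.homEquiv Z X).symm :=
    funext fun g => (adj.homEquiv_counit Z X g).symm
  exact h ▸ (adj.homEquiv Z X).symm.bijective

/-- The dictionary to chosen adjoints: the mates in (Der4) and the map `ī_! q^* X ⟶ W X` are
transposes of this kind. -/
theorem isIso_homEquiv_symm_iff {l : E ⥤ C} (adj : l ⊣ U) {X : E} {Y : C} (e : X ⟶ U.obj Y) :
    IsIso ((adj.homEquiv X Y).symm e) ↔ UnivL U e := by
  have he : adj.unit.app X ≫ U.map ((adj.homEquiv X Y).symm e) = e :=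
    (adj.homEquiv_unit _ _ _).symm.trans (Equiv.apply_symm_apply _ _)
  constructor
  · intro _
    rw [← he]
    exact (univL_unit adj X).comp_map _
  · intro h
    exact (univL_unit adj X).isIso_of_comp_map (he.symm ▸ h)

theorem isIso_homEquiv_iff {r : E ⥤ C} (adj : U ⊣ r) {X : E} {Y : C} (e : U.obj Y ⟶ X) :
    IsIso (adj.homEquiv Y X e) ↔ UnivR U e := by
  have he : U.map (adj.homEquiv Y X e) ≫ adj.counit.app X = e :=
    (adj.homEquiv_counit _ _ _).symm.trans (Equiv.symm_apply_apply _ _)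
  constructor
  · intro _
    rw [← he]
    exact (univR_counit adj X).map_comp _
  · intro h
    exact (univR_counit adj X).isIso_of_map_comp (he.symm ▸ h)

theorem isIso_counit_iff {l : E ⥤ C} (adj : l ⊣ U) (Y : C) :
    IsIso (adj.counit.app Y) ↔ UnivL U (𝟙 (U.obj Y)) := by
  rw [← isIso_homEquiv_symm_iff adj, adj.homEquiv_counit]
  simp

theorem isIso_unit_iff {r : E ⥤ C} (adj : U ⊣ r) (Y : C) :
    IsIso (adj.unit.app Y) ↔ UnivR U (𝟙 (U.obj Y)) := by
  rw [← isIso_homEquiv_iff adj, adj.homEquiv_unit]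
  simp

theorem isRightAdjoint_of_univL (h : ∀ X : E, ∃ (Y : C) (e : X ⟶ U.obj Y), UnivL U e) :
    U.IsRightAdjoint := by
  choose Y e he using h
  exact (Adjunction.adjunctionOfEquivLeft
    (fun X Z => Equiv.ofBijective (fun g : Y X ⟶ Z => e X ≫ U.map g) (he X Z))
    (fun X Z Z' g h => by simp)).isRightAdjoint

theorem isLeftAdjoint_of_univR (h : ∀ X : E, ∃ (Y : C) (e : U.obj Y ⟶ X), UnivR U e) :
    U.IsLeftAdjoint := by
  choose Y e he using h
  exact (Adjunction.adjunctionOfEquivRight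
    (fun Z X => (Equiv.ofBijective (fun g : Z ⟶ Y X => U.map g ≫ e X) (he X Z)).symm)
    (fun Z' Z X f g => by
      apply (he X Z').1
      change U.map ((Equiv.ofBijective _ (he X Z')).symm (U.map f ≫ g)) ≫ e X =
        U.map (f ≫ (Equiv.ofBijective _ (he X Z)).symm g) ≫ e X
      have h₁ := (Equiv.ofBijective _ (he X Z')).apply_symm_apply (U.map f ≫ g)
      have h₂ := (Equiv.ofBijective _ (he X Z)).apply_symm_apply g
      simp only [Equiv.ofBijective_apply] at h₁ h₂
      rw [h₁, U.map_comp, Category.assoc, h₂])).isLeftAdjoint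

end Universal

end Derivators

namespace Derivators

variable {Dia : DiagramDomain.{w}}

namespace Prederivator

variable (D : Prederivator.{w, v, u} Dia)

/-! ### Strict restriction -/

theorem square_app {J₁ J₂ K₁ K₂ : Shape Dia} {t : J₁ ⥤ J₂} {u₁ : J₁ ⥤ K₁} {u₂ : J₂ ⥤ K₂}
    {s : K₁ ⥤ K₂} (δ : t ⋙ u₂ ⟶ u₁ ⋙ s) (X : D.level K₂) :
    (D.square δ).app X = eqToHom (D.pull_comp_obj t u₂ X).symm ≫ (D.pullNat δ).app X ≫
      eqToHom (D.pull_comp_obj u₁ s X) := by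
  simp [square, eqToHom_app]

theorem pullNat_comp_app {J K : Shape Dia} {u₁ u₂ u₃ : J ⥤ K} (α : u₁ ⟶ u₂) (β : u₂ ⟶ u₃)
    (X : D.level K) :
    (D.pullNat (α ≫ β)).app X = (D.pullNat α).app X ≫ (D.pullNat β).app X := by
  rw [D.pullNat_comp, NatTrans.comp_app]

theorem pullNat_id_app {J K : Shape Dia} (t : J ⥤ K) (X : D.level K) :
    (D.pullNat (𝟙 t)).app X = 𝟙 _ := by
  rw [D.pullNat_id, NatTrans.id_app]

theorem pullNat_eqToHom {J K : Shape Dia} {t t' : J ⥤ K} (h : t = t') (X : D.level K) :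
    (D.pullNat (eqToHom h)).app X = eqToHom (by rw [h]) := by
  subst h
  simp [D.pullNat_id_app]

instance isIso_pullNat_app {J K : Shape Dia} {t t' : J ⥤ K} (α : t ⟶ t') [IsIso α]
    (X : D.level K) : IsIso ((D.pullNat α).app X) :=
  ⟨(D.pullNat (inv α)).app X, by rw [← D.pullNat_comp_app]; simp [D.pullNat_id_app],
    by rw [← D.pullNat_comp_app]; simp [D.pullNat_id_app]⟩

/-- `β` is the vertical composite of `δ` whiskered by `p` and `α` whiskered by `s`, and `pullNat`
respects both operations. Giving `β` with its components, rather than as this composite, leaves its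
functors free to be any definitionally equal composites. -/
theorem square_paste_app {I J₁ J₂ Q K₁ K₂ : Shape Dia} {p : I ⥤ J₁} {q : I ⥤ Q} {t : J₁ ⥤ J₂}
    {u₁ : J₁ ⥤ K₁} {u₂ : J₂ ⥤ K₂} {c : Q ⥤ K₁} {s : K₁ ⥤ K₂}
    (α : p ⋙ u₁ ⟶ q ⋙ c) (δ : t ⋙ u₂ ⟶ u₁ ⋙ s)
    (β : (p ⋙ t) ⋙ u₂ ⟶ q ⋙ (c ⋙ s))
    (hβ : ∀ x, β.app x = δ.app (p.obj x) ≫ s.map (α.app x)) (X : D.level K₂) :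
    (D.square β).app X = eqToHom (D.pull_comp_obj p t _) ≫
      (D.pull p).map ((D.square δ).app X) ≫ (D.square α).app ((D.pull s).obj X) ≫
        (D.pull q).map (eqToHom (D.pull_comp_obj c s X).symm) := by
  have e : β = Functor.whiskerLeft p δ ≫ Functor.whiskerRight α s := by
    ext x
    exact hβ x
  rw [e]
  simp only [square_app]
  erw [D.pullNat_comp_app]
  erw [D.pullNat_whiskerLeft_app, D.pullNat_whiskerRight_app]
  simp [eqToHom_map]

theorem square_paste_op_app {I J₁ J₂ Q K₁ K₂ : Shape Dia} {p : I ⥤ J₁} {q : I ⥤ Q} {t : J₁ ⥤ J₂}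
    {u₁ : J₁ ⥤ K₁} {u₂ : J₂ ⥤ K₂} {c : Q ⥤ K₁} {s : K₁ ⥤ K₂}
    (α : q ⋙ c ⟶ p ⋙ u₁) (δ : u₁ ⋙ s ⟶ t ⋙ u₂)
    (β : q ⋙ (c ⋙ s) ⟶ (p ⋙ t) ⋙ u₂)
    (hβ : ∀ x, β.app x = s.map (α.app x) ≫ δ.app (p.obj x)) (X : D.level K₂) :
    (D.square β).app X = (D.pull q).map (eqToHom (D.pull_comp_obj c s X)) ≫
      (D.square α).app ((D.pull s).obj X) ≫ (D.pull p).map ((D.square δ).app X) ≫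
        eqToHom (D.pull_comp_obj p t _).symm := by
  have e : β = Functor.whiskerRight α s ≫ Functor.whiskerLeft p δ := by
    ext x
    exact hβ x
  rw [e]
  simp only [square_app]
  erw [D.pullNat_comp_app]
  erw [D.pullNat_whiskerLeft_app, D.pullNat_whiskerRight_app]
  simp [eqToHom_map]

theorem map_pullNat_app {I J K : Shape Dia} (t : I ⥤ J) {u₁ u₂ : J ⥤ K} (α : u₁ ⟶ u₂)
    (X : D.level K) :
    (D.pull t).map ((D.pullNat α).app X) = eqToHom (D.pull_comp_obj t u₁ X).symm ≫
      (D.pullNat (Functor.whiskerLeft t α)).app X ≫ eqToHom (D.pull_comp_obj t u₂ X) := by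
  simp [D.pullNat_whiskerLeft_app]

theorem pullNat_app_pull {I J K : Shape Dia} {t₁ t₂ : I ⥤ J} (α : t₁ ⟶ t₂) (t : J ⥤ K)
    (X : D.level K) :
    (D.pullNat α).app ((D.pull t).obj X) = eqToHom (D.pull_comp_obj t₁ t X).symm ≫
      (D.pullNat (Functor.whiskerRight α t)).app X ≫ eqToHom (D.pull_comp_obj t₂ t X) := by
  simp [D.pullNat_whiskerRight_app]

theorem pullNat_app_comp_eqToHom {J K : Shape Dia} {u₁ u₂ u₂' u₃ : J ⥤ K} (α : u₁ ⟶ u₂)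
    (h : u₂ = u₂') (β : u₂' ⟶ u₃) (X : D.level K)
    (e : (D.pull u₂).obj X = (D.pull u₂').obj X) :
    (D.pullNat α).app X ≫ eqToHom e ≫ (D.pullNat β).app X =
      (D.pullNat (α ≫ eqToHom h ≫ β)).app X := by
  subst h
  simp [D.pullNat_comp_app]

/-! ### Adjunctions between shapes -/

/-- An adjunction `l ⊣ r` of shapes induces an adjunction `r^* ⊣ l^*`. -/
def pullAdj {J K : Shape Dia} {l : K ⥤ J} {r : J ⥤ K} (adj : l ⊣ r) : D.pull r ⊣ D.pull l where
  unit := eqToHom (D.pull_id K).symm ≫ D.pullNat adj.unit ≫ eqToHom (D.pull_comp l r)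
  counit := eqToHom (D.pull_comp r l).symm ≫ D.pullNat adj.counit ≫ eqToHom (D.pull_id J)
  left_triangle_components X := by
    simp only [NatTrans.comp_app, eqToHom_app, Functor.map_comp, eqToHom_map, Category.assoc,
      map_pullNat_app, pullNat_app_pull, eqToHom_trans_assoc, eqToHom_trans]
    erw [reassoc_of% D.pullNat_app_comp_eqToHom (Functor.whiskerLeft r adj.unit) rfl
      (Functor.whiskerRight adj.counit r) X]
    -- A triangle identity of `adj`; after it only identifications of equal objects remain.
    have h : (Functor.whiskerLeft r adj.unit ≫ eqToHom rfl ≫ Functor.whiskerRight adj.counit r :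
      r ⋙ 𝟭 K ⟶ 𝟭 J ⋙ r) = eqToHom rfl := by
      ext x
      simp
    rw [h, D.pullNat_eqToHom]
    simp
  right_triangle_components X := by
    simp only [NatTrans.comp_app, eqToHom_app, Functor.map_comp, eqToHom_map, Category.assoc,
      map_pullNat_app, pullNat_app_pull, eqToHom_trans_assoc, eqToHom_trans]
    erw [reassoc_of% D.pullNat_app_comp_eqToHom (Functor.whiskerRight adj.unit l) rfl
      (Functor.whiskerLeft l adj.counit) X]
    have h : (Functor.whiskerRight adj.unit l ≫ eqToHom rfl ≫ Functor.whiskerLeft l adj.counit :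
      𝟭 K ⋙ l ⟶ l ⋙ 𝟭 J) = eqToHom rfl := by
      ext x
      simp
    rw [h, D.pullNat_eqToHom]
    simp

/-- If `l ⊣ r` and the counit of `r^* ⊣ l^*` is invertible at `W`, then restriction along `r` is
bijective on maps into `l^* W`. -/
theorem bijective_pull_of_adj {J K : Shape Dia} {l : K ⥤ J} {r : J ⥤ K} (adj : l ⊣ r)
    (W : D.level J) [IsIso ((D.pullNat adj.counit).app W)] (Z : D.level K) :
    Function.Bijective fun g : Z ⟶ (D.pull l).obj W => (D.pull r).map g := by
  have hi : IsIso ((D.pullAdj adj).counit.app W) := by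
    simp only [pullAdj, NatTrans.comp_app, eqToHom_app]
    infer_instance
  have h := univR_counit (D.pullAdj adj) W
  exact univR_id_iff.1 h.map_id_of_isIso Z

/-- If `l ⊣ r` and the unit of `r^* ⊣ l^*` is invertible at `W`, then restriction along `l` is
bijective on maps out of `r^* W`. -/
theorem bijective_pull_of_adj' {J K : Shape Dia} {l : K ⥤ J} {r : J ⥤ K} (adj : l ⊣ r)
    (W : D.level K) [IsIso ((D.pullNat adj.unit).app W)] (Z : D.level J) :
    Function.Bijective fun g : (D.pull r).obj W ⟶ Z => (D.pull l).map g := by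
  have hi : IsIso ((D.pullAdj adj).unit.app W) := by
    simp only [pullAdj, NatTrans.comp_app, eqToHom_app]
    infer_instance
  have h := univL_unit (D.pullAdj adj) W
  exact univL_id_iff.1 h.map_id_of_isIso Z

theorem bijective_pull_comp {I J K : Shape Dia} (t : I ⥤ J) (s : J ⥤ K) (X Y : D.level K) :
    (Function.Bijective fun g : X ⟶ Y => (D.pull (t ⋙ s)).map g) ↔
      Function.Bijective fun g : X ⟶ Y => (D.pull t).map ((D.pull s).map g) := by
  have h : (fun g : X ⟶ Y => (D.pull (t ⋙ s)).map g) =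
      (Iso.homCongr (eqToIso (D.pull_comp_obj t s X)) (eqToIso (D.pull_comp_obj t s Y))).symm ∘
        fun g : X ⟶ Y => (D.pull t).map ((D.pull s).map g) := by
    ext g
    simp [D.pull_comp_map]
  rw [h]
  exact Equiv.comp_bijective _ _

/-! ### Points -/

/-- The transformation of points induced by an arrow. -/
def _root_.Derivators.Shape.ptNat {K : Shape Dia} {k k' : K} (f : k ⟶ k') :
    Shape.pt k ⟶ Shape.pt k' :=
  (Functor.const (Discrete PUnit.{w + 1})).map f

/-- The source is discrete, so this is an equality of functors, and strict functoriality of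
restriction applies to it. -/
theorem _root_.Derivators.Shape.exists_eq_pt {K : Shape Dia} (c : Shape.point Dia ⥤ K) :
    c = Shape.pt (c.obj ⟨PUnit.unit⟩) := by
  refine CategoryTheory.Functor.ext (fun x => rfl) ?_
  rintro ⟨⟨⟩⟩ ⟨⟨⟩⟩ ⟨⟨f⟩⟩
  simp [Shape.pt]

theorem _root_.Derivators.Shape.pt_comp {J K : Shape Dia} (j : J) (t : J ⥤ K) :
    Shape.pt j ⋙ t = Shape.pt (t.obj j) :=
  Shape.exists_eq_pt _

theorem pull_pt_obj {J K : Shape Dia} (j : J) (t : J ⥤ K) (X : D.level K) :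
    (D.pull (Shape.pt j)).obj ((D.pull t).obj X) = (D.pull (Shape.pt (t.obj j))).obj X := by
  rw [← D.pull_comp_obj, Shape.pt_comp]

theorem isIso_pull_comp_map {I J K : Shape Dia} (t : I ⥤ J) (s : J ⥤ K) {X Y : D.level K}
    (f : X ⟶ Y) : IsIso ((D.pull t).map ((D.pull s).map f)) ↔ IsIso ((D.pull (t ⋙ s)).map f) := by
  rw [D.pull_comp_map]
  simp

theorem isIso_pull_pt_map {J K : Shape Dia} (j : J) (t : J ⥤ K) {X Y : D.level K} (f : X ⟶ Y) :
    IsIso ((D.pull (Shape.pt j)).map ((D.pull t).map f)) ↔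
      IsIso ((D.pull (Shape.pt (t.obj j))).map f) := by
  rw [isIso_pull_comp_map, Shape.pt_comp]

/-- The map `k^* X ⟶ k'^* X` induced by an arrow `k ⟶ k'` is invertible. -/
def InvertsArrow {K : Shape Dia} (X : D.level K) {k k' : K} (f : k ⟶ k') : Prop :=
  IsIso ((D.pullNat (Shape.ptNat f)).app X)

variable {D}

theorem invertsArrow_of_isIso {K : Shape Dia} (X : D.level K) {k k' : K} (f : k ⟶ k') [IsIso f] :
    D.InvertsArrow X f :=
  haveI : IsIso (Shape.ptNat f) := inferInstanceAs (IsIso ((Functor.const _).map f))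
  D.isIso_pullNat_app _ _

theorem invertsArrow_of_iso {K : Shape Dia} {X Y : D.level K} (e : X ≅ Y) {k k' : K} (f : k ⟶ k') :
    D.InvertsArrow X f ↔ D.InvertsArrow Y f :=
  NatTrans.isIso_app_iff_of_iso _ e

theorem isIso_pullNat_point_iff {K : Shape Dia} (X : D.level K) {c c' : Shape.point Dia ⥤ K}
    (α : c ⟶ c') :
    IsIso ((D.pullNat α).app X) ↔ D.InvertsArrow X (α.app ⟨PUnit.unit⟩) := by
  obtain ⟨k, rfl⟩ : ∃ k, c = Shape.pt k := ⟨_, Shape.exists_eq_pt c⟩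
  obtain ⟨k', rfl⟩ : ∃ k', c' = Shape.pt k' := ⟨_, Shape.exists_eq_pt c'⟩
  have : α = Shape.ptNat (α.app ⟨PUnit.unit⟩) := by
    ext ⟨⟨⟩⟩
    rfl
  rw [InvertsArrow, ← this]
  rfl

theorem invertsArrow_pull {J K : Shape Dia} (t : J ⥤ K) (X : D.level K) {j j' : J} (f : j ⟶ j') :
    D.InvertsArrow ((D.pull t).obj X) f ↔ D.InvertsArrow X (t.map f) := by
  have h : IsIso ((D.pullNat (Functor.whiskerRight (Shape.ptNat f) t)).app X) ↔ _ :=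
    isIso_pullNat_point_iff X _
  rw [D.pullNat_whiskerRight_app] at h
  rw [isIso_comp_left_iff, isIso_comp_right_iff] at h
  exact h

/-- Vanishing at a point. -/
def ZeroAt {K : Shape Dia} (X : D.level K) (k : K) : Prop := IsZero ((D.pull (Shape.pt k)).obj X)

theorem zeroAt_pull {J K : Shape Dia} (t : J ⥤ K) (X : D.level K) (j : J) :
    ZeroAt ((D.pull t).obj X) j ↔ ZeroAt X (t.obj j) := by
  rw [ZeroAt, ZeroAt, D.pull_pt_obj]

theorem zeroAt_of_iso {K : Shape Dia} {X Y : D.level K} (e : X ≅ Y) (k : K) :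
    ZeroAt X k ↔ ZeroAt Y k :=
  ((D.pull (Shape.pt k)).mapIso e).isZero_iff

namespace IsDerivator

theorem isIso_iff (hD : D.IsDerivator) {K : Shape Dia} {X Y : D.level K} (f : X ⟶ Y) :
    IsIso f ↔ ∀ k : K, IsIso ((D.pull (Shape.pt k)).map f) := hD.der2 f

/-- (Der2) tests the map at each `j`, where it is restriction along the single arrow `α.app j`. -/
theorem isIso_pullNat_iff (hD : D.IsDerivator) {J K : Shape Dia} {t t' : J ⥤ K} (α : t ⟶ t')
    (X : D.level K) :
    IsIso ((D.pullNat α).app X) ↔ ∀ j, D.InvertsArrow X (α.app j) := by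
  rw [hD.isIso_iff]
  refine forall_congr' fun j => ?_
  have h := isIso_pullNat_point_iff X (Functor.whiskerLeft (Shape.pt j) α)
  rw [D.pullNat_whiskerLeft_app, isIso_comp_left_iff, isIso_comp_right_iff] at h
  exact h

theorem hasZeroObject (hD : D.IsDerivator) (hpt : D.IsPointed) (K : Shape Dia) :
    HasZeroObject (D.level K) :=
  haveI : HasZeroObject (D.level (Shape.point Dia)) := hpt
  ⟨_, hD.isZero_pull (Shape.toPoint K) (isZero_zero _)⟩

/-- A genuine zero object exists in `D.level K`; its map to a pointwise zero `X` is invertible at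
every point, hence invertible by (Der2). -/
theorem isZero_iff (hD : D.IsDerivator) (hpt : D.IsPointed) {K : Shape Dia} (X : D.level K) :
    IsZero X ↔ ∀ k : K, ZeroAt X k := by
  refine ⟨fun h k => hD.isZero_pull _ h, fun h => ?_⟩
  obtain ⟨O, hO⟩ := (hD.hasZeroObject hpt K).zero
  let f : O ⟶ X := hO.to_ X
  have : IsIso f := (hD.isIso_iff f).2 fun k =>
    (hD.isZero_pull _ hO).isIso (h k) _
  exact hO.of_iso (asIso f).symm

theorem isZero_of_isEmpty (hD : D.IsDerivator) (hpt : D.IsPointed) {K : Shape Dia} [IsEmpty K]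
    (X : D.level K) : IsZero X :=
  (hD.isZero_iff hpt X).2 fun k => isEmptyElim k

end IsDerivator

end Prederivator
end Derivators

namespace Derivators

open Shape

variable {Dia : DiagramDomain.{w}}

namespace Prederivator

variable (D : Prederivator.{w, v, u} Dia)

/-! ### Exact squares, left version -/

/-- The square `δ : u₂ t ⟶ s u₁` satisfies base change for left Kan extensions along `u₁`, `u₂`. -/
def ExactL {J₁ J₂ K₁ K₂ : Shape Dia} {t : J₁ ⥤ J₂} {u₁ : J₁ ⥤ K₁} {u₂ : J₂ ⥤ K₂} {s : K₁ ⥤ K₂}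
    (δ : t ⋙ u₂ ⟶ u₁ ⋙ s) : Prop :=
  ∀ ⦃X : D.level J₂⦄ ⦃Y : D.level K₂⦄ ⦃e : X ⟶ (D.pull u₂).obj Y⦄, UnivL (D.pull u₂) e →
    UnivL (D.pull u₁) ((D.pull t).map e ≫ (D.square δ).app Y)

/-- The square `δ : s u₁ ⟶ u₂ t` satisfies base change for right Kan extensions along `u₁`, `u₂`. -/
def ExactR {J₁ J₂ K₁ K₂ : Shape Dia} {t : J₁ ⥤ J₂} {u₁ : J₁ ⥤ K₁} {u₂ : J₂ ⥤ K₂} {s : K₁ ⥤ K₂}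
    (δ : u₁ ⋙ s ⟶ t ⋙ u₂) : Prop :=
  ∀ ⦃X : D.level J₂⦄ ⦃Y : D.level K₂⦄ ⦃e : (D.pull u₂).obj Y ⟶ X⦄, UnivR (D.pull u₂) e →
    UnivR (D.pull u₁) ((D.square δ).app Y ≫ (D.pull t).map e)

variable {D}

theorem map_comp_square_paste {I J₁ J₂ Q K₁ K₂ : Shape Dia} {p : I ⥤ J₁} {q : I ⥤ Q} {t : J₁ ⥤ J₂}
    {u₁ : J₁ ⥤ K₁} {u₂ : J₂ ⥤ K₂} {c : Q ⥤ K₁} {s : K₁ ⥤ K₂}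
    (α : p ⋙ u₁ ⟶ q ⋙ c) (δ : t ⋙ u₂ ⟶ u₁ ⋙ s)
    (β : (p ⋙ t) ⋙ u₂ ⟶ q ⋙ (c ⋙ s))
    (hβ : ∀ x, β.app x = δ.app (p.obj x) ≫ s.map (α.app x))
    {X : D.level J₂} {Y : D.level K₂} (e : X ⟶ (D.pull u₂).obj Y) :
    (D.pull (p ⋙ t)).map e ≫ (D.square β).app Y = eqToHom (D.pull_comp_obj p t X) ≫
      ((D.pull p).map ((D.pull t).map e ≫ (D.square δ).app Y) ≫
        (D.square α).app ((D.pull s).obj Y)) ≫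
        (D.pull q).map (eqToHom (D.pull_comp_obj c s Y).symm) := by
  rw [D.square_paste_app α δ β hβ, D.pull_comp_map]
  simp

theorem square_paste_comp_map {I J₁ J₂ Q K₁ K₂ : Shape Dia} {p : I ⥤ J₁} {q : I ⥤ Q} {t : J₁ ⥤ J₂}
    {u₁ : J₁ ⥤ K₁} {u₂ : J₂ ⥤ K₂} {c : Q ⥤ K₁} {s : K₁ ⥤ K₂}
    (α : q ⋙ c ⟶ p ⋙ u₁) (δ : u₁ ⋙ s ⟶ t ⋙ u₂)
    (β : q ⋙ (c ⋙ s) ⟶ (p ⋙ t) ⋙ u₂)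
    (hβ : ∀ x, β.app x = s.map (α.app x) ≫ δ.app (p.obj x))
    {X : D.level J₂} {Y : D.level K₂} (e : (D.pull u₂).obj Y ⟶ X) :
    (D.square β).app Y ≫ (D.pull (p ⋙ t)).map e =
      (D.pull q).map (eqToHom (D.pull_comp_obj c s Y)) ≫
      ((D.square α).app ((D.pull s).obj Y) ≫
        (D.pull p).map ((D.square δ).app Y ≫ (D.pull t).map e)) ≫
        eqToHom (D.pull_comp_obj p t X).symm := by
  rw [D.square_paste_op_app α δ β hβ, D.pull_comp_map]
  simp

/-- The two arrows differ only by identifications of equal objects. The equivalence serves pasting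
in one direction and pointwise detection of exactness in the other. -/
theorem univL_paste_iff {I J₁ J₂ Q K₁ K₂ : Shape Dia} {p : I ⥤ J₁} {q : I ⥤ Q} {t : J₁ ⥤ J₂}
    {u₁ : J₁ ⥤ K₁} {u₂ : J₂ ⥤ K₂} {c : Q ⥤ K₁} {s : K₁ ⥤ K₂}
    (α : p ⋙ u₁ ⟶ q ⋙ c) (δ : t ⋙ u₂ ⟶ u₁ ⋙ s)
    (β : (p ⋙ t) ⋙ u₂ ⟶ q ⋙ (c ⋙ s))
    (hβ : ∀ x, β.app x = δ.app (p.obj x) ≫ s.map (α.app x))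
    {X : D.level J₂} {Y : D.level K₂} (e : X ⟶ (D.pull u₂).obj Y) :
    UnivL (D.pull q) ((D.pull (p ⋙ t)).map e ≫ (D.square β).app Y) ↔
      UnivL (D.pull q) ((D.pull p).map ((D.pull t).map e ≫ (D.square δ).app Y) ≫
        (D.square α).app ((D.pull s).obj Y)) := by
  rw [map_comp_square_paste α δ β hβ]
  exact ⟨fun h => UnivL.of_comp_map _ (UnivL.of_iso_comp _ h),
    fun h => UnivL.iso_comp (UnivL.comp_map h _) _⟩

theorem univR_paste_iff {I J₁ J₂ Q K₁ K₂ : Shape Dia} {p : I ⥤ J₁} {q : I ⥤ Q} {t : J₁ ⥤ J₂}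
    {u₁ : J₁ ⥤ K₁} {u₂ : J₂ ⥤ K₂} {c : Q ⥤ K₁} {s : K₁ ⥤ K₂}
    (α : q ⋙ c ⟶ p ⋙ u₁) (δ : u₁ ⋙ s ⟶ t ⋙ u₂)
    (β : q ⋙ (c ⋙ s) ⟶ (p ⋙ t) ⋙ u₂)
    (hβ : ∀ x, β.app x = s.map (α.app x) ≫ δ.app (p.obj x))
    {X : D.level J₂} {Y : D.level K₂} (e : (D.pull u₂).obj Y ⟶ X) :
    UnivR (D.pull q) ((D.square β).app Y ≫ (D.pull (p ⋙ t)).map e) ↔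
      UnivR (D.pull q) ((D.square α).app ((D.pull s).obj Y) ≫
        (D.pull p).map ((D.square δ).app Y ≫ (D.pull t).map e)) := by
  rw [square_paste_comp_map α δ β hβ]
  exact ⟨fun h => UnivR.of_comp_iso _ (UnivR.of_map_comp _ h),
    fun h => UnivR.map_comp (UnivR.comp_iso h _) _⟩

theorem ExactL.paste {I J₁ J₂ Q K₁ K₂ : Shape Dia} {p : I ⥤ J₁} {q : I ⥤ Q} {t : J₁ ⥤ J₂}
    {u₁ : J₁ ⥤ K₁} {u₂ : J₂ ⥤ K₂} {c : Q ⥤ K₁} {s : K₁ ⥤ K₂}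
    {α : p ⋙ u₁ ⟶ q ⋙ c} {δ : t ⋙ u₂ ⟶ u₁ ⋙ s} (hα : D.ExactL α) (hδ : D.ExactL δ)
    (β : (p ⋙ t) ⋙ u₂ ⟶ q ⋙ (c ⋙ s))
    (hβ : ∀ x, β.app x = δ.app (p.obj x) ≫ s.map (α.app x)) : D.ExactL β :=
  fun _ _ e he => (univL_paste_iff α δ β hβ e).2 (hα (hδ he))

theorem ExactR.paste {I J₁ J₂ Q K₁ K₂ : Shape Dia} {p : I ⥤ J₁} {q : I ⥤ Q} {t : J₁ ⥤ J₂}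
    {u₁ : J₁ ⥤ K₁} {u₂ : J₂ ⥤ K₂} {c : Q ⥤ K₁} {s : K₁ ⥤ K₂}
    {α : q ⋙ c ⟶ p ⋙ u₁} {δ : u₁ ⋙ s ⟶ t ⋙ u₂} (hα : D.ExactR α) (hδ : D.ExactR δ)
    (β : q ⋙ (c ⋙ s) ⟶ (p ⋙ t) ⋙ u₂)
    (hβ : ∀ x, β.app x = s.map (α.app x) ≫ δ.app (p.obj x)) : D.ExactR β :=
  fun _ _ e he => (univR_paste_iff α δ β hβ e).2 (hα (hδ he))

/-! ### (Der4) combined with adjunctions of slice categories -/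

/-- The functor `P ⥤ u_{/c}` induced by `α` has a left adjoint. -/
def FinalAt {J K P : Shape Dia} {t : J ⥤ K} {c : point Dia ⥤ K} {p : P ⥤ J}
    (α : p ⋙ t ⟶ toPoint P ⋙ c) : Prop :=
  ∀ (j : J) (g : t.obj j ⟶ c.obj ⟨PUnit.unit⟩), ∃ (x : P) (h : j ⟶ p.obj x),
    t.map h ≫ α.app x = g ∧ ∀ (x' : P) (h' : j ⟶ p.obj x'), t.map h' ≫ α.app x' = g →
      ∃! m : x ⟶ x', h ≫ p.map m = h'

/-- The functor `P ⥤ u_{c/}` induced by `α` has a right adjoint. -/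
def InitialAt {J K P : Shape Dia} {t : J ⥤ K} {c : point Dia ⥤ K} {p : P ⥤ J}
    (α : toPoint P ⋙ c ⟶ p ⋙ t) : Prop :=
  ∀ (j : J) (g : c.obj ⟨PUnit.unit⟩ ⟶ t.obj j), ∃ (x : P) (h : p.obj x ⟶ j),
    α.app x ≫ t.map h = g ∧ ∀ (x' : P) (h' : p.obj x' ⟶ j), α.app x' ≫ t.map h' = g →
      ∃! m : x' ⟶ x, p.map m ≫ h = h'

/-- The functor to a slice category induced by a transformation to a point. -/
def toSliceOver {J K P : Shape Dia} {t : J ⥤ K} {k : K} {p : P ⥤ J}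
    (α : p ⋙ t ⟶ toPoint P ⋙ pt k) : P ⥤ sliceOver t k where
  obj x := CostructuredArrow.mk (S := t) (T := k) (Y := p.obj x) (α.app x)
  map f := CostructuredArrow.homMk (p.map f) ((α.naturality f).trans (Category.comp_id _))

/-- The functor to a slice category induced by a transformation from a point. -/
def toSliceUnder {J K P : Shape Dia} {t : J ⥤ K} {k : K} {p : P ⥤ J}
    (α : toPoint P ⋙ pt k ⟶ p ⋙ t) : P ⥤ sliceUnder t k where
  obj x := StructuredArrow.mk (S := k) (T := t) (Y := p.obj x) (α.app x)
  map f := StructuredArrow.homMk (p.map f) ((α.naturality f).symm.trans (Category.id_comp _))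

theorem bijective_pull_toPoint_of_adj {P Q : Shape Dia} {l : Q ⥤ P} {R : P ⥤ Q} (adj : l ⊣ R)
    (X : D.level Q) (N : D.level (point Dia)) :
    Function.Bijective fun g : X ⟶ (D.pull (toPoint Q)).obj N => (D.pull R).map g := by
  have h : IsIso ((D.pullNat adj.counit).app ((D.pull (toPoint P)).obj N)) := by
    have : IsIso (Functor.whiskerRight adj.counit (toPoint P)) := NatIso.isIso_of_isIso_app _
    rw [D.pullNat_app_pull]
    infer_instance
  -- The constant diagram on `Q` is equal to `l^*` of the constant diagram on `P`, but not
  -- definitionally, so the target is generalized first.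
  have key : ∀ W, W = (D.pull l).obj ((D.pull (toPoint P)).obj N) →
      Function.Bijective fun g : X ⟶ W => (D.pull R).map g := by
    rintro _ rfl
    exact D.bijective_pull_of_adj adj _ X
  exact key _ (D.pull_comp_obj l (toPoint P) N)

theorem isIso_square_app {J₁ J₂ K₁ K₂ : Shape Dia} {t : J₁ ⥤ J₂} {u₁ : J₁ ⥤ K₁} {u₂ : J₂ ⥤ K₂}
    {s : K₁ ⥤ K₂} (δ : t ⋙ u₂ ⟶ u₁ ⋙ s) [IsIso δ] (X : D.level K₂) :
    IsIso ((D.square δ).app X) := by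
  rw [D.square_app]
  infer_instance

/-- Right adjoints are final: restriction along `R` is bijective on maps into constant diagrams,
hence does not change colimits. -/
theorem exactL_of_adj {P Q : Shape Dia} {l : Q ⥤ P} {R : P ⥤ Q} (adj : l ⊣ R)
    (δ : R ⋙ toPoint Q ⟶ toPoint P ⋙ 𝟭 (point Dia)) : D.ExactL δ := by
  intro X Y e he
  have hδ : IsIso δ := NatIso.isIso_of_isIso_app _
  have hsq := isIso_square_app (D := D) δ
  refine UnivL.of_comp_map (eqToHom (D.pull_id_obj _ Y)) fun N => ?_
  have e₁ := (he N)
  have e₂ := bijective_pull_toPoint_of_adj adj X N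
  have e₃ := (Iso.homCongr (Iso.refl ((D.pull R).obj X))
    (asIso ((D.square δ).app N) ≪≫ (D.pull (toPoint P)).mapIso
      (eqToIso (D.pull_id_obj _ N)))).bijective
  -- The required map is a composite of three bijections: the universal property over `Q`,
  -- restriction along `R`, and transport along the square.
  refine (congrArg Function.Bijective (funext fun g => ?_)).mpr ((e₃.comp e₂).comp e₁)
  have hn := (D.square δ).naturality g
  simp only [Functor.comp_map, D.pull_id_map, Functor.map_comp, Functor.comp_obj] at hn
  simp only [Functor.comp_obj, Function.comp_apply, Iso.homCongr_apply, Functor.map_comp,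
    Iso.refl_inv, Iso.trans_hom, asIso_hom, Functor.mapIso_hom, eqToIso.hom, Category.assoc,
    Category.id_comp, reassoc_of% hn, eqToHom_map, eqToHom_trans, eqToHom_refl, Category.comp_id]

/-- The working form of (Der4): a colimit over the slice may be computed over any `P` whose functor
to the slice is a right adjoint. The comma square is pasted with the square of that functor. -/
theorem FinalAt.exactL (hD : D.IsDerivator) {J K P : Shape Dia} {t : J ⥤ K} {c : point Dia ⥤ K}
    {p : P ⥤ J} {α : p ⋙ t ⟶ toPoint P ⋙ c} (h : FinalAt α) : D.ExactL α := by
  obtain ⟨k, rfl⟩ : ∃ k, c = Shape.pt k := ⟨_, Shape.exists_eq_pt c⟩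
  -- The object `x` and the arrow `m` supplied by `FinalAt` are the value and the unit of the left
  -- adjoint.
  have hR : (toSliceOver α).IsRightAdjoint := by
    refine isRightAdjoint_of_univL fun Y => ?_
    obtain ⟨x, m, hm, hx⟩ := h Y.left Y.hom
    refine ⟨x, CostructuredArrow.homMk m hm, fun x' => ⟨fun f g w => ?_, fun f => ?_⟩⟩
    · obtain ⟨_, _, hu⟩ := hx x' (m ≫ p.map f) (by
        rw [t.map_comp, Category.assoc]
        exact (congrArg (t.map m ≫ ·) ((α.naturality f).trans (Category.comp_id _))).trans hm)
      exact (hu f rfl).trans (hu g (congrArg CommaMorphism.left w).symm).symm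
    · obtain ⟨a, ha, -⟩ := hx x' f.left (CostructuredArrow.w f)
      exact ⟨a, CostructuredArrow.hom_ext _ _ ha⟩
  -- (Der4) concerns the unit of a chosen adjoint; any other universal arrow differs from it by the
  -- isomorphism `i`.
  have h₁ : D.ExactL (overNat t k) := by
    intro X Y e he
    obtain ⟨lu, ⟨adj⟩⟩ := hD.der3_left t
    obtain ⟨lπ, ⟨adjπ⟩⟩ := hD.der3_left (toPoint (sliceOver t k))
    have h₂ := (isIso_homEquiv_symm_iff adjπ _).1 (hD.der4_left t k adj adjπ X)
    obtain ⟨i, hi⟩ := (univL_unit adj X).exists_desc e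
    have : IsIso i := (univL_unit adj X).isIso_of_comp_map (hi.symm ▸ he)
    have h₃ := h₂.comp_map ((D.pull (pt k)).map i)
    rw [Category.assoc] at h₃
    erw [← (D.square (overNat t k)).naturality] at h₃
    simpa [← hi] using h₃
  exact ExactL.paste (exactL_of_adj (D := D) (Adjunction.ofIsRightAdjoint (toSliceOver α)) (𝟙 _))
    h₁ α fun x => ((congrArg _ (CategoryTheory.Functor.map_id _ _)).trans (Category.comp_id _)).symm

theorem bijective_pull_toPoint_of_adj' {P Q : Shape Dia} {l : P ⥤ Q} {R : Q ⥤ P} (adj : l ⊣ R)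
    (X : D.level Q) (N : D.level (point Dia)) :
    Function.Bijective fun g : (D.pull (toPoint Q)).obj N ⟶ X => (D.pull l).map g := by
  have h : IsIso ((D.pullNat adj.unit).app ((D.pull (toPoint P)).obj N)) := by
    have : IsIso (Functor.whiskerRight adj.unit (toPoint P)) := NatIso.isIso_of_isIso_app _
    rw [D.pullNat_app_pull]
    infer_instance
  have key : ∀ W, W = (D.pull R).obj ((D.pull (toPoint P)).obj N) →
      Function.Bijective fun g : W ⟶ X => (D.pull l).map g := by
    rintro _ rfl
    exact D.bijective_pull_of_adj' adj _ X
  exact key _ (D.pull_comp_obj R (toPoint P) N)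

theorem exactR_of_adj {P Q : Shape Dia} {l : P ⥤ Q} {R : Q ⥤ P} (adj : l ⊣ R)
    (δ : toPoint P ⋙ 𝟭 (point Dia) ⟶ l ⋙ toPoint Q) : D.ExactR δ := by
  intro X Y e he
  have hδ : IsIso δ := NatIso.isIso_of_isIso_app _
  have hsq := isIso_square_app (D := D) δ
  refine UnivR.of_map_comp (eqToHom (D.pull_id_obj _ Y).symm) fun N => ?_
  have e₁ := (he N)
  have e₂ := bijective_pull_toPoint_of_adj' adj X N
  have e₃ := (Iso.homCongr ((asIso ((D.square δ).app N)).symm ≪≫ (D.pull (toPoint P)).mapIso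
      (eqToIso (D.pull_id_obj _ N))) (Iso.refl ((D.pull l).obj X))).bijective
  refine (congrArg Function.Bijective (funext fun g => ?_)).mpr ((e₃.comp e₂).comp e₁)
  have hn := (D.square δ).naturality g
  simp only [Functor.comp_map, D.pull_id_map, Functor.map_comp, Functor.comp_obj,
    Category.assoc] at hn
  simp only [Functor.comp_obj, Function.comp_apply, Iso.homCongr_apply, Functor.map_comp,
    Iso.refl_hom, Iso.trans_inv, Iso.symm_inv, asIso_hom, Functor.mapIso_inv, eqToIso.inv,
    Category.assoc, Category.comp_id, ← reassoc_of% hn, eqToHom_map, eqToHom_trans_assoc,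
    eqToHom_refl, Category.id_comp]

theorem InitialAt.exactR (hD : D.IsDerivator) {J K P : Shape Dia} {t : J ⥤ K} {c : point Dia ⥤ K}
    {p : P ⥤ J} {α : toPoint P ⋙ c ⟶ p ⋙ t} (h : InitialAt α) : D.ExactR α := by
  obtain ⟨k, rfl⟩ : ∃ k, c = Shape.pt k := ⟨_, Shape.exists_eq_pt c⟩
  have hR : (toSliceUnder α).IsLeftAdjoint := by
    refine isLeftAdjoint_of_univR fun Y => ?_
    obtain ⟨x, m, hm, hx⟩ := h Y.right Y.hom
    refine ⟨x, StructuredArrow.homMk m hm, fun x' => ⟨fun f g w => ?_, fun f => ?_⟩⟩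
    · obtain ⟨_, _, hu⟩ := hx x' (p.map f ≫ m) (by
        rw [t.map_comp]
        have h₁ := (α.naturality f).symm.trans (Category.id_comp _)
        simp only [Functor.comp_map] at h₁
        rw [reassoc_of% h₁]
        exact hm)
      exact (hu f rfl).trans (hu g (congrArg CommaMorphism.right w).symm).symm
    · obtain ⟨a, ha, -⟩ := hx x' f.right (StructuredArrow.w f)
      exact ⟨a, StructuredArrow.hom_ext _ _ ha⟩
  have h₁ : D.ExactR (underNat t k) := by
    intro X Y e he
    obtain ⟨ru, ⟨adj⟩⟩ := hD.der3_right t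
    obtain ⟨rπ, ⟨adjπ⟩⟩ := hD.der3_right (toPoint (sliceUnder t k))
    have h₂ := (isIso_homEquiv_iff adjπ _).1 (hD.der4_right t k adj adjπ X)
    obtain ⟨i, hi⟩ := (univR_counit adj X).exists_lift e
    have : IsIso i := (univR_counit adj X).isIso_of_map_comp (hi.symm ▸ he)
    have h₃ := h₂.map_comp ((D.pull (pt k)).map i)
    have hn := (D.square (underNat t k)).naturality i
    simp only [Functor.comp_map] at hn
    rw [reassoc_of% hn] at h₃
    simpa [← hi] using h₃
  exact ExactR.paste (exactR_of_adj (D := D) (Adjunction.ofIsLeftAdjoint (toSliceUnder α)) (𝟙 _))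
    h₁ α fun x => ((congrArg (· ≫ _) (CategoryTheory.Functor.map_id _ _)).trans
      (Category.id_comp _)).symm

/-! ### Detection at points -/

/-- The comparison `i` from the actual left Kan extension to `Y` is tested with (Der2). At each
point its source and target both carry universal arrows over `P`, so it is invertible there. -/
theorem univL_of_points (hD : D.IsDerivator) {J K : Shape Dia} {t : J ⥤ K} {X : D.level J}
    {Y : D.level K} (e : X ⟶ (D.pull t).obj Y)
    (h : ∀ k : K, ∃ (P : Shape Dia) (p : P ⥤ J) (α : p ⋙ t ⟶ toPoint P ⋙ pt k),
      D.ExactL α ∧ UnivL (D.pull (toPoint P)) ((D.pull p).map e ≫ (D.square α).app Y)) :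
    UnivL (D.pull t) e := by
  obtain ⟨l, ⟨adj⟩⟩ := hD.der3_left t
  obtain ⟨i, hi⟩ := (univL_unit adj X).exists_desc e
  have : IsIso i := (hD.isIso_iff i).2 fun k => by
    obtain ⟨P, p, α, hα, hu⟩ := h k
    refine (hα (univL_unit adj X)).isIso_of_comp_map ?_
    have hn := (D.square α).naturality i
    simp only [Functor.comp_map] at hn
    rwa [Category.assoc, ← hn, ← Functor.map_comp_assoc, hi]
  exact hi ▸ (univL_unit adj X).comp_map i

theorem univR_of_points (hD : D.IsDerivator) {J K : Shape Dia} {t : J ⥤ K} {X : D.level J}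
    {Y : D.level K} (e : (D.pull t).obj Y ⟶ X)
    (h : ∀ k : K, ∃ (P : Shape Dia) (p : P ⥤ J) (α : toPoint P ⋙ pt k ⟶ p ⋙ t),
      D.ExactR α ∧ UnivR (D.pull (toPoint P)) ((D.square α).app Y ≫ (D.pull p).map e)) :
    UnivR (D.pull t) e := by
  obtain ⟨r, ⟨adj⟩⟩ := hD.der3_right t
  obtain ⟨i, hi⟩ := (univR_counit adj X).exists_lift e
  have : IsIso i := (hD.isIso_iff i).2 fun k => by
    obtain ⟨P, p, α, hα, hu⟩ := h k
    refine (hα (univR_counit adj X)).isIso_of_map_comp ?_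
    have hn := (D.square α).naturality i
    simp only [Functor.comp_map] at hn
    rwa [reassoc_of% hn, ← Functor.map_comp, hi]
  exact hi ▸ (univR_counit adj X).map_comp i

/-- A square is exact if it is so after pasting with suitable squares at all points. -/
theorem exactL_of_finalAt (hD : D.IsDerivator) {J₁ J₂ K₁ K₂ : Shape Dia} {t : J₁ ⥤ J₂}
    {u₁ : J₁ ⥤ K₁} {u₂ : J₂ ⥤ K₂} {s : K₁ ⥤ K₂} (δ : t ⋙ u₂ ⟶ u₁ ⋙ s)
    (h : ∀ k : K₁, ∃ (P : Shape Dia) (p : P ⥤ J₁) (α : p ⋙ u₁ ⟶ toPoint P ⋙ pt k),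
      FinalAt α ∧ FinalAt (t := u₂) (c := pt k ⋙ s) (p := p ⋙ t)
        (Functor.whiskerLeft p δ ≫ Functor.whiskerRight α s)) :
    D.ExactL δ := fun X Y e he => univL_of_points hD _ fun k => by
  obtain ⟨P, p, α, hα, hβ⟩ := h k
  exact ⟨P, p, α, hα.exactL hD, (univL_paste_iff α δ _ (fun x => rfl) e).1 (hβ.exactL hD he)⟩

/-- A square is exact if it is so after pasting with suitable squares at all points. -/
theorem exactR_of_initialAt (hD : D.IsDerivator) {J₁ J₂ K₁ K₂ : Shape Dia} {t : J₁ ⥤ J₂}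
    {u₁ : J₁ ⥤ K₁} {u₂ : J₂ ⥤ K₂} {s : K₁ ⥤ K₂} (δ : u₁ ⋙ s ⟶ t ⋙ u₂)
    (h : ∀ k : K₁, ∃ (P : Shape Dia) (p : P ⥤ J₁) (α : toPoint P ⋙ pt k ⟶ p ⋙ u₁),
      InitialAt α ∧ InitialAt (t := u₂) (c := pt k ⋙ s) (p := p ⋙ t)
        (Functor.whiskerRight α s ≫ Functor.whiskerLeft p δ)) :
    D.ExactR δ := fun X Y e he => univR_of_points hD _ fun k => by
  obtain ⟨P, p, α, hα, hβ⟩ := h k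
  exact ⟨P, p, α, hα.exactR hD, (univR_paste_iff α δ _ (fun x => rfl) e).1 (hβ.exactR hD he)⟩

/-- Here `P` is the whole slice and the induced functor is the identity. -/
theorem finalAt_overNat {J K : Shape Dia} (t : J ⥤ K) (k : K) : FinalAt (overNat t k) := by
  intro j g
  refine ⟨CostructuredArrow.mk (S := t) (T := k) (Y := j) g, 𝟙 j, ?_, fun x' h' w => ?_⟩
  · exact (congrArg (· ≫ (overNat t k).app _) (t.map_id j)).trans (Category.id_comp _)
  · exact ⟨CostructuredArrow.homMk h' w, Category.id_comp _, fun m hm =>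
      CostructuredArrow.hom_ext _ _ ((Category.id_comp _).symm.trans hm)⟩

theorem initialAt_underNat {J K : Shape Dia} (t : J ⥤ K) (k : K) : InitialAt (underNat t k) := by
  intro j g
  refine ⟨StructuredArrow.mk (S := k) (T := t) (Y := j) g, 𝟙 j, ?_, fun x' h' w => ?_⟩
  · exact (congrArg ((underNat t k).app _ ≫ ·) (t.map_id j)).trans (Category.comp_id _)
  · exact ⟨StructuredArrow.homMk h' w, Category.comp_id _, fun m hm =>
      StructuredArrow.hom_ext _ _ ((Category.comp_id _).symm.trans hm)⟩

/-- A square is exact if the functors between its slices are right adjoints. -/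
theorem exactL_of_slices (hD : D.IsDerivator) {J₁ J₂ K₁ K₂ : Shape Dia} {t : J₁ ⥤ J₂}
    {u₁ : J₁ ⥤ K₁} {u₂ : J₂ ⥤ K₂} {s : K₁ ⥤ K₂} (δ : t ⋙ u₂ ⟶ u₁ ⋙ s)
    (h : ∀ (k : K₁) (j : J₂) (g : u₂.obj j ⟶ s.obj k),
      ∃ (j₁ : J₁) (g₁ : u₁.obj j₁ ⟶ k) (h : j ⟶ t.obj j₁),
        u₂.map h ≫ δ.app j₁ ≫ s.map g₁ = g ∧
        ∀ (j' : J₁) (g' : u₁.obj j' ⟶ k) (h' : j ⟶ t.obj j'),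
          u₂.map h' ≫ δ.app j' ≫ s.map g' = g →
            ∃! m : j₁ ⟶ j', u₁.map m ≫ g' = g₁ ∧ h ≫ t.map m = h') : D.ExactL δ := by
  refine exactL_of_finalAt hD δ fun k => ⟨_, _, _, finalAt_overNat u₁ k, fun j g => ?_⟩
  obtain ⟨j₁, g₁, h₁, w, hu⟩ := h k j g
  refine ⟨CostructuredArrow.mk (S := u₁) (T := k) (Y := j₁) g₁, h₁, w, fun x' h' w' => ?_⟩
  obtain ⟨m, ⟨hm₁, hm₂⟩, hm⟩ := hu x'.left x'.hom h' w'
  exact ⟨CostructuredArrow.homMk m hm₁, hm₂, fun m' hm' =>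
    CostructuredArrow.hom_ext _ _ (hm _ ⟨CostructuredArrow.w m', hm'⟩)⟩

/-- A square is exact if the functors between its slices are left adjoints. -/
theorem exactR_of_slices (hD : D.IsDerivator) {J₁ J₂ K₁ K₂ : Shape Dia} {t : J₁ ⥤ J₂}
    {u₁ : J₁ ⥤ K₁} {u₂ : J₂ ⥤ K₂} {s : K₁ ⥤ K₂} (δ : u₁ ⋙ s ⟶ t ⋙ u₂)
    (h : ∀ (k : K₁) (j : J₂) (g : s.obj k ⟶ u₂.obj j),
      ∃ (j₁ : J₁) (g₁ : k ⟶ u₁.obj j₁) (h : t.obj j₁ ⟶ j),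
        s.map g₁ ≫ δ.app j₁ ≫ u₂.map h = g ∧
        ∀ (j' : J₁) (g' : k ⟶ u₁.obj j') (h' : t.obj j' ⟶ j),
          s.map g' ≫ δ.app j' ≫ u₂.map h' = g →
            ∃! m : j' ⟶ j₁, g' ≫ u₁.map m = g₁ ∧ t.map m ≫ h = h') : D.ExactR δ := by
  refine exactR_of_initialAt hD δ fun k => ⟨_, _, _, initialAt_underNat u₁ k, fun j g => ?_⟩
  obtain ⟨j₁, g₁, h₁, w, hu⟩ := h k j g
  refine ⟨StructuredArrow.mk (S := k) (T := u₁) (Y := j₁) g₁, h₁,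
    (Category.assoc _ _ _).trans w, fun x' h' w' => ?_⟩
  obtain ⟨m, ⟨hm₁, hm₂⟩, hm⟩ := hu x'.right x'.hom h' ((Category.assoc _ _ _).symm.trans w')
  exact ⟨StructuredArrow.homMk m hm₁, hm₂, fun m' hm' =>
    StructuredArrow.hom_ext _ _ (hm _ ⟨StructuredArrow.w m', hm'⟩)⟩

/-- A square with fully faithful horizontal functors is exact if `t` reaches all objects over the
image of `s`. -/
theorem exactL_of_sieve (hD : D.IsDerivator) {J₁ J₂ K₁ K₂ : Shape Dia} {t : J₁ ⥤ J₂}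
    {u₁ : J₁ ⥤ K₁} {u₂ : J₂ ⥤ K₂} {s : K₁ ⥤ K₂} (δ : t ⋙ u₂ ⟶ u₁ ⋙ s) [IsIso δ] [t.Full]
    [t.Faithful] [s.Full] [s.Faithful]
    (h : ∀ (k : K₁) (j : J₂), (u₂.obj j ⟶ s.obj k) → ∃ j' : J₁, Nonempty (t.obj j' ≅ j)) :
    D.ExactL δ := by
  refine exactL_of_slices hD δ fun k j g => ?_
  obtain ⟨j', ⟨i⟩⟩ := h k j g
  obtain ⟨g', hg'⟩ := s.map_surjective
    (inv (δ.app j') ≫ u₂.map i.hom ≫ g : s.obj (u₁.obj j') ⟶ s.obj k)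
  refine ⟨j', g', i.inv, by simp [hg'], fun x g₁ h' w => ?_⟩
  obtain ⟨m, hm⟩ := t.map_surjective (i.hom ≫ h')
  have hn := δ.naturality m
  simp only [Functor.comp_map] at hn
  refine ⟨m, ⟨s.map_injective ?_, by simp [hm]⟩, fun m' hm' => t.map_injective ?_⟩
  · rw [← cancel_epi (δ.app j')]
    simp only [s.map_comp]
    rw [← reassoc_of% hn, hm, hg', ← w]
    simp
  · simp [hm, ← hm'.2]

/-- The square of a fully faithful functor is exact. -/
theorem exactR_of_fullyFaithful (hD : D.IsDerivator) {J K : Shape Dia} (t : J ⥤ K) [t.Full]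
    [t.Faithful] : D.ExactR (𝟙 (𝟭 J.carrier ⋙ t)) := by
  refine exactR_of_slices hD _ fun k j g => ?_
  obtain ⟨g', hg'⟩ := t.map_surjective (g : t.obj k ⟶ t.obj j)
  refine ⟨j, g', 𝟙 j, by simp [hg'], fun x g₁ h' w => ?_⟩
  refine ⟨h', ⟨t.map_injective ?_, Category.comp_id _⟩, fun m' hm' => ?_⟩
  · rw [hg', ← w]
    simp
  · exact (Category.comp_id _).symm.trans hm'.2

end Prederivator
end Derivators

namespace Derivators

open Shape

variable {Dia : DiagramDomain.{w}}

namespace Prederivator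

variable {D : Prederivator.{w, v, u} Dia}

/-! ### Base change for products -/

/-- The slice over a point of a product is a product of slices, and the factor `A_{/a}` has the
terminal object `𝟙 a`. Hence `J_{/k}` with first coordinate `a` is final in it, and likewise over
`(t a, k)`. Used to extend in the variable `K` while restricting from `B` to `A`. -/
theorem exactL_prod_right (hD : D.IsDerivator) {A B J K : Shape Dia} (t : A ⥤ B) (r : J ⥤ K) :
    D.ExactL (t := prodMap t (𝟭 J)) (u₁ := prodMap (𝟭 A) r) (u₂ := prodMap (𝟭 B) r)
      (s := prodMap t (𝟭 K)) (𝟙 (prodMap t r)) := by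
  refine exactL_of_finalAt hD _ ?_
  rintro ⟨a, k⟩
  refine ⟨sliceOver r k, Functor.prod' ((Functor.const _).obj a) (overProj r k),
    { app := fun x => Prod.mkHom (𝟙 a) (CostructuredArrow.hom x)
      naturality := fun x y f => Prod.ext (by rfl) ((overNat r k).naturality f) }, ?_, ?_⟩
  · rintro ⟨b, j⟩ ⟨f, g⟩
    change b ⟶ a at f
    change r.obj j ⟶ k at g
    refine ⟨CostructuredArrow.mk (S := r) (T := k) (Y := j) g, Prod.mkHom f (𝟙 j),
      Prod.ext ?_ ?_, ?_⟩
    · exact (by simp : f ≫ 𝟙 a = f)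
    · exact (by simp : r.map (𝟙 j) ≫ g = g)
    · rintro x ⟨f', g'⟩ w
      change b ⟶ a at f'
      change j ⟶ x.left at g'
      have w₁ : f' ≫ 𝟙 a = f := congrArg Prod.fst w
      have w₂ : r.map g' ≫ x.hom = g := congrArg Prod.snd w
      refine ⟨CostructuredArrow.homMk g' w₂, Prod.ext ?_ ?_, fun m hm =>
        CostructuredArrow.hom_ext _ _ ?_⟩
      · exact (by simp [← w₁] : f ≫ 𝟙 a = f')
      · exact Category.id_comp g'
      · exact (Category.id_comp _).symm.trans (congrArg Prod.snd hm)
  · rintro ⟨b, j⟩ ⟨f, g⟩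
    change b ⟶ t.obj a at f
    change r.obj j ⟶ k at g
    refine ⟨CostructuredArrow.mk (S := r) (T := k) (Y := j) g, Prod.mkHom f (𝟙 j),
      Prod.ext ?_ ?_, ?_⟩
    · exact (by simp : f ≫ 𝟙 _ ≫ t.map (𝟙 a) = f)
    · exact (by simp : r.map (𝟙 j) ≫ 𝟙 _ ≫ g = g)
    · rintro x ⟨f', g'⟩ w
      change b ⟶ t.obj a at f'
      change j ⟶ x.left at g'
      have w₁ : f' ≫ 𝟙 _ ≫ t.map (𝟙 a) = f := congrArg Prod.fst w
      have w₂ : r.map g' ≫ 𝟙 _ ≫ x.hom = g := congrArg Prod.snd w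
      refine ⟨CostructuredArrow.homMk g' ((by simp : r.map g' ≫ x.hom = _).trans w₂),
        Prod.ext ?_ ?_, fun m hm => CostructuredArrow.hom_ext _ _ ?_⟩
      · exact (by simp [← w₁] : f ≫ t.map (𝟙 a) = f')
      · exact Category.id_comp g'
      · exact (Category.id_comp _).symm.trans (congrArg Prod.snd hm)

/-- The same argument with the factors exchanged. It makes the levelwise extensions along `r × id`
compatible with restriction in the parameter, so that they form a morphism of shifted prederivators.
-/
theorem exactL_prod_left (hD : D.IsDerivator) {J K M N : Shape Dia} (r : J ⥤ K) (t : M ⥤ N) :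
    D.ExactL (t := prodMap (𝟭 J) t) (u₁ := prodMap r (𝟭 M)) (u₂ := prodMap r (𝟭 N))
      (s := prodMap (𝟭 K) t) (𝟙 (prodMap r t)) := by
  refine exactL_of_finalAt hD _ ?_
  rintro ⟨k, a⟩
  refine ⟨sliceOver r k, Functor.prod' (overProj r k) ((Functor.const _).obj a),
    { app := fun x => Prod.mkHom (CostructuredArrow.hom x) (𝟙 a)
      naturality := fun x y f => Prod.ext ((overNat r k).naturality f) (by rfl) }, ?_, ?_⟩
  · rintro ⟨j, b⟩ ⟨g, f⟩
    change b ⟶ a at f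
    change r.obj j ⟶ k at g
    refine ⟨CostructuredArrow.mk (S := r) (T := k) (Y := j) g, Prod.mkHom (𝟙 j) f,
      Prod.ext ?_ ?_, ?_⟩
    · exact (by simp : r.map (𝟙 j) ≫ g = g)
    · exact (by simp : f ≫ 𝟙 a = f)
    · rintro x ⟨g', f'⟩ w
      change b ⟶ a at f'
      change j ⟶ x.left at g'
      have w₁ : f' ≫ 𝟙 a = f := congrArg Prod.snd w
      have w₂ : r.map g' ≫ x.hom = g := congrArg Prod.fst w
      refine ⟨CostructuredArrow.homMk g' w₂, Prod.ext ?_ ?_, fun m hm =>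
        CostructuredArrow.hom_ext _ _ ?_⟩
      · exact Category.id_comp g'
      · exact (by simp [← w₁] : f ≫ 𝟙 a = f')
      · exact (Category.id_comp _).symm.trans (congrArg Prod.fst hm)
  · rintro ⟨j, b⟩ ⟨g, f⟩
    change b ⟶ t.obj a at f
    change r.obj j ⟶ k at g
    refine ⟨CostructuredArrow.mk (S := r) (T := k) (Y := j) g, Prod.mkHom (𝟙 j) f,
      Prod.ext ?_ ?_, ?_⟩
    · exact (by simp : r.map (𝟙 j) ≫ 𝟙 _ ≫ g = g)
    · exact (by simp : f ≫ 𝟙 _ ≫ t.map (𝟙 a) = f)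
    · rintro x ⟨g', f'⟩ w
      change b ⟶ t.obj a at f'
      change j ⟶ x.left at g'
      have w₁ : f' ≫ 𝟙 _ ≫ t.map (𝟙 a) = f := congrArg Prod.snd w
      have w₂ : r.map g' ≫ 𝟙 _ ≫ x.hom = g := congrArg Prod.fst w
      refine ⟨CostructuredArrow.homMk g' ((by simp : r.map g' ≫ x.hom = _).trans w₂),
        Prod.ext ?_ ?_, fun m hm => CostructuredArrow.hom_ext _ _ ?_⟩
      · exact Category.id_comp g'
      · exact (by simp [← w₁] : f ≫ t.map (𝟙 a) = f')
      · exact (Category.id_comp _).symm.trans (congrArg Prod.fst hm)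

/-- This is (Der4) for the shifted prederivator. The square is tested at each `a` in `B`, where
fixing the first coordinate `a` picks out a final copy of `J_{/k}`. -/
theorem exactL_prod_overNat (hD : D.IsDerivator) (B : Shape Dia) {J K : Shape Dia} (r : J ⥤ K)
    (k : K) :
    D.ExactL (t := prodMap (𝟭 B) (overProj r k)) (u₁ := prodMap (𝟭 B) (toPoint (sliceOver r k)))
      (u₂ := prodMap (𝟭 B) r) (s := prodMap (𝟭 B) (pt k))
      (prodNat (𝟙 (𝟭 B.carrier)) (overNat r k)) := by
  refine exactL_of_finalAt hD _ ?_
  rintro ⟨a, ⟨⟨⟩⟩⟩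
  refine ⟨sliceOver r k, Functor.prod' ((Functor.const _).obj a) (𝟭 _),
    { app := fun x => Prod.mkHom (𝟙 a) (𝟙 _)
      naturality := fun x y f => Prod.ext (by rfl) (by rfl) }, ?_, ?_⟩
  · rintro ⟨b, x⟩ ⟨f, g⟩
    change b ⟶ a at f
    refine ⟨x, Prod.mkHom f (𝟙 x), Prod.ext ?_ (Subsingleton.elim _ _), ?_⟩
    · exact (by simp : f ≫ 𝟙 a = f)
    · rintro y ⟨f', g'⟩ w
      change b ⟶ a at f'
      change x ⟶ y at g'
      have w₁ : f' ≫ 𝟙 a = f := congrArg Prod.fst w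
      refine ⟨g', Prod.ext ?_ ?_, fun m hm => ?_⟩
      · exact (by simp [← w₁] : f ≫ 𝟙 a = f')
      · exact Category.id_comp g'
      · exact (Category.id_comp _).symm.trans (congrArg Prod.snd hm)
  · rintro ⟨b, j⟩ ⟨f, g⟩
    change b ⟶ a at f
    change r.obj j ⟶ k at g
    refine ⟨CostructuredArrow.mk (S := r) (T := k) (Y := j) g, Prod.mkHom f (𝟙 j),
      Prod.ext ?_ ?_, ?_⟩
    · exact (by simp : f ≫ 𝟙 _ ≫ 𝟙 a = f)
    · exact (by simp : r.map (𝟙 j) ≫ g ≫ 𝟙 _ = g)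
    · rintro x ⟨f', g'⟩ w
      change b ⟶ a at f'
      change j ⟶ x.left at g'
      have w₁ : f' ≫ 𝟙 _ ≫ 𝟙 a = f := congrArg Prod.fst w
      have w₂ : r.map g' ≫ x.hom ≫ 𝟙 k = g := congrArg Prod.snd w
      refine ⟨CostructuredArrow.homMk g' ((by simp : r.map g' ≫ x.hom = _).trans w₂),
        Prod.ext ?_ ?_, fun m hm => CostructuredArrow.hom_ext _ _ ?_⟩
      · exact (by simp [← w₁] : f ≫ 𝟙 a = f')
      · exact Category.id_comp g'
      · exact (Category.id_comp _).symm.trans (congrArg Prod.snd hm)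

theorem exactR_prod_right (hD : D.IsDerivator) {A B J K : Shape Dia} (t : A ⥤ B) (r : J ⥤ K) :
    D.ExactR (t := prodMap t (𝟭 J)) (u₁ := prodMap (𝟭 A) r) (u₂ := prodMap (𝟭 B) r)
      (s := prodMap t (𝟭 K)) (𝟙 (prodMap t r)) := by
  refine exactR_of_initialAt hD _ ?_
  rintro ⟨a, k⟩
  refine ⟨sliceUnder r k, Functor.prod' ((Functor.const _).obj a) (underProj r k),
    { app := fun x => Prod.mkHom (𝟙 a) (StructuredArrow.hom x)
      naturality := fun x y f => Prod.ext (by rfl) ((underNat r k).naturality f) }, ?_, ?_⟩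
  · rintro ⟨b, j⟩ ⟨f, g⟩
    change a ⟶ b at f
    change k ⟶ r.obj j at g
    refine ⟨StructuredArrow.mk (S := k) (T := r) (Y := j) g, Prod.mkHom f (𝟙 j),
      Prod.ext ?_ ?_, ?_⟩
    · exact (by simp : 𝟙 a ≫ f = f)
    · exact (by simp : g ≫ r.map (𝟙 j) = g)
    · rintro x ⟨f', g'⟩ w
      change a ⟶ b at f'
      change x.right ⟶ j at g'
      have w₁ : 𝟙 a ≫ f' = f := congrArg Prod.fst w
      have w₂ : x.hom ≫ r.map g' = g := congrArg Prod.snd w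
      refine ⟨StructuredArrow.homMk g' w₂, Prod.ext ?_ ?_, fun m hm =>
        StructuredArrow.hom_ext _ _ ?_⟩
      · exact (by simp [← w₁] : 𝟙 a ≫ f = f')
      · exact Category.comp_id g'
      · exact (Category.comp_id _).symm.trans (congrArg Prod.snd hm)
  · rintro ⟨b, j⟩ ⟨f, g⟩
    change t.obj a ⟶ b at f
    change k ⟶ r.obj j at g
    refine ⟨StructuredArrow.mk (S := k) (T := r) (Y := j) g, Prod.mkHom f (𝟙 j),
      Prod.ext ?_ ?_, ?_⟩
    · exact (by simp : (t.map (𝟙 a) ≫ 𝟙 _) ≫ f = f)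
    · exact (by simp : (g ≫ 𝟙 _) ≫ r.map (𝟙 j) = g)
    · rintro x ⟨f', g'⟩ w
      change t.obj a ⟶ b at f'
      change x.right ⟶ j at g'
      have w₁ : (t.map (𝟙 a) ≫ 𝟙 _) ≫ f' = f := congrArg Prod.fst w
      have w₂ : (x.hom ≫ 𝟙 _) ≫ r.map g' = g := congrArg Prod.snd w
      refine ⟨StructuredArrow.homMk g' ((by simp : x.hom ≫ r.map g' = _).trans w₂),
        Prod.ext ?_ ?_, fun m hm => StructuredArrow.hom_ext _ _ ?_⟩
      · exact (by simp [← w₁] : t.map (𝟙 a) ≫ f = f')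
      · exact Category.comp_id g'
      · exact (Category.comp_id _).symm.trans (congrArg Prod.snd hm)

theorem exactR_prod_left (hD : D.IsDerivator) {J K M N : Shape Dia} (r : J ⥤ K) (t : M ⥤ N) :
    D.ExactR (t := prodMap (𝟭 J) t) (u₁ := prodMap r (𝟭 M)) (u₂ := prodMap r (𝟭 N))
      (s := prodMap (𝟭 K) t) (𝟙 (prodMap r t)) := by
  refine exactR_of_initialAt hD _ ?_
  rintro ⟨k, a⟩
  refine ⟨sliceUnder r k, Functor.prod' (underProj r k) ((Functor.const _).obj a),
    { app := fun x => Prod.mkHom (StructuredArrow.hom x) (𝟙 a)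
      naturality := fun x y f => Prod.ext ((underNat r k).naturality f) (by rfl) }, ?_, ?_⟩
  · rintro ⟨j, b⟩ ⟨g, f⟩
    change a ⟶ b at f
    change k ⟶ r.obj j at g
    refine ⟨StructuredArrow.mk (S := k) (T := r) (Y := j) g, Prod.mkHom (𝟙 j) f,
      Prod.ext ?_ ?_, ?_⟩
    · exact (by simp : g ≫ r.map (𝟙 j) = g)
    · exact (by simp : 𝟙 a ≫ f = f)
    · rintro x ⟨g', f'⟩ w
      change a ⟶ b at f'
      change x.right ⟶ j at g'
      have w₁ : 𝟙 a ≫ f' = f := congrArg Prod.snd w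
      have w₂ : x.hom ≫ r.map g' = g := congrArg Prod.fst w
      refine ⟨StructuredArrow.homMk g' w₂, Prod.ext ?_ ?_, fun m hm =>
        StructuredArrow.hom_ext _ _ ?_⟩
      · exact Category.comp_id g'
      · exact (by simp [← w₁] : 𝟙 a ≫ f = f')
      · exact (Category.comp_id _).symm.trans (congrArg Prod.fst hm)
  · rintro ⟨j, b⟩ ⟨g, f⟩
    change t.obj a ⟶ b at f
    change k ⟶ r.obj j at g
    refine ⟨StructuredArrow.mk (S := k) (T := r) (Y := j) g, Prod.mkHom (𝟙 j) f,
      Prod.ext ?_ ?_, ?_⟩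
    · exact (by simp : (g ≫ 𝟙 _) ≫ r.map (𝟙 j) = g)
    · exact (by simp : (t.map (𝟙 a) ≫ 𝟙 _) ≫ f = f)
    · rintro x ⟨g', f'⟩ w
      change t.obj a ⟶ b at f'
      change x.right ⟶ j at g'
      have w₁ : (t.map (𝟙 a) ≫ 𝟙 _) ≫ f' = f := congrArg Prod.snd w
      have w₂ : (x.hom ≫ 𝟙 _) ≫ r.map g' = g := congrArg Prod.fst w
      refine ⟨StructuredArrow.homMk g' ((by simp : x.hom ≫ r.map g' = _).trans w₂),
        Prod.ext ?_ ?_, fun m hm => StructuredArrow.hom_ext _ _ ?_⟩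
      · exact Category.comp_id g'
      · exact (by simp [← w₁] : t.map (𝟙 a) ≫ f = f')
      · exact (Category.comp_id _).symm.trans (congrArg Prod.fst hm)

theorem exactR_prod_underNat (hD : D.IsDerivator) (B : Shape Dia) {J K : Shape Dia} (r : J ⥤ K)
    (k : K) :
    D.ExactR (t := prodMap (𝟭 B) (underProj r k)) (u₁ := prodMap (𝟭 B) (toPoint (sliceUnder r k)))
      (u₂ := prodMap (𝟭 B) r) (s := prodMap (𝟭 B) (pt k))
      (prodNat (𝟙 (𝟭 B.carrier)) (underNat r k)) := by
  refine exactR_of_initialAt hD _ ?_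
  rintro ⟨a, ⟨⟨⟩⟩⟩
  refine ⟨sliceUnder r k, Functor.prod' ((Functor.const _).obj a) (𝟭 _),
    { app := fun x => Prod.mkHom (𝟙 a) (𝟙 _)
      naturality := fun x y f => Prod.ext (by rfl) (by rfl) }, ?_, ?_⟩
  · rintro ⟨b, x⟩ ⟨f, g⟩
    change a ⟶ b at f
    refine ⟨x, Prod.mkHom f (𝟙 x), Prod.ext ?_ (Subsingleton.elim _ _), ?_⟩
    · exact (by simp : 𝟙 a ≫ f = f)
    · rintro y ⟨f', g'⟩ w
      change a ⟶ b at f'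
      change y ⟶ x at g'
      have w₁ : 𝟙 a ≫ f' = f := congrArg Prod.fst w
      refine ⟨g', Prod.ext ?_ ?_, fun m hm => ?_⟩
      · exact (by simp [← w₁] : 𝟙 a ≫ f = f')
      · exact Category.comp_id g'
      · exact (Category.comp_id _).symm.trans (congrArg Prod.snd hm)
  · rintro ⟨b, j⟩ ⟨f, g⟩
    change a ⟶ b at f
    change k ⟶ r.obj j at g
    refine ⟨StructuredArrow.mk (S := k) (T := r) (Y := j) g, Prod.mkHom f (𝟙 j),
      Prod.ext ?_ ?_, ?_⟩
    · exact (by simp : (𝟙 a ≫ 𝟙 _) ≫ f = f)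
    · exact (by simp : (𝟙 _ ≫ g) ≫ r.map (𝟙 j) = g)
    · rintro x ⟨f', g'⟩ w
      change a ⟶ b at f'
      change x.right ⟶ j at g'
      have w₁ : (𝟙 a ≫ 𝟙 _) ≫ f' = f := congrArg Prod.fst w
      have w₂ : (𝟙 k ≫ x.hom) ≫ r.map g' = g := congrArg Prod.snd w
      refine ⟨StructuredArrow.homMk g' ((by simp : x.hom ≫ r.map g' = _).trans w₂),
        Prod.ext ?_ ?_, fun m hm => StructuredArrow.hom_ext _ _ ?_⟩
      · exact (by simp [← w₁] : 𝟙 a ≫ f = f')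
      · exact Category.comp_id g'
      · exact (Category.comp_id _).symm.trans (congrArg Prod.snd hm)

end Prederivator
end Derivators

namespace Derivators

open Shape

variable {Dia : DiagramDomain.{w}}

namespace Prederivator

variable {D : Prederivator.{w, v, u} Dia}

/-! ### Shifted derivators -/

theorem pull_isEquivalence {J K : Shape Dia} (e : J.carrier ≌ K.carrier) :
    (D.pull e.functor).IsEquivalence :=
  have : IsIso (D.pullAdj e.toAdjunction).unit :=
    (NatTrans.isIso_iff_isIso_app _).2 fun X => by
      simp only [pullAdj, NatTrans.comp_app, eqToHom_app]
      have : IsIso e.toAdjunction.unit := inferInstanceAs (IsIso e.unit)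
      infer_instance
  have : IsIso (D.pullAdj e.toAdjunction).counit :=
    (NatTrans.isIso_iff_isIso_app _).2 fun X => by
      simp only [pullAdj, NatTrans.comp_app, eqToHom_app]
      have : IsIso e.toAdjunction.counit := inferInstanceAs (IsIso e.counit)
      infer_instance
  (D.pullAdj e.toAdjunction).toEquivalence.isEquivalence_inverse

/-- The canonical functor `∐ (B × K i) ⥤ B × ∐ K i`. -/
def prodSigma (B : Shape Dia) {I : Type w} (K : I → Shape Dia) :
    Shape.sigma (fun i => B.prod (K i)) ⥤ B.prod (Shape.sigma K) :=
  Sigma.desc fun i => prodMap (𝟭 B) (K' := Shape.sigma K)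
    (Sigma.incl (C := fun i => (K i).carrier) i)

/-- The canonical functor `B × ∐ K i ⥤ ∐ (B × K i)`. -/
def sigmaProd (B : Shape Dia) {I : Type w} (K : I → Shape Dia) :
    B.prod (Shape.sigma K) ⥤ Shape.sigma (fun i => B.prod (K i)) where
  obj x := ⟨x.2.1, (x.1, x.2.2)⟩
  map {x y} f := by
    obtain ⟨b, ⟨i, k⟩⟩ := x
    obtain ⟨b', ⟨i', k'⟩⟩ := y
    obtain ⟨f, ⟨g⟩⟩ := f
    exact Sigma.SigmaHom.mk (Prod.mkHom f g)
  map_id := by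
    rintro ⟨b, ⟨i, k⟩⟩
    rfl
  map_comp := by
    rintro ⟨b, ⟨i, k⟩⟩ ⟨b', ⟨i', k'⟩⟩ ⟨b'', ⟨i'', k''⟩⟩ ⟨f, ⟨g⟩⟩ ⟨f', ⟨g'⟩⟩
    rfl

/-- Products distribute over coproducts of shapes. -/
def prodSigmaEquiv (B : Shape Dia) {I : Type w} (K : I → Shape Dia) :
    (Shape.sigma (fun i => B.prod (K i))).carrier ≌ (B.prod (Shape.sigma K)).carrier :=
  CategoryTheory.Equivalence.mk (prodSigma B K) (sigmaProd B K)
    (NatIso.ofComponents (fun x => Iso.refl _) (by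
      rintro ⟨i, b, k⟩ ⟨j, b', k'⟩ ⟨f⟩
      exact (Category.comp_id _).trans (Category.id_comp _).symm))
    (NatIso.ofComponents (fun x => Iso.refl _) (by
      rintro ⟨b, ⟨i, k⟩⟩ ⟨b', ⟨i', k'⟩⟩ ⟨f, ⟨g⟩⟩
      exact (Category.comp_id _).trans (Category.id_comp _).symm))

/-- (Der1) holds because products distribute over coproducts, (Der2) because a point of `B × K` is a
pair of points, and (Der4) because multiplying a comma square by `B` keeps it exact. -/
theorem IsDerivator.shift (hD : D.IsDerivator) (B : Shape Dia) : (D.shift B).IsDerivator where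
  der1 {I} K := by
    have h₁ := hD.der1 fun i => B.prod (K i)
    have h₂ : (D.pull (prodSigma B K)).IsEquivalence := D.pull_isEquivalence (prodSigmaEquiv B K)
    let G := Functor.pi' fun i => D.pull (J := B.prod (K i)) (K := Shape.sigma fun i => B.prod (K i))
      (Sigma.incl (C := fun i => B × (K i).carrier) i)
    let e : D.pull (prodSigma B K) ⋙ G ≅ Functor.pi' fun i =>
        (D.shift B).pull (J := K i) (K := Shape.sigma K)
          (Sigma.incl (C := fun i => (K i).carrier) i) :=
      NatIso.pi' fun i => eqToIso (D.pull_comp _ (prodSigma B K)).symm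
    have : G.IsEquivalence := h₁
    exact Functor.isEquivalence_of_iso e
  der2 {K X Y} f := by
    rw [hD.isIso_iff]
    refine ⟨fun h k => (hD.isIso_iff _).2 ?_, fun h => ?_⟩
    · rintro ⟨b, ⟨⟨⟩⟩⟩
      exact (D.isIso_pull_pt_map _ _ f).2 (h (b, k))
    · rintro ⟨b, k⟩
      exact (D.isIso_pull_pt_map (J := B.prod (point Dia)) (K := B.prod K) (b, ⟨PUnit.unit⟩)
        (prodMap (𝟭 B) (pt k)) f).1
        ((hD.isIso_iff _).1 (h k) _)
  der3_left t := hD.der3_left (prodMap (𝟭 B) t)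
  der3_right t := hD.der3_right (prodMap (𝟭 B) t)
  der4_left t k _ adj _ adjπ X :=
    (isIso_homEquiv_symm_iff adjπ _).2 (exactL_prod_overNat hD B t k (univL_unit adj X))
  der4_right t k _ adj _ adjπ X :=
    (isIso_homEquiv_iff adjπ _).2 (exactR_prod_underNat hD B t k (univR_counit adj X))

/-! ### Subderivators -/

section Sub

variable {P : ∀ K, ObjectProperty (D.level K)}
  {hP : ∀ {J K : Shape Dia} (t : J ⥤ K) (X : D.level K), P K X → P J ((D.pull t).obj X)}

theorem square_sub_app {J₁ J₂ K₁ K₂ : Shape Dia} {t : J₁ ⥤ J₂} {u₁ : J₁ ⥤ K₁} {u₂ : J₂ ⥤ K₂}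
    {s : K₁ ⥤ K₂} (δ : t ⋙ u₂ ⟶ u₁ ⋙ s) (X : (D.sub P hP).level K₂) :
    (((D.sub P hP).square δ).app X).hom = (D.square δ).app X.obj := by
  rw [square_app, square_app, ObjectProperty.FullSubcategory.comp_hom,
    ObjectProperty.FullSubcategory.comp_hom, eqToHom_full_hom, eqToHom_full_hom]
  rfl

theorem univL_sub {J K : Shape Dia} {t : J ⥤ K} {X : (D.sub P hP).level J}
    {Y : (D.sub P hP).level K} {e : X ⟶ ((D.sub P hP).pull t).obj Y}
    (h : UnivL (D.pull t) (X := X.obj) (Y := Y.obj) e.hom) : UnivL ((D.sub P hP).pull t) e :=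
  fun _ => ⟨fun _ _ w => ObjectProperty.hom_ext _ (h.hom_ext
      (congrArg InducedCategory.Hom.hom w)), fun f => by
    obtain ⟨g, hg⟩ := h.exists_desc f.hom
    exact ⟨ObjectProperty.homMk g, ObjectProperty.hom_ext _ hg⟩⟩

theorem univR_sub {J K : Shape Dia} {t : J ⥤ K} {X : (D.sub P hP).level J}
    {Y : (D.sub P hP).level K} {e : ((D.sub P hP).pull t).obj Y ⟶ X}
    (h : UnivR (D.pull t) (X := X.obj) (Y := Y.obj) e.hom) : UnivR ((D.sub P hP).pull t) e :=
  fun _ => ⟨fun _ _ w => ObjectProperty.hom_ext _ (h.hom_ext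
      (congrArg InducedCategory.Hom.hom w)), fun f => by
    obtain ⟨g, hg⟩ := h.exists_lift f.hom
    exact ⟨ObjectProperty.homMk g, ObjectProperty.hom_ext _ hg⟩⟩

/-- A full subprederivator of a derivator which is closed under Kan extensions and detected on the
summands of coproducts is a derivator. -/
theorem IsDerivator.sub (hD : D.IsDerivator) [∀ K, (P K).IsClosedUnderIsomorphisms]
    (hs : ∀ {I : Type w} (K : I → Shape Dia) (X : D.level (Shape.sigma K)),
      (∀ i, P (K i) ((D.pull (J := K i) (K := Shape.sigma K)
        (Sigma.incl (C := fun i => (K i).carrier) i)).obj X)) → P _ X)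
    (hl : ∀ {J K : Shape Dia} (t : J ⥤ K) {X : D.level J} {Y : D.level K}
      (e : X ⟶ (D.pull t).obj Y), UnivL (D.pull t) e → P J X → P K Y)
    (hr : ∀ {J K : Shape Dia} (t : J ⥤ K) {X : D.level J} {Y : D.level K}
      (e : (D.pull t).obj Y ⟶ X), UnivR (D.pull t) e → P J X → P K Y) :
    (D.sub P hP).IsDerivator := by
  have hL : ∀ {J K : Shape Dia} (t : J ⥤ K) (X : (D.sub P hP).level J),
      ∃ (Y : (D.sub P hP).level K) (e : X ⟶ ((D.sub P hP).pull t).obj Y),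
        UnivL (D.pull t) (X := X.obj) (Y := Y.obj) e.hom := fun t X =>
    ⟨⟨_, hl t _ (univL_unit (hD.lanAdj t) X.obj) X.property⟩, ObjectProperty.homMk _,
      univL_unit (hD.lanAdj t) X.obj⟩
  have hR : ∀ {J K : Shape Dia} (t : J ⥤ K) (X : (D.sub P hP).level J),
      ∃ (Y : (D.sub P hP).level K) (e : ((D.sub P hP).pull t).obj Y ⟶ X),
        UnivR (D.pull t) (X := X.obj) (Y := Y.obj) e.hom := fun t X =>
    ⟨⟨_, hr t _ (univR_counit (hD.ranAdj t) X.obj) X.property⟩, ObjectProperty.homMk _,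
      univR_counit (hD.ranAdj t) X.obj⟩
  -- Universality inside the subprederivator implies universality in `D`: the Kan extension formed
  -- in `D` already lies in `P`, and the two universal arrows differ by an isomorphism.
  have hL' : ∀ {J K : Shape Dia} (t : J ⥤ K) {X : (D.sub P hP).level J}
      {Y : (D.sub P hP).level K} (e : X ⟶ ((D.sub P hP).pull t).obj Y),
      UnivL ((D.sub P hP).pull t) e → UnivL (D.pull t) (X := X.obj) (Y := Y.obj) e.hom := by
    intro J K t X Y e he
    obtain ⟨Y', e', he'⟩ := hL t X
    obtain ⟨i, rfl⟩ := (univL_sub he').exists_desc e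
    have := (univL_sub he').isIso_of_comp_map he
    exact he'.comp_map i.hom
  have hR' : ∀ {J K : Shape Dia} (t : J ⥤ K) {X : (D.sub P hP).level J}
      {Y : (D.sub P hP).level K} (e : ((D.sub P hP).pull t).obj Y ⟶ X),
      UnivR ((D.sub P hP).pull t) e → UnivR (D.pull t) (X := X.obj) (Y := Y.obj) e.hom := by
    intro J K t X Y e he
    obtain ⟨Y', e', he'⟩ := hR t X
    obtain ⟨i, rfl⟩ := (univR_sub he').exists_lift e
    have := (univR_sub he').isIso_of_map_comp he
    exact he'.map_comp i.hom
  have hiso : ∀ {K : Shape Dia} {X Y : (D.sub P hP).level K} (f : X ⟶ Y),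
      IsIso f ↔ IsIso f.hom := fun {K} X Y f =>
    (isIso_iff_of_reflects_iso f (P K).ι).symm
  exact
  { der1 := fun {I} K => by
      have h := hD.der1 K
      let G := Functor.pi' fun i => D.pull (J := K i) (K := Shape.sigma K)
        (Sigma.incl (C := fun i => (K i).carrier) i)
      have hG : G.IsEquivalence := h
      refine { faithful := ⟨fun {X Y f g} w => ?_⟩, full := ⟨fun {X Y} f => ?_⟩, essSurj := ⟨fun X => ?_⟩ }
      · refine ObjectProperty.hom_ext _ (G.map_injective (funext fun i => ?_))
        have h₁ := congrArg InducedCategory.Hom.hom (congrFun w i)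
        exact h₁
      · obtain ⟨g, hg⟩ := G.map_surjective (X := X.obj) (Y := Y.obj) fun i => (f i).hom
        exact ⟨ObjectProperty.homMk g, funext fun i => ObjectProperty.hom_ext _ (congrFun hg i)⟩
      · let i := G.objObjPreimageIso fun i => (X i).obj
        -- Essential surjectivity is the only part of (Der1) that needs `P` to be detected on
        -- summands.
        refine ⟨⟨G.objPreimage fun i => (X i).obj, hs K _ fun j => ?_⟩, ⟨Pi.isoMk fun j => ?_⟩⟩
        · exact (P _).prop_of_iso (Pi.isoApp i j).symm (X j).property
        · exact (P _).isoMk (Pi.isoApp i j)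
    der2 := fun {K X Y} f => by
      rw [hiso, hD.isIso_iff]
      exact forall_congr' fun k => (hiso (((D.sub P hP).pull (pt k)).map f)).symm
    der3_left := fun t => isRightAdjoint_of_univL fun X => by
      obtain ⟨Y, e, he⟩ := hL t X
      exact ⟨Y, e, univL_sub he⟩
    der3_right := fun t => isLeftAdjoint_of_univR fun X => by
      obtain ⟨Y, e, he⟩ := hR t X
      exact ⟨Y, e, univR_sub he⟩
    der4_left := fun t k _ adj _ adjπ X => by
      refine (isIso_homEquiv_symm_iff adjπ _).2 (univL_sub ?_)
      have h := (finalAt_overNat t k).exactL hD (hL' t _ (univL_unit adj X))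
      rw [← square_sub_app (hP := hP)] at h
      exact h
    der4_right := fun t k _ adj _ adjπ X => by
      refine (isIso_homEquiv_iff adjπ _).2 (univR_sub ?_)
      have h := (initialAt_underNat t k).exactR hD (hR' t _ (univR_counit adj X))
      rw [← square_sub_app (hP := hP)] at h
      exact h }

end Sub

/-! ### The vanishing subderivator -/

theorem vanishes_iff (hD : D.IsDerivator) (hpt : D.IsPointed) {B : Shape Dia}
    (A : ObjectProperty B) (K : Shape Dia) (X : D.level (B.prod K)) :
    D.Vanishes A K X ↔ ∀ (b : B) (k : K), A b → ZeroAt X ((b, k) : B.prod K) := by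
  rw [Vanishes, hD.isZero_iff hpt]
  refine ⟨fun h b k hb => ?_, fun h => ?_⟩
  · exact (zeroAt_pull _ X _).1 (h (⟨b, hb⟩, k))
  · rintro ⟨⟨b, hb⟩, k⟩
    exact (zeroAt_pull (J := (B.full A).prod K) (prodMap (J := B.full A) A.ι (𝟭 K)) X _).2 (h b k hb)

instance {B : Shape Dia} (A : ObjectProperty B) (K : Shape Dia) :
    (D.Vanishes A K).IsClosedUnderIsomorphisms where
  of_iso e h := IsZero.of_iso h ((D.pull _).mapIso e.symm)

/-- By base change, the restriction to `A` of a Kan extension in the variable `K` is the Kan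
extension of the restriction to `A`, and a Kan extension of zero is zero. -/
theorem isDerivator_vanishing (hD : D.IsDerivator) (hpt : D.IsPointed) {B : Shape Dia}
    (A : ObjectProperty B) : (D.vanishing hD A).IsDerivator := by
  have hz := hD.hasZeroObject hpt
  refine (hD.shift B).sub (P := D.Vanishes A) (hP := hD.vanishes_pull A) ?_ ?_ ?_
  · intro I K X h
    simp only [vanishes_iff hD hpt A] at h ⊢
    rintro b ⟨i, k⟩ hb
    exact (zeroAt_pull (J := B.prod (K i)) (K := B.prod (Shape.sigma K))
      (prodMap (𝟭 B) (K' := Shape.sigma K)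
        (Sigma.incl (C := fun i => (K i).carrier) i)) X (b, k)).1 (h i b k hb)
  · intro J K t X Y e he hX
    exact (exactL_prod_right hD (A := B.full A) A.ι t he).isZero hX
  · intro J K t X Y e he hX
    exact (exactR_prod_right hD (A := B.full A) A.ι t he).isZero hX

theorem isPointed_vanishing (hD : D.IsDerivator) (hpt : D.IsPointed) {B : Shape Dia}
    (A : ObjectProperty B) : (D.vanishing hD A).IsPointed := by
  obtain ⟨O, hO⟩ := (hD.hasZeroObject hpt (B.prod (point Dia))).zero
  refine ⟨⟨O, hD.isZero_pull _ hO⟩, fun Y => ?_, fun Y => ?_⟩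
  · exact ⟨⟨⟨ObjectProperty.homMk (hO.to_ Y.obj)⟩, fun f =>
      ObjectProperty.hom_ext _ (hO.eq_of_src _ _)⟩⟩
  · exact ⟨⟨⟨ObjectProperty.homMk (hO.from_ Y.obj)⟩, fun f =>
      ObjectProperty.hom_ext _ (hO.eq_of_tgt _ _)⟩⟩

end Prederivator
end Derivators

namespace Derivators

open Shape

variable {Dia : DiagramDomain.{w}}

/-! ### Morphisms and modifications of prederivators in components -/

namespace Mor

variable {D E : Prederivator.{w, v, u} Dia}

/-- The component `t^* Φ X ⟶ Φ t^* X` of the structure isomorphism. -/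
def str (Φ : Mor D E) {J K : Shape Dia} (t : J ⥤ K) (X : D.level K) :
    (E.pull t).obj ((Φ.app K).obj X) ⟶ (Φ.app J).obj ((D.pull t).obj X) :=
  (Φ.γ t).hom.app X

instance (Φ : Mor D E) {J K : Shape Dia} (t : J ⥤ K) (X : D.level K) : IsIso (Φ.str t X) :=
  inferInstanceAs (IsIso ((Φ.γ t).hom.app X))

theorem str_naturality (Φ : Mor D E) {J K : Shape Dia} (t : J ⥤ K) {X Y : D.level K}
    (f : X ⟶ Y) : (E.pull t).map ((Φ.app K).map f) ≫ Φ.str t Y =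
      Φ.str t X ≫ (Φ.app J).map ((D.pull t).map f) :=
  (Φ.γ t).hom.naturality f

theorem str_naturality_assoc (Φ : Mor D E) {J K : Shape Dia} (t : J ⥤ K) {X Y : D.level K}
    (f : X ⟶ Y) {Z : E.level J} (g : (Φ.app J).obj ((D.pull t).obj Y) ⟶ Z) :
    (E.pull t).map ((Φ.app K).map f) ≫ Φ.str t Y ≫ g =
      Φ.str t X ≫ (Φ.app J).map ((D.pull t).map f) ≫ g := by
  rw [← Category.assoc, str_naturality, Category.assoc]

theorem str_id (Φ : Mor D E) (K : Shape Dia) (X : D.level K) :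
    Φ.str (𝟭 K) X = eqToHom (E.pull_id_obj K ((Φ.app K).obj X)) ≫
      (Φ.app K).map (eqToHom (D.pull_id_obj K X).symm) :=
  Φ.γ_id K X

theorem str_comp (Φ : Mor D E) {I J K : Shape Dia} (t : I ⥤ J) (s : J ⥤ K) (X : D.level K) :
    Φ.str (t ⋙ s) X = eqToHom (E.pull_comp_obj t s ((Φ.app K).obj X)) ≫
      (E.pull t).map (Φ.str s X) ≫ Φ.str t ((D.pull s).obj X) ≫
        (Φ.app I).map (eqToHom (D.pull_comp_obj t s X).symm) :=
  Φ.γ_comp t s X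

theorem pullNat_str (Φ : Mor D E) {J K : Shape Dia} {t s : J ⥤ K} (α : t ⟶ s) (X : D.level K) :
    (E.pullNat α).app ((Φ.app K).obj X) ≫ Φ.str s X =
      Φ.str t X ≫ (Φ.app J).map ((D.pullNat α).app X) :=
  Φ.γ_naturality α X

theorem pullNat_str_assoc (Φ : Mor D E) {J K : Shape Dia} {t s : J ⥤ K} (α : t ⟶ s)
    (X : D.level K) {Z : E.level J} (g : (Φ.app J).obj ((D.pull s).obj X) ⟶ Z) :
    (E.pullNat α).app ((Φ.app K).obj X) ≫ Φ.str s X ≫ g =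
      Φ.str t X ≫ (Φ.app J).map ((D.pullNat α).app X) ≫ g := by
  rw [← Category.assoc, pullNat_str, Category.assoc]

/-- Construct a morphism of prederivators from components of the structure isomorphisms. -/
noncomputable def ofStr (app : ∀ K : Shape Dia, D.level K ⥤ E.level K)
    (g : ∀ {J K : Shape Dia} (t : J ⥤ K) (X : D.level K),
      (E.pull t).obj ((app K).obj X) ⟶ (app J).obj ((D.pull t).obj X))
    (hg : ∀ {J K : Shape Dia} (t : J.carrier ⥤ K.carrier) X, IsIso (g t X))
    (nat : ∀ {J K : Shape Dia} (t : J ⥤ K) {X Y : D.level K} (f : X ⟶ Y),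
      (E.pull t).map ((app K).map f) ≫ g t Y = g t X ≫ (app J).map ((D.pull t).map f))
    (map_id : ∀ (K : Shape Dia) (X : D.level K),
      g (𝟭 K) X = eqToHom (E.pull_id_obj K ((app K).obj X)) ≫
        (app K).map (eqToHom (D.pull_id_obj K X).symm))
    (map_comp : ∀ {I J K : Shape Dia} (t : I ⥤ J) (s : J ⥤ K) (X : D.level K),
      g (t ⋙ s) X = eqToHom (E.pull_comp_obj t s ((app K).obj X)) ≫
        (E.pull t).map (g s X) ≫ g t ((D.pull s).obj X) ≫
          (app I).map (eqToHom (D.pull_comp_obj t s X).symm))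
    (nat₂ : ∀ {J K : Shape Dia} {t s : J ⥤ K} (α : t ⟶ s) (X : D.level K),
      (E.pullNat α).app ((app K).obj X) ≫ g s X = g t X ≫ (app J).map ((D.pullNat α).app X)) :
    Mor D E where
  app := app
  γ t := NatIso.ofComponents
    (fun X => @asIso _ _ _ _ (g t X) (hg t X)) (fun f => nat t f)
  γ_id := map_id
  γ_comp := map_comp
  γ_naturality := nat₂

/-! ### Adjoints of morphisms of prederivators -/

section LeftAdjoint

variable (Ψ : Mor E D) {l : ∀ K, D.level K ⥤ E.level K}
  {η : ∀ (K : Shape Dia) (X : D.level K), X ⟶ (Ψ.app K).obj ((l K).obj X)}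
  (hη : ∀ (K : Shape Dia) (X : D.level K), UnivL (Ψ.app K) (η K X))
  (nat : ∀ {K : Shape Dia} {X Y : D.level K} (f : X ⟶ Y),
    η K X ≫ (Ψ.app K).map ((l K).map f) = f ≫ η K Y)
  (h : ∀ {J K : Shape Dia} (t : J ⥤ K) (X : D.level K), UnivL (Ψ.app J)
    ((D.pull t).map (η K X) ≫ Ψ.str t ((l K).obj X)))

/-- The structure map of a levelwise left adjoint. -/
noncomputable def leftAdjointStr {J K : Shape Dia} (t : J ⥤ K) (X : D.level K) :
    (E.pull t).obj ((l K).obj X) ⟶ (l J).obj ((D.pull t).obj X) :=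
  ((h t X).exists_desc (η J ((D.pull t).obj X))).choose

theorem unit_comp_leftAdjointStr {J K : Shape Dia} (t : J ⥤ K) (X : D.level K) :
    (D.pull t).map (η K X) ≫ Ψ.str t ((l K).obj X) ≫
      (Ψ.app J).map (leftAdjointStr Ψ h t X) = η J ((D.pull t).obj X) :=
  (Category.assoc _ _ _).symm.trans
    ((h t X).exists_desc (η J ((D.pull t).obj X))).choose_spec

theorem unit_comp_leftAdjointStr_assoc {J K : Shape Dia} (t : J ⥤ K) (X : D.level K)
    {Z : D.level J} (g : (Ψ.app J).obj ((l J).obj ((D.pull t).obj X)) ⟶ Z) :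
    (D.pull t).map (η K X) ≫ Ψ.str t ((l K).obj X) ≫
      (Ψ.app J).map (leftAdjointStr Ψ h t X) ≫ g = η J ((D.pull t).obj X) ≫ g := by
  rw [← unit_comp_leftAdjointStr Ψ h t X]
  simp only [Category.assoc]

include h in
theorem leftAdjoint_hom_ext {J K : Shape Dia} {t : J ⥤ K} {X : D.level K} {Z : E.level J}
    {f g : (E.pull t).obj ((l K).obj X) ⟶ Z}
    (w : (D.pull t).map (η K X) ≫ Ψ.str t ((l K).obj X) ≫ (Ψ.app J).map f =
      (D.pull t).map (η K X) ≫ Ψ.str t ((l K).obj X) ≫ (Ψ.app J).map g) :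
    f = g :=
  (h t X).hom_ext (by simpa using w)

/-- A levelwise left adjoint of a morphism of prederivators, as a morphism of prederivators. -/
noncomputable def leftAdjoint : Mor D E :=
  ofStr l (fun t X => leftAdjointStr Ψ h t X)
    -- The structure map compares two universal arrows out of `t^* X`: the restricted unit, by `h`,
    -- and the unit of the restriction, by `hη`.
    (fun t X => (h t X).isIso_of_comp_map (g := leftAdjointStr Ψ h t X) (by
      rw [Category.assoc, unit_comp_leftAdjointStr]
      exact hη _ _))
    (fun t X Y f => by
      apply leftAdjoint_hom_ext Ψ h
      simp only [Functor.map_comp]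
      rw [← str_naturality_assoc, ← Functor.map_comp_assoc, nat,
        Functor.map_comp_assoc, unit_comp_leftAdjointStr, unit_comp_leftAdjointStr_assoc, nat])
    (fun K X => by
      apply leftAdjoint_hom_ext Ψ h
      rw [unit_comp_leftAdjointStr, D.pull_id_map, str_id]
      simp only [eqToHom_map, Category.assoc, eqToHom_trans]
      -- The identification is written as the image under `Ψ` and `l` of an arrow, so that
      -- naturality of `η` applies to it.
      rw [← eqToHom_map (Ψ.app K) (congrArg (l K).obj (D.pull_id_obj K X).symm),
        ← eqToHom_map (l K) (D.pull_id_obj K X).symm, nat]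
      simp)
    (fun t s X => by
      apply leftAdjoint_hom_ext Ψ h
      rw [unit_comp_leftAdjointStr, D.pull_comp_map, str_comp]
      simp only [Functor.map_comp, Category.assoc, eqToHom_map, eqToHom_trans_assoc,
        eqToHom_refl, Category.id_comp]
      rw [← str_naturality_assoc]
      simp only [← Functor.map_comp_assoc]
      rw [unit_comp_leftAdjointStr, unit_comp_leftAdjointStr_assoc]
      rw [← eqToHom_map (Ψ.app _) (congrArg (l _).obj (D.pull_comp_obj t s X).symm),
        ← eqToHom_map (l _) (D.pull_comp_obj t s X).symm, nat]
      simp)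
    (fun {J K t s} α X => by
      apply leftAdjoint_hom_ext Ψ h
      simp only [Functor.map_comp]
      rw [unit_comp_leftAdjointStr_assoc, nat, ← pullNat_str_assoc]
      have hn := (D.pullNat α).naturality (η K X)
      rw [reassoc_of% hn, unit_comp_leftAdjointStr])

end LeftAdjoint

section RightAdjoint

variable (Ψ : Mor E D) {r : ∀ K, D.level K ⥤ E.level K}
  {ε : ∀ (K : Shape Dia) (X : D.level K), (Ψ.app K).obj ((r K).obj X) ⟶ X}
  (hε : ∀ (K : Shape Dia) (X : D.level K), UnivR (Ψ.app K) (ε K X))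
  (nat : ∀ {K : Shape Dia} {X Y : D.level K} (f : X ⟶ Y),
    (Ψ.app K).map ((r K).map f) ≫ ε K Y = ε K X ≫ f)
  (h : ∀ {J K : Shape Dia} (t : J ⥤ K) (X : D.level K), UnivR (Ψ.app J)
    (inv (Ψ.str t ((r K).obj X)) ≫ (D.pull t).map (ε K X)))

/-- The structure map of a levelwise right adjoint. -/
noncomputable def rightAdjointStr {J K : Shape Dia} (t : J ⥤ K) (X : D.level K) :
    (E.pull t).obj ((r K).obj X) ⟶ (r J).obj ((D.pull t).obj X) :=
  ((hε J ((D.pull t).obj X)).exists_lift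
    (inv (Ψ.str t ((r K).obj X)) ≫ (D.pull t).map (ε K X))).choose

theorem rightAdjointStr_comp_counit {J K : Shape Dia} (t : J ⥤ K) (X : D.level K) :
    (Ψ.app J).map (rightAdjointStr Ψ hε t X) ≫ ε J ((D.pull t).obj X) =
      inv (Ψ.str t ((r K).obj X)) ≫ (D.pull t).map (ε K X) :=
  ((hε J ((D.pull t).obj X)).exists_lift
    (inv (Ψ.str t ((r K).obj X)) ≫ (D.pull t).map (ε K X))).choose_spec

theorem str_comp_rightAdjointStr {J K : Shape Dia} (t : J ⥤ K) (X : D.level K) :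
    Ψ.str t ((r K).obj X) ≫ (Ψ.app J).map (rightAdjointStr Ψ hε t X) ≫
      ε J ((D.pull t).obj X) = (D.pull t).map (ε K X) := by
  rw [rightAdjointStr_comp_counit, IsIso.hom_inv_id_assoc]

theorem str_comp_rightAdjointStr_assoc {J K : Shape Dia} (t : J ⥤ K) (X : D.level K)
    {Z : D.level J} (g : (D.pull t).obj X ⟶ Z) :
    Ψ.str t ((r K).obj X) ≫ (Ψ.app J).map (rightAdjointStr Ψ hε t X) ≫
      ε J ((D.pull t).obj X) ≫ g = (D.pull t).map (ε K X) ≫ g := by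
  rw [← str_comp_rightAdjointStr Ψ hε t X]
  simp only [Category.assoc]

include hε in
theorem rightAdjoint_hom_ext {J K : Shape Dia} {t : J ⥤ K} {Z : E.level K} {X : D.level J}
    {f g : (E.pull t).obj Z ⟶ (r J).obj X}
    (w : Ψ.str t Z ≫ (Ψ.app J).map f ≫ ε J X = Ψ.str t Z ≫ (Ψ.app J).map g ≫ ε J X) :
    f = g :=
  (hε J X).hom_ext ((cancel_epi (Ψ.str t Z)).1 w)

/-- A levelwise right adjoint of a morphism of prederivators, as a morphism of prederivators. -/
noncomputable def rightAdjoint : Mor D E :=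
  ofStr r (fun t X => rightAdjointStr Ψ hε t X)
    (fun t X => (hε _ _).isIso_of_map_comp (g := rightAdjointStr Ψ hε t X) (by
      rw [rightAdjointStr_comp_counit]
      exact h _ _))
    (fun t X Y f => by
      apply rightAdjoint_hom_ext Ψ hε
      simp only [Functor.map_comp, Category.assoc]
      rw [nat, ← str_naturality_assoc, str_comp_rightAdjointStr, str_comp_rightAdjointStr_assoc,
        ← Functor.map_comp, ← Functor.map_comp, nat])
    (fun K X => by
      apply rightAdjoint_hom_ext Ψ hε
      rw [str_comp_rightAdjointStr, D.pull_id_map, str_id]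
      simp only [Functor.map_comp, Category.assoc]
      rw [nat]
      simp [eqToHom_map])
    (fun t s X => by
      apply rightAdjoint_hom_ext Ψ hε
      rw [str_comp_rightAdjointStr, D.pull_comp_map, str_comp]
      simp only [Functor.map_comp, Category.assoc]
      rw [nat]
      simp only [eqToHom_map, eqToHom_trans_assoc, eqToHom_refl, Category.id_comp]
      rw [← str_naturality_assoc, str_comp_rightAdjointStr_assoc]
      simp only [← Functor.map_comp_assoc]
      rw [str_comp_rightAdjointStr])
    (fun {J K t s} α X => by
      apply rightAdjoint_hom_ext Ψ hε
      simp only [Functor.map_comp, Category.assoc]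
      rw [nat, ← pullNat_str_assoc, str_comp_rightAdjointStr, str_comp_rightAdjointStr_assoc]
      exact ((D.pullNat α).naturality (ε K X)).symm)

end RightAdjoint

/-! ### Whiskering of modifications -/

variable {F : Prederivator.{w, v, u} Dia}

theorem modification_comm {Φ Ψ : Mor D E} (ρ : Φ ⟶ Ψ) {J K : Shape Dia} (t : J ⥤ K)
    (X : D.level K) :
    (E.pull t).map ((ρ.app K).app X) ≫ Ψ.str t X = Φ.str t X ≫ (ρ.app J).app ((D.pull t).obj X) :=
  ρ.comm t X

theorem modification_comm_assoc {Φ Ψ : Mor D E} (ρ : Φ ⟶ Ψ) {J K : Shape Dia} (t : J ⥤ K)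
    (X : D.level K) {Z : E.level J} (g : (Ψ.app J).obj ((D.pull t).obj X) ⟶ Z) :
    (E.pull t).map ((ρ.app K).app X) ≫ Ψ.str t X ≫ g =
      Φ.str t X ≫ (ρ.app J).app ((D.pull t).obj X) ≫ g := by
  rw [← Category.assoc, modification_comm, Category.assoc]

theorem comp_str (Φ : Mor D E) (Ψ : Mor E F) {J K : Shape Dia} (t : J ⥤ K) (X : D.level K) :
    (Φ.comp Ψ).str t X = Ψ.str t ((Φ.app K).obj X) ≫ (Ψ.app J).map (Φ.str t X) :=
  rfl

theorem id_str {J K : Shape Dia} (t : J ⥤ K) (X : D.level K) :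
    (Mor.id D).str t X = 𝟙 _ :=
  rfl

/-- Construct a modification from its components. -/
def modOfApp {Φ Ψ : Mor D E} (app : ∀ K : Shape Dia, Φ.app K ⟶ Ψ.app K)
    (comm : ∀ {J K : Shape Dia} (t : J ⥤ K) (X : D.level K),
      (E.pull t).map ((app K).app X) ≫ Ψ.str t X = Φ.str t X ≫ (app J).app ((D.pull t).obj X)) :
    Φ ⟶ Ψ :=
  Modification.mk app comm

/-- A modification with invertible components is an isomodification. -/
noncomputable def isoOfIsIsoApp {Φ Ψ : Mor D E} (ρ : Φ ⟶ Ψ)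
    (hρ : ∀ (K : Shape Dia) (X : D.level K), IsIso ((ρ.app K).app X)) : Φ ≅ Ψ where
  hom := ρ
  inv := modOfApp (fun K => { app := fun X => inv ((ρ.app K).app X) }) (by
    intro J K t X
    simp only [Functor.map_inv]
    rw [IsIso.inv_comp_eq, ← Category.assoc, IsIso.eq_comp_inv]
    exact (modification_comm ρ t X).symm)
  hom_inv_id := Modification.ext (funext fun K => by
    ext X; exact IsIso.hom_inv_id ((ρ.app K).app X))
  inv_hom_id := Modification.ext (funext fun K => by
    ext X; exact IsIso.inv_hom_id ((ρ.app K).app X))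

instance isIso_modification_hom_app {Φ Ψ : Mor D E} (e : Φ ≅ Ψ) (K : Shape Dia) (X : D.level K) :
    IsIso ((e.hom.app K).app X) := by
  refine ⟨(e.inv.app K).app X, ?_, ?_⟩
  · exact congrArg (fun ρ => (Modification.app ρ K).app X) e.hom_inv_id
  · exact congrArg (fun ρ => (Modification.app ρ K).app X) e.inv_hom_id

/-- Whiskering of a modification. -/
def whiskerRight {Φ Φ' : Mor D E} (ρ : Φ ⟶ Φ') (Ψ : Mor E F) : Φ.comp Ψ ⟶ Φ'.comp Ψ :=
  modOfApp (fun K => Functor.whiskerRight (ρ.app K) (Ψ.app K)) (by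
    intro J K t X
    have h : (F.pull t).map ((Ψ.app K).map ((ρ.app K).app X)) ≫
        Ψ.str t ((Φ'.app K).obj X) ≫ (Ψ.app J).map (Φ'.str t X) =
        (Ψ.str t ((Φ.app K).obj X) ≫ (Ψ.app J).map (Φ.str t X)) ≫
          (Ψ.app J).map ((ρ.app J).app ((D.pull t).obj X)) := by
      rw [str_naturality_assoc, Category.assoc, ← Functor.map_comp, ← Functor.map_comp,
        modification_comm]
    exact h)

/-- Whiskering of a modification. -/
def whiskerLeft (Φ : Mor D E) {Ψ Ψ' : Mor E F} (ρ : Ψ ⟶ Ψ') : Φ.comp Ψ ⟶ Φ.comp Ψ' :=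
  modOfApp (fun K => Functor.whiskerLeft (Φ.app K) (ρ.app K)) (by
    intro J K t X
    have h : (F.pull t).map ((ρ.app K).app ((Φ.app K).obj X)) ≫
        Ψ'.str t ((Φ.app K).obj X) ≫ (Ψ'.app J).map (Φ.str t X) =
        (Ψ.str t ((Φ.app K).obj X) ≫ (Ψ.app J).map (Φ.str t X)) ≫
          (ρ.app J).app ((Φ.app J).obj ((D.pull t).obj X)) := by
      rw [modification_comm_assoc, Category.assoc, (ρ.app J).naturality]
    exact h)

end Mor

namespace Prederivator

variable {D : Prederivator.{w, v, u} Dia}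

theorem pullMor_str {J K M N : Shape Dia} (t : J ⥤ K) (s : M ⥤ N) (X : D.level (K.prod N)) :
    (D.pullMor t).str s X =
      eqToHom ((D.pull_comp_obj (prodMap (𝟭 J) s) (prodMap t (𝟭 N)) X).symm.trans
        (D.pull_comp_obj (prodMap t (𝟭 M)) (prodMap (𝟭 K) s) X)) := by
  simp only [Mor.str, pullMor, eqToIso.hom, eqToHom_app]

theorem inv_of_eq_eqToHom {C : Type u} [Category.{v} C] {X Y : C} {f : X ⟶ Y} [IsIso f] (h : X = Y)
    (hf : f = eqToHom h) : inv f = eqToHom h.symm := by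
  subst h
  simp [hf]

theorem square_of_eq {J₁ J₂ K₁ K₂ : Shape Dia} {t : J₁ ⥤ J₂} {u₁ : J₁ ⥤ K₁} {u₂ : J₂ ⥤ K₂}
    {s : K₁ ⥤ K₂} (h : t ⋙ u₂ = u₁ ⋙ s) (δ : t ⋙ u₂ ⟶ u₁ ⋙ s) (hδ : δ = eqToHom h)
    (X : D.level K₂) :
    (D.square δ).app X =
      eqToHom ((D.pull_comp_obj t u₂ X).symm.trans ((congrArg (fun F => (D.pull F).obj X) h).trans
        (D.pull_comp_obj u₁ s X))) := by
  rw [hδ, D.square_app, D.pullNat_eqToHom h]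
  simp

/-- For a strictly commuting square the base change arrow is the restricted arrow up to `eqToHom`;
the proof `p` is arbitrary so as to match whichever one the goal contains. -/
theorem ExactL.univL_eqToHom {J₁ J₂ K₁ K₂ : Shape Dia} {t : J₁ ⥤ J₂} {u₁ : J₁ ⥤ K₁}
    {u₂ : J₂ ⥤ K₂} {s : K₁ ⥤ K₂} {δ : t ⋙ u₂ ⟶ u₁ ⋙ s} (hE : D.ExactL δ) (h : t ⋙ u₂ = u₁ ⋙ s)
    (hδ : δ = eqToHom h) {X : D.level J₂} {Y : D.level K₂} {e : X ⟶ (D.pull u₂).obj Y}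
    (he : UnivL (D.pull u₂) e)
    (p : (D.pull t).obj ((D.pull u₂).obj Y) = (D.pull u₁).obj ((D.pull s).obj Y)) :
    UnivL (D.pull u₁) ((D.pull t).map e ≫ eqToHom p) :=
  square_of_eq h δ hδ Y ▸ hE he

theorem ExactR.univR_eqToHom {J₁ J₂ K₁ K₂ : Shape Dia} {t : J₁ ⥤ J₂} {u₁ : J₁ ⥤ K₁}
    {u₂ : J₂ ⥤ K₂} {s : K₁ ⥤ K₂} {δ : u₁ ⋙ s ⟶ t ⋙ u₂} (hE : D.ExactR δ) (h : u₁ ⋙ s = t ⋙ u₂)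
    (hδ : δ = eqToHom h) {X : D.level J₂} {Y : D.level K₂} {e : (D.pull u₂).obj Y ⟶ X}
    (he : UnivR (D.pull u₂) e)
    (p : (D.pull u₁).obj ((D.pull s).obj Y) = (D.pull t).obj ((D.pull u₂).obj Y)) :
    UnivR (D.pull u₁) (eqToHom p ≫ (D.pull t).map e) :=
  square_of_eq h δ hδ Y ▸ hE he

/-- The Beck–Chevalley condition under which levelwise left adjoints of `pullMor t` assemble into a
morphism. -/
theorem univL_lanUnit_pullMor_str (hD : D.IsDerivator) {J K M N : Shape Dia} (t : J ⥤ K)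
    (s : M ⥤ N) (X : D.level (J.prod N)) :
    UnivL (D.pull (prodMap t (𝟭 M)))
      ((D.pull (prodMap (𝟭 J) s)).map ((hD.lanAdj (prodMap t (𝟭 N))).unit.app X) ≫
        (D.pullMor t).str s ((hD.lan (prodMap t (𝟭 N))).obj X)) := by
  rw [pullMor_str]
  exact (exactL_prod_left hD t s).univL_eqToHom rfl rfl
    (univL_unit (hD.lanAdj (prodMap t (𝟭 N))) X) _

theorem univR_pullMor_str_ranCounit (hD : D.IsDerivator) {J K M N : Shape Dia} (t : J ⥤ K)
    (s : M ⥤ N) (X : (D.shift J).level N) :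
    UnivR ((D.pullMor t).app M)
      (inv ((D.pullMor t).str s ((hD.ran (prodMap t (𝟭 N))).obj X)) ≫
        ((D.shift J).pull s).map ((hD.ranAdj (prodMap t (𝟭 N))).counit.app X)) := by
  rw [inv_of_eq_eqToHom _ (pullMor_str t s _)]
  exact (exactR_prod_left hD t s).univR_eqToHom rfl rfl
    (univR_counit (hD.ranAdj (prodMap t (𝟭 N))) X) _

/-- The left Kan extension morphism `u_! : 𝔻^J ⟶ 𝔻^K`. -/
noncomputable def IsDerivator.lanMor (hD : D.IsDerivator) {J K : Shape Dia} (t : J ⥤ K) :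
    Mor (D.shift J) (D.shift K) :=
  Mor.leftAdjoint (D.pullMor t) (l := fun M => hD.lan (prodMap t (𝟭 M)))
    (η := fun M X => (hD.lanAdj (prodMap t (𝟭 M))).unit.app X)
    (fun M X => univL_unit (hD.lanAdj (prodMap t (𝟭 M))) X)
    (fun {M} _ _ f => ((hD.lanAdj (prodMap t (𝟭 M))).unit.naturality f).symm)
    (fun s X => univL_lanUnit_pullMor_str hD t s X)

/-- The right Kan extension morphism `u_* : 𝔻^J ⟶ 𝔻^K`. -/
noncomputable def IsDerivator.ranMor (hD : D.IsDerivator) {J K : Shape Dia} (t : J ⥤ K) :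
    Mor (D.shift J) (D.shift K) :=
  Mor.rightAdjoint (D.pullMor t) (r := fun M => hD.ran (prodMap t (𝟭 M)))
    (ε := fun M X => (hD.ranAdj (prodMap t (𝟭 M))).counit.app X)
    (fun M X => univR_counit (hD.ranAdj (prodMap t (𝟭 M))) X)
    (fun {M} _ _ f => ((hD.ranAdj (prodMap t (𝟭 M))).counit.naturality f))
    (fun s X => univR_pullMor_str_ranCounit hD t s X)

end Prederivator

end Derivators

namespace Derivators

open Shape

variable {Dia : DiagramDomain.{w}}

/-! ### Reflections onto full subprederivators -/

namespace Mor

section Reflection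

variable {D : Prederivator.{w, v, u} Dia} (L : Mor D D) (P : ∀ K, ObjectProperty (D.level K))
  (hP : ∀ {J K : Shape Dia} (t : J ⥤ K) (X : D.level K), P K X → P J ((D.pull t).obj X))

/-- The corestriction of an endomorphism to a full subprederivator. -/
noncomputable def corestrict
    (hL : ∀ (K : Shape Dia) (X : D.level K), P K ((L.app K).obj X)) : Mor D (D.sub P hP) :=
  ofStr (fun K => (P K).lift (L.app K) (hL K))
    (fun t X => ObjectProperty.homMk (L.str t X))
    (fun t X => (isIso_iff_of_reflects_iso _ (P _).ι).1 (inferInstanceAs (IsIso (L.str t X))))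
    (fun t X Y f => ObjectProperty.hom_ext _ (L.str_naturality t f))
    (fun K X => by
      refine ObjectProperty.hom_ext _ ((L.str_id K X).trans ?_)
      rw [ObjectProperty.FullSubcategory.comp_hom, Prederivator.eqToHom_full_hom]
      rfl)
    (fun t s X => by
      refine ObjectProperty.hom_ext _ ((L.str_comp t s X).trans ?_)
      simp only [ObjectProperty.FullSubcategory.comp_hom, Prederivator.eqToHom_full_hom]
      rfl)
    (fun α X => ObjectProperty.hom_ext _ (L.pullNat_str α X))

theorem subIncl_str {J K : Shape Dia} (t : J ⥤ K) (X : (D.sub P hP).level K) :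
    (D.subIncl P hP).str t X = 𝟙 _ :=
  rfl

/-- The corestriction followed by the inclusion is the given endomorphism. -/
noncomputable def corestrictIncl
    (hL : ∀ (K : Shape Dia) (X : D.level K), P K ((L.app K).obj X)) :
    L ≅ (corestrict L P hP hL).comp (D.subIncl P hP) :=
  isoOfIsIsoApp (modOfApp (Ψ := (corestrict L P hP hL).comp (D.subIncl P hP))
    (fun K => 𝟙 (L.app K)) (by
      intro J K t X
      rw [comp_str, subIncl_str]
      have h : (D.pull t).map (𝟙 ((L.app K).obj X)) ≫ 𝟙 _ ≫ L.str t X = L.str t X ≫ 𝟙 _ := by simp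
      exact h))
    (fun K X => (inferInstance : IsIso (𝟙 ((L.app K).obj X))))

variable {L P}

/-- The component `X ⟶ L X` of a modification `id ⟶ L`. -/
def unitApp (η : Mor.id D ⟶ L) (K : Shape Dia) (X : D.level K) : X ⟶ (L.app K).obj X :=
  (η.app K).app X

theorem unitApp_naturality (η : Mor.id D ⟶ L) {K : Shape Dia} {X Y : D.level K} (f : X ⟶ Y) :
    f ≫ unitApp η K Y = unitApp η K X ≫ (L.app K).map f :=
  (η.app K).naturality f

theorem unitApp_naturality_assoc (η : Mor.id D ⟶ L) {K : Shape Dia} {X Y Z : D.level K}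
    (f : X ⟶ Y) (g : (L.app K).obj Y ⟶ Z) :
    f ≫ unitApp η K Y ≫ g = unitApp η K X ≫ (L.app K).map f ≫ g := by
  rw [← Category.assoc, unitApp_naturality, Category.assoc]

theorem map_unitApp_str (η : Mor.id D ⟶ L) {J K : Shape Dia} (t : J ⥤ K) (X : D.level K) :
    (D.pull t).map (unitApp η K X) ≫ L.str t X = unitApp η J ((D.pull t).obj X) :=
  (modification_comm η t X).trans (Category.id_comp _)

theorem map_unitApp_str_assoc (η : Mor.id D ⟶ L) {J K : Shape Dia} (t : J ⥤ K) (X : D.level K)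
    {Z : D.level J} (g : (L.app J).obj ((D.pull t).obj X) ⟶ Z) :
    (D.pull t).map (unitApp η K X) ≫ L.str t X ≫ g =
      unitApp η J ((D.pull t).obj X) ≫ g := by
  rw [← Category.assoc, map_unitApp_str]

variable (η : Mor.id D ⟶ L) (hL : ∀ (K : Shape Dia) (X : D.level K), P K ((L.app K).obj X))
  (hη : ∀ (K : Shape Dia) (X Y : D.level K), P K Y →
    Function.Bijective fun g : (L.app K).obj X ⟶ Y => unitApp η K X ≫ g)

include hL hη

/-- Existence against `Y` gives a retraction `g` of the unit; uniqueness against `L Y`, which lies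
in `P` too, makes `g` an inverse. -/
theorem isIso_reflection_unit {K : Shape Dia} {Y : D.level K} (hY : P K Y) :
    IsIso (unitApp η K Y) := by
  obtain ⟨g, hg : unitApp η K Y ≫ g = 𝟙 Y⟩ := (hη K Y Y hY).2 (𝟙 Y)
  refine ⟨g, hg, (hη K Y _ (hL K Y)).1 ?_⟩
  change unitApp η K Y ≫ g ≫ unitApp η K Y = unitApp η K Y ≫ 𝟙 _
  rw [reassoc_of% hg, Category.comp_id]

/-- Both sides agree after precomposition with the unit, by naturality. Hence `L η` and `η_L` are
invertible together. -/
theorem map_reflection_unit (K : Shape Dia) (X : D.level K) :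
    (L.app K).map (unitApp η K X) = unitApp η K ((L.app K).obj X) :=
  (hη K X _ (hL K _)).1 (unitApp_naturality η (unitApp η K X)).symm

/-- The inverse of the unit of a reflection at an object of the full subprederivator. -/
noncomputable def reflectionCounit {K : Shape Dia} {Y : D.level K} (hY : P K Y) :
    (L.app K).obj Y ⟶ Y :=
  haveI := isIso_reflection_unit η hL hη hY
  inv (unitApp η K Y)

theorem unit_reflectionCounit {K : Shape Dia} {Y : D.level K} (hY : P K Y) :
    unitApp η K Y ≫ reflectionCounit η hL hη hY = 𝟙 Y :=
  haveI := isIso_reflection_unit η hL hη hY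
  IsIso.hom_inv_id _

/-- The adjunction exhibiting a full subprederivator as reflective. -/
noncomputable def corestrictAdj :
    MorAdjunction (corestrict L P hP hL) (D.subIncl P hP) where
  unit := η ≫ (corestrictIncl L P hP hL).hom
  counit := modOfApp (Ψ := Mor.id (D.sub P hP))
    (fun K =>
      { app := fun Y => ObjectProperty.homMk (reflectionCounit η hL hη Y.property)
        naturality := fun Y Z f => by
          refine ObjectProperty.hom_ext _ ((hη K Y.obj Z.obj Z.property).1 ?_)
          change unitApp η K Y.obj ≫ (L.app K).map f.hom ≫ reflectionCounit η hL hη Z.property =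
            unitApp η K Y.obj ≫ reflectionCounit η hL hη Y.property ≫ f.hom
          rw [← unitApp_naturality_assoc, unit_reflectionCounit,
            ← Category.assoc (unitApp η K Y.obj), unit_reflectionCounit, Category.id_comp,
            Category.comp_id] })
    (by
      intro J K t Y
      refine ObjectProperty.hom_ext _ ?_
      rw [id_str, comp_str]
      have := isIso_reflection_unit η hL hη Y.property
      have h : (D.pull t).map (reflectionCounit η hL hη Y.property) ≫ 𝟙 _ =
          (L.str t Y.obj ≫ (L.app J).map (𝟙 _)) ≫
            reflectionCounit η hL hη (hP t _ Y.property) := by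
        rw [← cancel_epi ((D.pull t).map (unitApp η K Y.obj)), Category.comp_id,
          ← Functor.map_comp, unit_reflectionCounit, CategoryTheory.Functor.map_id,
          CategoryTheory.Functor.map_id, Category.comp_id, map_unitApp_str_assoc,
          unit_reflectionCounit]
      exact h)
  left_triangle K X := by
    refine ObjectProperty.hom_ext _ ?_
    have h : (L.app K).map (unitApp η K X ≫ 𝟙 _) ≫ reflectionCounit η hL hη (hL K X) = 𝟙 _ := by
      rw [Category.comp_id, map_reflection_unit η hL hη, unit_reflectionCounit]
    exact h
  right_triangle K Y := by
    have h : (unitApp η K Y.obj ≫ 𝟙 _) ≫ reflectionCounit η hL hη Y.property = 𝟙 _ := by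
      rw [Category.comp_id, unit_reflectionCounit]
    exact h

theorem isLocalization_corestrict :
    IsLocalization ((corestrict L P hP hL).comp (D.subIncl P hP))
      (corestrictAdj hP η hL hη).unit := by
  intro K X
  have h₁ := isIso_reflection_unit η hL hη (hL K X)
  have e : unitApp η K ((L.app K).obj X) ≫ 𝟙 _ = unitApp η K ((L.app K).obj X) :=
    Category.comp_id _
  have e' : (L.app K).map (unitApp η K X ≫ 𝟙 _) = unitApp η K ((L.app K).obj X) := by
    rw [Category.comp_id, map_reflection_unit η hL hη]
  exact ⟨(by rw [e]; exact h₁ : IsIso (unitApp η K ((L.app K).obj X) ≫ 𝟙 _)),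
    (by rw [e']; exact h₁ : IsIso ((L.app K).map (unitApp η K X ≫ 𝟙 _)))⟩

theorem essImage_corestrict [∀ K, (P K).IsClosedUnderIsomorphisms] (K : Shape Dia) :
    (((corestrict L P hP hL).comp (D.subIncl P hP)).app K).essImage = P K := by
  ext Y
  constructor
  · rintro ⟨X, ⟨e⟩⟩
    exact (P K).prop_of_iso e (hL K X)
  · intro hY
    have := isIso_reflection_unit η hL hη hY
    exact ⟨Y, ⟨(asIso (unitApp η K Y)).symm⟩⟩

end Reflection

end Mor

end Derivators

namespace Derivators

open Shape

variable {Dia : DiagramDomain.{w}}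

/-! ### Fully faithful functors of shapes -/

theorem Two.eq_zero_or_one (x : Two.{w}) : x = Two.zero ∨ x = Two.one := by
  obtain ⟨x⟩ := x
  fin_cases x
  · exact Or.inl rfl
  · exact Or.inr rfl

theorem Two.ne_of_hom {x y : Two.{w}} (f : x ⟶ y) (hx : x = Two.one) : y = Two.one := by
  subst hx
  obtain rfl | rfl := y.eq_zero_or_one
  · have h : (Two.one.{w} : Two.{w}) ≤ Two.zero := leOfHom f
    exact absurd (show (1 : Fin 2) ≤ 0 from h) (by decide)
  · rfl

section

variable {C C' E E' : Type*} [Category C] [Category C'] [Category E] [Category E']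

instance (t : C ⥤ C') (s : E ⥤ E') [t.Faithful] [s.Faithful] : (Functor.prod t s).Faithful where
  map_injective h := Prod.ext (t.map_injective (congrArg Prod.fst h))
    (s.map_injective (congrArg Prod.snd h))

instance (t : C ⥤ C') (s : E ⥤ E') [t.Full] [s.Full] : (Functor.prod t s).Full where
  map_surjective f := ⟨Prod.mkHom (t.preimage f.1) (s.preimage f.2),
    Prod.ext (t.map_preimage f.1) (s.map_preimage f.2)⟩

instance (c : E) : (Functor.prod' (𝟭 C) ((Functor.const C).obj c)).Faithful where
  map_injective h := congrArg Prod.fst h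

instance (c : E) [Subsingleton (c ⟶ c)] :
    (Functor.prod' (𝟭 C) ((Functor.const C).obj c)).Full where
  map_surjective f := ⟨f.1, Prod.ext rfl (Subsingleton.elim (α := c ⟶ c) _ _)⟩

end

namespace Prederivator

variable {D : Prederivator.{w, v, u} Dia}

theorem isIso_of_univL_pull_id {K : Shape Dia} {X Y : D.level K}
    {e : X ⟶ (D.pull (𝟭 K.carrier)).obj Y} (h : UnivL (D.pull (𝟭 K.carrier)) e) : IsIso e := by
  have key : ∀ (U : D.level K ⥤ D.level K) (_ : U = 𝟭 _) (e : X ⟶ U.obj Y), UnivL U e → IsIso e := by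
    rintro _ rfl e h
    obtain ⟨g, hg⟩ := h.exists_desc (Z := X) (𝟙 X)
    refine ⟨g, hg, h.hom_ext ?_⟩
    simp only [Functor.id_map] at hg ⊢
    rw [reassoc_of% hg, Category.comp_id]
  exact key _ (D.pull_id K) e h

theorem isIso_of_univR_pull_id {K : Shape Dia} {X Y : D.level K}
    {e : (D.pull (𝟭 K.carrier)).obj Y ⟶ X} (h : UnivR (D.pull (𝟭 K.carrier)) e) : IsIso e := by
  have key : ∀ (U : D.level K ⥤ D.level K) (_ : U = 𝟭 _) (e : U.obj Y ⟶ X), UnivR U e → IsIso e := by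
    rintro _ rfl e h
    obtain ⟨g, hg⟩ := h.exists_lift (Z := X) (𝟙 X)
    refine ⟨g, h.hom_ext ?_, hg⟩
    simp only [Functor.id_map] at hg ⊢
    rw [Category.assoc, hg, Category.comp_id]
    exact (Category.id_comp e).symm
  exact key _ (D.pull_id K) e h

theorem isIso_pull_id_map_iff {K : Shape Dia} {X Y : D.level K} (f : X ⟶ Y) :
    IsIso ((D.pull (𝟭 K.carrier)).map f) ↔ IsIso f := by
  rw [D.pull_id_map]
  simp

/-- The square of a fully faithful functor is exact. -/
theorem exactL_of_fullyFaithful (hD : D.IsDerivator) {J K : Shape Dia} (t : J ⥤ K) [t.Full]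
    [t.Faithful] : D.ExactL (𝟙 (𝟭 J.carrier ⋙ t)) :=
  exactL_of_sieve hD _ fun _ j _ => ⟨j, ⟨Iso.refl _⟩⟩

/-- Kan extension along a fully faithful functor really extends. Base change along the square with
identity functors on `J` reduces the claim to universality for `(𝟭 J)^*`, that is, to invertibility.
-/
theorem _root_.Derivators.UnivL.isIso_of_fullyFaithful (hD : D.IsDerivator) {J K : Shape Dia} {t : J ⥤ K} [t.Full]
    [t.Faithful] {X : D.level J} {Y : D.level K} {e : X ⟶ (D.pull t).obj Y}
    (h : UnivL (D.pull t) e) : IsIso e := by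
  have h₁ := isIso_of_univL_pull_id (exactL_of_fullyFaithful hD t h)
  have h₂ := isIso_square_app (D := D) (𝟙 (𝟭 J.carrier ⋙ t)) Y
  rw [isIso_comp_right_iff] at h₁
  exact (isIso_pull_id_map_iff e).1 h₁

theorem _root_.Derivators.UnivR.isIso_of_fullyFaithful (hD : D.IsDerivator) {J K : Shape Dia} {t : J ⥤ K} [t.Full]
    [t.Faithful] {X : D.level J} {Y : D.level K} {e : (D.pull t).obj Y ⟶ X}
    (h : UnivR (D.pull t) e) : IsIso e := by
  have h₁ := isIso_of_univR_pull_id (exactR_of_fullyFaithful hD t h)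
  have h₂ := isIso_square_app (D := D) (𝟙 (𝟭 J.carrier ⋙ t)) Y
  rw [isIso_comp_left_iff] at h₁
  exact (isIso_pull_id_map_iff e).1 h₁

/-! ### Pointwise recognition of Kan extensions along fully faithful functors -/

/-- `Y` is the left Kan extension of its restriction along `t`. -/
def IsLan {J K : Shape Dia} (t : J ⥤ K) (Y : D.level K) : Prop :=
  UnivL (D.pull t) (𝟙 ((D.pull t).obj Y))

/-- `Y` is the right Kan extension of its restriction along `t`. -/
def IsRan {J K : Shape Dia} (t : J ⥤ K) (Y : D.level K) : Prop :=
  UnivR (D.pull t) (𝟙 ((D.pull t).obj Y))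

theorem isLan_iff {J K : Shape Dia} (t : J ⥤ K) (Y : D.level K) :
    IsLan t Y ↔ ∀ Z, Function.Bijective fun g : Y ⟶ Z => (D.pull t).map g := univL_id_iff

theorem isRan_iff {J K : Shape Dia} (t : J ⥤ K) (Y : D.level K) :
    IsRan t Y ↔ ∀ Z, Function.Bijective fun g : Z ⟶ Y => (D.pull t).map g := univR_id_iff

theorem IsLan.pull_of_exactL {J₁ J₂ K₁ K₂ : Shape Dia} {t : J₁ ⥤ J₂} {u₁ : J₁ ⥤ K₁} {u₂ : J₂ ⥤ K₂}
    {s : K₁ ⥤ K₂} {δ : t ⋙ u₂ ⟶ u₁ ⋙ s} [IsIso δ] (hE : D.ExactL δ) {Y : D.level K₂}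
    (h : IsLan u₂ Y) : IsLan u₁ ((D.pull s).obj Y) := by
  have h₁ := isIso_square_app δ Y
  have h₂ := hE h
  exact UnivL.map_id_of_isIso h₂

/-- The value at `k` is the limit of `p^* X` over `P`, and a limit of a zero diagram is zero. -/
theorem zeroAt_of_exactR (hD : D.IsDerivator) (hpt : D.IsPointed) {J K P : Shape Dia} {t : J ⥤ K}
    {k : K} {p : P ⥤ J} {α : toPoint P ⋙ pt k ⟶ p ⋙ t} (hα : D.ExactR α) {X : D.level J}
    {Y : D.level K} {e : (D.pull t).obj Y ⟶ X} (h : UnivR (D.pull t) e)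
    (hX : IsZero ((D.pull p).obj X)) : ZeroAt Y k :=
  haveI := hD.hasZeroObject hpt (point Dia)
  (hα h).isZero hX

theorem univL_of_isZero {C E : Type*} [Category C] [Category E] {U : C ⥤ E} {X : E} {Y : C} (e : X ⟶ U.obj Y)
    (hX : IsZero X) (hY : IsZero Y) : UnivL U e := fun Z =>
  ⟨fun _ _ _ => hY.eq_of_src _ _, fun _ => ⟨hY.to_ Z, hX.eq_of_src _ _⟩⟩

theorem univR_of_isZero {C E : Type*} [Category C] [Category E] {U : C ⥤ E} {X : E} {Y : C} (e : U.obj Y ⟶ X)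
    (hX : IsZero X) (hY : IsZero Y) : UnivR U e := fun Z =>
  ⟨fun _ _ _ => hY.eq_of_tgt _ _, fun _ => ⟨hY.from_ Z, hX.eq_of_tgt _ _⟩⟩

theorem full_pull_toPoint_point : (D.pull (toPoint (point Dia))).Full ∧
    (D.pull (toPoint (point Dia))).Faithful := by
  have h : toPoint (point Dia) = 𝟭 (point Dia).carrier := by
    refine CategoryTheory.Functor.ext (fun x => rfl) fun x y f => Subsingleton.elim _ _
  rw [h, D.pull_id]
  exact ⟨inferInstance, inferInstance⟩

theorem _root_.Derivators.Shape.pt_comp_eq_toPoint_comp {J K : Shape Dia} (j : J) (t : J ⥤ K) :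
    pt j ⋙ t = toPoint (point Dia) ⋙ pt (t.obj j) :=
  (exists_eq_pt (pt j ⋙ t)).trans (exists_eq_pt (toPoint (point Dia) ⋙ pt (t.obj j))).symm

/-- For fully faithful `t` the slice over `t j` has the terminal object `(j, 𝟙)`, so a single point
is final in it. -/
theorem finalAt_pt {J K : Shape Dia} (t : J ⥤ K) [t.Full] [t.Faithful] (j : J) :
    FinalAt (eqToHom (pt_comp_eq_toPoint_comp j t)) := by
  intro j' g
  have e : ∀ x, (eqToHom (pt_comp_eq_toPoint_comp j t)).app x = 𝟙 (t.obj j) := fun x => by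
    rw [eqToHom_app]
    rfl
  obtain ⟨g', hg'⟩ := t.map_surjective (g : t.obj j' ⟶ t.obj j)
  refine ⟨⟨PUnit.unit⟩, g', ?_, fun x' h' w => ?_⟩
  · rw [e]
    exact (Category.comp_id _).trans hg'
  · rw [e] at w
    refine ⟨𝟙 _, t.map_injective ?_, fun m _ => Subsingleton.elim _ _⟩
    exact (congrArg t.map (Category.comp_id g')).trans
      (hg'.trans ((Category.comp_id _).symm.trans w).symm)

theorem initialAt_pt {J K : Shape Dia} (t : J ⥤ K) [t.Full] [t.Faithful] (j : J) :
    InitialAt (eqToHom (pt_comp_eq_toPoint_comp j t).symm) := by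
  intro j' g
  have e : ∀ x, (eqToHom (pt_comp_eq_toPoint_comp j t).symm).app x = 𝟙 (t.obj j) := fun x => by
    rw [eqToHom_app]
    rfl
  obtain ⟨g', hg'⟩ := t.map_surjective (g : t.obj j ⟶ t.obj j')
  refine ⟨⟨PUnit.unit⟩, g', ?_, fun x' h' w => ?_⟩
  · rw [e]
    exact (Category.id_comp _).trans hg'
  · rw [e] at w
    refine ⟨𝟙 _, t.map_injective ?_, fun m _ => Subsingleton.elim _ _⟩
    exact (congrArg t.map (Category.id_comp g')).trans
      (hg'.trans ((Category.id_comp _).symm.trans w).symm)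

theorem univL_of_isIso {C E : Type*} [Category C] [Category E] {U : C ⥤ E} [U.Full] [U.Faithful]
    {X : E} {Y : C} (e : X ⟶ U.obj Y) [IsIso e] : UnivL U e :=
  by simpa using UnivL.iso_comp (univL_id_iff.2 fun _ => ⟨U.map_injective, U.map_surjective⟩) e

theorem univR_of_isIso {C E : Type*} [Category C] [Category E] {U : C ⥤ E} [U.Full] [U.Faithful]
    {X : E} {Y : C} (e : U.obj Y ⟶ X) [IsIso e] : UnivR U e := by
  simpa using UnivR.comp_iso (univR_id_iff.2 fun _ => ⟨U.map_injective, U.map_surjective⟩) e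

/-- At points in the image of `t` there is nothing to check, by full faithfulness. Elsewhere the
colimit in question and the value of `Y` are both zero, so any arrow between them is universal. -/
theorem isLan_of_points (hD : D.IsDerivator) {J K : Shape Dia} (t : J ⥤ K) [t.Full] [t.Faithful]
    (Y : D.level K)
    (h : ∀ k : K, (∃ j, t.obj j = k) ∨ ZeroAt Y k ∧
      ∃ (P : Shape Dia) (p : P ⥤ J) (α : p ⋙ t ⟶ toPoint P ⋙ pt k),
        FinalAt α ∧ IsZero ((D.pull p).obj ((D.pull t).obj Y))) : IsLan t Y := by
  refine univL_of_points hD _ fun k => ?_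
  obtain ⟨j, rfl⟩ | ⟨hk, P, p, α, hα, hP⟩ := h k
  · have := full_pull_toPoint_point (D := D)
    refine ⟨point Dia, pt j, eqToHom (pt_comp_eq_toPoint_comp j t), (finalAt_pt t j).exactL hD, ?_⟩
    obtain ⟨h₁, h₂⟩ := this
    have h₃ := isIso_square_app (D := D) (eqToHom (pt_comp_eq_toPoint_comp j t)) Y
    exact univL_of_isIso _
  · exact ⟨P, p, α, hα.exactL hD, univL_of_isZero _ hP hk⟩

theorem isRan_of_points (hD : D.IsDerivator) {J K : Shape Dia} (t : J ⥤ K) [t.Full] [t.Faithful]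
    (Y : D.level K)
    (h : ∀ k : K, (∃ j, t.obj j = k) ∨ ZeroAt Y k ∧
      ∃ (P : Shape Dia) (p : P ⥤ J) (α : toPoint P ⋙ pt k ⟶ p ⋙ t),
        InitialAt α ∧ IsZero ((D.pull p).obj ((D.pull t).obj Y))) : IsRan t Y := by
  refine univR_of_points hD _ fun k => ?_
  obtain ⟨j, rfl⟩ | ⟨hk, P, p, α, hα, hP⟩ := h k
  · have := full_pull_toPoint_point (D := D)
    refine ⟨point Dia, pt j, eqToHom (pt_comp_eq_toPoint_comp j t).symm,
      (initialAt_pt t j).exactR hD, ?_⟩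
    obtain ⟨h₁, h₂⟩ := this
    have h₃ := isIso_square_app (D := D) (eqToHom (pt_comp_eq_toPoint_comp j t).symm) Y
    exact univR_of_isIso _
  · exact ⟨P, p, α, hα.exactR hD, univR_of_isZero _ hP hk⟩

theorem finalAt_of_isEmpty {J K : Shape Dia} (t : J ⥤ K) (k : K) (h : ∀ j, IsEmpty (t.obj j ⟶ k)) :
    ∃ (P : Shape Dia) (p : P ⥤ J) (α : p ⋙ t ⟶ toPoint P ⋙ pt k), FinalAt α ∧ IsEmpty P :=
  ⟨_, _, _, finalAt_overNat t k, ⟨fun x => (h x.left).false x.hom⟩⟩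

theorem initialAt_of_isEmpty {J K : Shape Dia} (t : J ⥤ K) (k : K)
    (h : ∀ j, IsEmpty (k ⟶ t.obj j)) :
    ∃ (P : Shape Dia) (p : P ⥤ J) (α : toPoint P ⋙ pt k ⟶ p ⋙ t), InitialAt α ∧ IsEmpty P :=
  ⟨_, _, _, initialAt_underNat t k, ⟨fun x => (h x.right).false x.hom⟩⟩

theorem isLan_of_isEmpty (hD : D.IsDerivator) (hpt : D.IsPointed) {J K : Shape Dia} (t : J ⥤ K)
    [t.Full] [t.Faithful] (Y : D.level K)
    (h : ∀ k : K, (∃ j, t.obj j = k) ∨ ZeroAt Y k ∧ ∀ j, IsEmpty (t.obj j ⟶ k)) : IsLan t Y := by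
  refine isLan_of_points hD t Y fun k => (h k).imp_right fun ⟨h₁, h₂⟩ => ⟨h₁, ?_⟩
  obtain ⟨P, p, α, hα, _⟩ := finalAt_of_isEmpty t k h₂
  exact ⟨P, p, α, hα, hD.isZero_of_isEmpty hpt _⟩

theorem isRan_of_isEmpty (hD : D.IsDerivator) (hpt : D.IsPointed) {J K : Shape Dia} (t : J ⥤ K)
    [t.Full] [t.Faithful] (Y : D.level K)
    (h : ∀ k : K, (∃ j, t.obj j = k) ∨ ZeroAt Y k ∧ ∀ j, IsEmpty (k ⟶ t.obj j)) : IsRan t Y := by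
  refine isRan_of_points hD t Y fun k => (h k).imp_right fun ⟨h₁, h₂⟩ => ⟨h₁, ?_⟩
  obtain ⟨P, p, α, hα, _⟩ := initialAt_of_isEmpty t k h₂
  exact ⟨P, p, α, hα, hD.isZero_of_isEmpty hpt _⟩

theorem zeroAt_of_univR_of_isEmpty (hD : D.IsDerivator) (hpt : D.IsPointed) {J K : Shape Dia}
    {t : J ⥤ K} {X : D.level J} {Y : D.level K} {e : (D.pull t).obj Y ⟶ X}
    (he : UnivR (D.pull t) e) {k : K} (h : ∀ j, IsEmpty (k ⟶ t.obj j)) : ZeroAt Y k := by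
  obtain ⟨P, p, α, hα, _⟩ := initialAt_of_isEmpty t k h
  exact zeroAt_of_exactR hD hpt (hα.exactR hD) he (hD.isZero_of_isEmpty hpt _)

end Prederivator

end Derivators

namespace Derivators

open Shape

variable {Dia : DiagramDomain.{w}}

/-! ### The shape of the cofiber square -/

namespace Shape

variable {B : Shape Dia} (A : ObjectProperty B)

/-- The part of `B × [1] × [1]` from which the cofiber square is extended: the mapping cylinder
`(a, (0, 0))`, `(b, (1, 0))`, together with the objects `(b, (0, 1))`. -/
abbrev cofibShape : Shape Dia :=
  (B.prod (Shape.square Dia)).full fun x =>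
    x.2 ≠ (Two.one, Two.one) ∧ (x.2 = (Two.zero, Two.zero) → A x.1)

/-- The inclusion into `B × [1] × [1]`. -/
abbrev cofibIncl : cofibShape A ⥤ B.prod (Shape.square Dia) :=
  ObjectProperty.ι (C := B.carrier × (Two.{w} × Two.{w})) fun x =>
    x.2 ≠ (Two.one, Two.one) ∧ (x.2 = (Two.zero, Two.zero) → A x.1)

/-- The inclusion of the mapping cylinder. -/
abbrev cylToCofib : cyl A ⥤ cofibShape A :=
  ObjectProperty.lift _ (cylIncl A ⋙ prodMap (𝟭 B) (top Dia)) fun x =>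
    ⟨fun h => zero_ne_one (congrArg Prod.snd h), fun h => x.property.resolve_right fun h' =>
      zero_ne_one ((congrArg Prod.fst h).symm.trans h')⟩

/-- The inclusion into `B` times the span. -/
abbrev cofibToSpan : cofibShape A ⥤ B.prod (Shape.span Dia) :=
  Functor.prod' (cofibIncl A ⋙ CategoryTheory.Prod.fst B.carrier (Two.{w} × Two.{w}))
    (ObjectProperty.lift _ (cofibIncl A ⋙ CategoryTheory.Prod.snd B.carrier (Two.{w} × Two.{w}))
      fun x => x.property.1)

theorem cylToCofib_comp :
    cylToCofib A ⋙ cofibIncl A = cylIncl A ⋙ prodMap (𝟭 B) (top Dia) := rfl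

instance : (top Dia).Full where
  map_surjective f := ⟨f.1, Prod.ext rfl (Subsingleton.elim _ _)⟩

instance : (top Dia).Faithful where
  map_injective _ := Subsingleton.elim _ _

/-- Objects with last coordinate `0` form the mapping cylinder; since `(1,1)` is excluded, the
others lie over `(0,1)`. -/
theorem exists_cylToCofib_or (x : cofibShape A) :
    (∃ y, (cylToCofib A).obj y = x) ∨ x.obj.2 = (Two.zero, Two.one) := by
  obtain ⟨⟨b, y, z⟩, h₁, h₂⟩ := x
  obtain rfl | rfl := z.eq_zero_or_one
  · left
    refine ⟨⟨(b, y), ?_⟩, rfl⟩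
    obtain rfl | rfl := y.eq_zero_or_one
    · exact Or.inl (h₂ rfl)
    · exact Or.inr rfl
  · right
    obtain rfl | rfl := y.eq_zero_or_one
    · rfl
    · exact absurd rfl h₁

theorem isEmpty_hom_of_snd_eq_one {C : Type w} [Category.{w} C] {b b' : C} {y y' z z' : Two.{w}}
    (hz : z = Two.one) (hz' : z' = Two.zero) :
    IsEmpty (((b, y, z) : C × Two.{w} × Two.{w}) ⟶ (b', y', z')) :=
  ⟨fun f => zero_ne_one (hz'.symm.trans (Two.ne_of_hom f.2.2 hz))⟩

end Shape

namespace Prederivator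

variable {D : Prederivator.{w, v, u} Dia} (hD : D.IsDerivator) (hpt : D.IsPointed) {B : Shape Dia}
  (A : ObjectProperty B)

/-- The morphism `X ↦ (i_! i^* X ⟶ X, 0)` with values in `𝔻` of the shape of the cofiber square. -/
noncomputable def IsDerivator.cofibSpan : Mor (D.shift B) (D.shift (cofibShape A)) :=
  (D.pullMor (cylProj A)).comp (hD.ranMor (cylToCofib A))

/-- The morphism which sends `X` to the cofiber square of the coherent counit at `X`. -/
noncomputable def IsDerivator.cofibSquare : Mor (D.shift B) (D.shift (B.prod (Shape.square Dia))) :=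
  (hD.cofibSpan A).comp (hD.lanMor (cofibIncl A))

/-- The unit `V ⟶ κ^* κ_! V`. -/
noncomputable def IsDerivator.cofibUnit (K : Shape Dia) (X : D.level (B.prod K)) :
    ((hD.cofibSpan A).app K).obj X ⟶
      (D.pull (prodMap (cofibIncl A) (𝟭 K))).obj (((hD.cofibSquare A).app K).obj X) :=
  (hD.lanAdj (prodMap (cofibIncl A) (𝟭 K))).unit.app (((hD.cofibSpan A).app K).obj X)

/-- The counit `c^* c_* q^* X ⟶ q^* X`. -/
noncomputable def IsDerivator.cofibCounit (K : Shape Dia) (X : D.level (B.prod K)) :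
    (D.pull (prodMap (cylToCofib A) (𝟭 K))).obj (((hD.cofibSpan A).app K).obj X) ⟶
      (D.pull (prodMap (cylProj A) (𝟭 K))).obj X :=
  (hD.ranAdj (prodMap (cylToCofib A) (𝟭 K))).counit.app
    ((D.pull (prodMap (cylProj A) (𝟭 K))).obj X)

theorem univL_cofibUnit (K : Shape Dia) (X : D.level (B.prod K)) :
    UnivL (D.pull (prodMap (cofibIncl A) (𝟭 K))) (hD.cofibUnit A K X) :=
  univL_unit (hD.lanAdj (prodMap (cofibIncl A) (𝟭 K))) (((hD.cofibSpan A).app K).obj X)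

theorem univR_cofibCounit (K : Shape Dia) (X : D.level (B.prod K)) :
    UnivR (D.pull (prodMap (cylToCofib A) (𝟭 K))) (hD.cofibCounit A K X) :=
  univR_counit (hD.ranAdj (prodMap (cylToCofib A) (𝟭 K)))
    ((D.pull (prodMap (cylProj A) (𝟭 K))).obj X)

instance (K : Shape Dia) (X : D.level (B.prod K)) : IsIso (hD.cofibUnit A K X) :=
  (univL_cofibUnit hD A K X).isIso_of_fullyFaithful hD

instance (K : Shape Dia) (X : D.level (B.prod K)) : IsIso (hD.cofibCounit A K X) :=
  (univR_cofibCounit hD A K X).isIso_of_fullyFaithful hD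

theorem isLan_cofibSquare (K : Shape Dia) (X : D.level (B.prod K)) :
    IsLan (prodMap (cofibIncl A) (𝟭 K)) (((hD.cofibSquare A).app K).obj X) :=
  (univL_cofibUnit hD A K X).map_id_of_isIso

-- The object `(b, (0,1))` has no arrow into the cylinder, whose last coordinate is `0`. The right
-- extension therefore takes there the limit over an empty category, and the left extension does not
-- alter it.
include hpt in
theorem zeroAt_cofibSquare (K : Shape Dia) (X : D.level (B.prod K)) (b : B) (k : K) :
    ZeroAt (((hD.cofibSquare A).app K).obj X)
      (K := (B.prod (Shape.square Dia)).prod K) ((b, (Two.zero, Two.one)), k) := by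
  let x : cofibShape A := ⟨(b, (Two.zero, Two.one)), fun h => zero_ne_one (congrArg Prod.fst h),
    fun h => absurd (congrArg Prod.snd h).symm zero_ne_one⟩
  refine (zeroAt_pull (prodMap (cofibIncl A) (𝟭 K)) _ ((x, k) : (cofibShape A).prod K)).1 ?_
  refine (zeroAt_of_iso (K := (cofibShape A).prod K) (asIso (hD.cofibUnit A K X)) (x, k)).1 ?_
  refine zeroAt_of_univR_of_isEmpty hD hpt (univR_cofibCounit hD A K X) fun j => ⟨fun f => ?_⟩
  exact (isEmpty_hom_of_snd_eq_one rfl rfl).false f.1.hom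

include hpt in
theorem isRan_span_cofibSquare (K : Shape Dia) (X : D.level (B.prod K)) :
    IsRan (prodMap (prodMap (𝟭 B) (spanTop Dia)) (𝟭 K))
      ((D.pull (prodMap (prodMap (𝟭 B) (spanIncl Dia)) (𝟭 K))).obj
        (((hD.cofibSquare A).app K).obj X)) := by
  refine isRan_of_isEmpty hD hpt _ _ ?_
  rintro ⟨⟨b, ⟨⟨y, z⟩, hyz⟩⟩, k⟩
  obtain rfl | rfl := z.eq_zero_or_one
  · exact Or.inl ⟨((b, y), k), rfl⟩
  · obtain rfl : y = Two.zero := y.eq_zero_or_one.resolve_right fun h => hyz (by rw [h])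
    refine Or.inr ⟨?_, fun j => ⟨fun f => ?_⟩⟩
    · exact (zeroAt_pull (prodMap (prodMap (𝟭 B) (spanIncl Dia)) (𝟭 K)) _ _).2
        (zeroAt_cofibSquare hD hpt A K X b k)
    · exact zero_ne_one (Two.ne_of_hom f.1.2.hom.2 rfl)

/-- `cofibIncl` factors through `B × span`. The square is a left extension along the composite, its
restriction to the span is one along the first factor, and the two bijections on maps leave a
bijection for the second factor. -/
theorem isLan_span_cofibSquare (K : Shape Dia) (X : D.level (B.prod K)) :
    IsLan (prodMap (prodMap (𝟭 B) (spanIncl Dia)) (𝟭 K)) (((hD.cofibSquare A).app K).obj X) := by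
  let s := prodMap (prodMap (𝟭 B) (spanIncl Dia)) (𝟭 K)
  let t := prodMap (cofibToSpan A) (𝟭 K)
  let Y := ((hD.cofibSquare A).app K).obj X
  have h₁ : IsLan (t ⋙ s) Y := isLan_cofibSquare hD A K X
  have h₂ : IsLan t ((D.pull s).obj Y) := by
    let δ : 𝟭 _ ⋙ (t ⋙ s) ⟶ t ⋙ s := 𝟙 (t ⋙ s)
    have hδ : IsIso δ := inferInstanceAs (IsIso (𝟙 (t ⋙ s)))
    have hE : D.ExactL δ := exactL_of_sieve hD δ fun k j f => ⟨j, ⟨Iso.refl _⟩⟩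
    exact h₁.pull_of_exactL hE
  rw [isLan_iff] at h₁ h₂ ⊢
  intro Z
  have h₅ := (D.bijective_pull_comp t s Y Z).1 (h₁ Z)
  exact (Function.Bijective.of_comp_iff' (h₂ _) _).1 h₅

end Prederivator

end Derivators

namespace Derivators

open Shape

variable {Dia : DiagramDomain.{w}}

/-! ### The coherent counit -/

namespace Mor

variable {D E F : Prederivator.{w, v, u} Dia}

/-- The modification `Φ ⟶ Ψ L Φ` induced by a unit `id ⟶ Ψ L`. -/
def whiskerUnit (Φ : Mor F D) {L : Mor D E} {Ψ : Mor E D}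
    (η : ∀ (K : Shape Dia) (X : D.level K), X ⟶ (Ψ.app K).obj ((L.app K).obj X))
    (nat : ∀ {K : Shape Dia} {X Y : D.level K} (f : X ⟶ Y),
      f ≫ η K Y = η K X ≫ (Ψ.app K).map ((L.app K).map f))
    (comm : ∀ {J K : Shape Dia} (t : J ⥤ K) (X : D.level K),
      (D.pull t).map (η K X) ≫ Ψ.str t ((L.app K).obj X) ≫ (Ψ.app J).map (L.str t X) =
        η J ((D.pull t).obj X)) :
    Φ ⟶ (Φ.comp L).comp Ψ :=
  modOfApp (fun K => { app := fun X => η K ((Φ.app K).obj X)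
                       naturality := fun _ _ f => nat ((Φ.app K).map f) }) (by
    intro J K t X
    have h : (D.pull t).map (η K ((Φ.app K).obj X)) ≫
        Ψ.str t ((L.app K).obj ((Φ.app K).obj X)) ≫ (Ψ.app J).map
          (L.str t ((Φ.app K).obj X) ≫ (L.app J).map (Φ.str t X)) =
        Φ.str t X ≫ η J ((Φ.app J).obj ((F.pull t).obj X)) := by
      rw [nat, ← comm, Functor.map_comp, Category.assoc, Category.assoc]
    exact h)

/-- The modification `Ψ R Φ ⟶ Φ` induced by a counit `Ψ R ⟶ id`. -/
def whiskerCounit (Φ : Mor F D) {R : Mor D E} {Ψ : Mor E D}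
    (ε : ∀ (K : Shape Dia) (X : D.level K), (Ψ.app K).obj ((R.app K).obj X) ⟶ X)
    (nat : ∀ {K : Shape Dia} {X Y : D.level K} (f : X ⟶ Y),
      (Ψ.app K).map ((R.app K).map f) ≫ ε K Y = ε K X ≫ f)
    (comm : ∀ {J K : Shape Dia} (t : J ⥤ K) (X : D.level K),
      Ψ.str t ((R.app K).obj X) ≫ (Ψ.app J).map (R.str t X) ≫ ε J ((D.pull t).obj X) =
        (D.pull t).map (ε K X)) :
    (Φ.comp R).comp Ψ ⟶ Φ :=
  modOfApp (fun K => { app := fun X => ε K ((Φ.app K).obj X)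
                       naturality := fun _ _ f => nat ((Φ.app K).map f) }) (by
    intro J K t X
    have h : (D.pull t).map (ε K ((Φ.app K).obj X)) ≫ Φ.str t X =
        (Ψ.str t ((R.app K).obj ((Φ.app K).obj X)) ≫ (Ψ.app J).map
          (R.str t ((Φ.app K).obj X) ≫ (R.app J).map (Φ.str t X))) ≫
          ε J ((Φ.app J).obj ((F.pull t).obj X)) := by
      rw [Functor.map_comp, Category.assoc, Category.assoc, nat, ← comm]
      simp only [Category.assoc]
    exact h)

end Mor

namespace Prederivator

variable {D E : Prederivator.{w, v, u} Dia}

/-- The unit `Φ ⟶ t^* t_! Φ` as a modification. -/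
noncomputable def IsDerivator.lanUnit (hD : D.IsDerivator) {J K : Shape Dia}
    (Φ : Mor E (D.shift J)) (t : J ⥤ K) : Φ ⟶ (Φ.comp (hD.lanMor t)).comp (D.pullMor t) :=
  Φ.whiskerUnit (fun M X => (hD.lanAdj (prodMap t (𝟭 M))).unit.app X)
    (fun {M} _ _ f => (hD.lanAdj (prodMap t (𝟭 M))).unit.naturality f)
    (fun s X => Mor.unit_comp_leftAdjointStr (D.pullMor t)
      (η := fun M X => (hD.lanAdj (prodMap t (𝟭 M))).unit.app X)
      (fun _ _ => univL_lanUnit_pullMor_str hD t _ _) s X)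

/-- The counit `t^* t_* Φ ⟶ Φ` as a modification. -/
noncomputable def IsDerivator.ranCounit (hD : D.IsDerivator) {J K : Shape Dia}
    (Φ : Mor E (D.shift J)) (t : J ⥤ K) : (Φ.comp (hD.ranMor t)).comp (D.pullMor t) ⟶ Φ :=
  Φ.whiskerCounit (fun M X => (hD.ranAdj (prodMap t (𝟭 M))).counit.app X)
    (fun {M} _ _ f => (hD.ranAdj (prodMap t (𝟭 M))).counit.naturality f)
    (fun s X => Mor.str_comp_rightAdjointStr (D.pullMor t)
      (ε := fun M X => (hD.ranAdj (prodMap t (𝟭 M))).counit.app X)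
      (fun _ _ => univR_counit (hD.ranAdj (prodMap t (𝟭 _))) _) s X)

theorem map_comp_eqToHom_of_eq {C C' : Type*} [Category C] [Category C'] {F G : C ⥤ C'} (h : F = G)
    {X Y : C} (f : X ⟶ Y) (p : F.obj Y = G.obj Y) (q : F.obj X = G.obj X) :
    F.map f ≫ eqToHom p = eqToHom q ≫ G.map f := by
  subst h
  simp

theorem map_comp_eqToHom_of_comp_eq {C₁ C₂ C₂' C₃ : Type*} [Category C₁] [Category C₂] [Category C₂']
    [Category C₃] {S : C₁ ⥤ C₂} {T : C₂ ⥤ C₃} {S' : C₁ ⥤ C₂'} {T' : C₂' ⥤ C₃} (h : S ⋙ T = S' ⋙ T')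
    {X Y : C₁} (f : X ⟶ Y) {Z : C₂} {Z' : C₂'} {V V' : C₃} (a : V' = V) (b : V = T'.obj Z')
    (c : Z' = S'.obj X) (b' : V' = T.obj Z) (c' : Z = S.obj X)
    (a' : T.obj (S.obj Y) = T'.obj (S'.obj Y)) :
    eqToHom a ≫ eqToHom b ≫ T'.map (eqToHom c ≫ S'.map f) =
      (eqToHom b' ≫ T.map (eqToHom c' ≫ S.map f)) ≫ eqToHom a' := by
  have h₁ := map_comp_eqToHom_of_eq h f a' (Functor.congr_obj h X)
  simp only [Functor.comp_map] at h₁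
  simp only [Functor.map_comp, eqToHom_map, Category.assoc, h₁]
  simp

theorem pull_pull_eq {I J J' K : Shape Dia} {t : I ⥤ J} {s : J ⥤ K} {t' : I ⥤ J'} {s' : J' ⥤ K}
    (h : t ⋙ s = t' ⋙ s') (M : Shape Dia) :
    D.pull (prodMap s (𝟭 M)) ⋙ D.pull (prodMap t (𝟭 M)) =
      D.pull (prodMap s' (𝟭 M)) ⋙ D.pull (prodMap t' (𝟭 M)) := by
  have h' : prodMap t (𝟭 M) ⋙ prodMap s (𝟭 M) = prodMap t' (𝟭 M) ⋙ prodMap s' (𝟭 M) :=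
    congrArg (fun r => prodMap r (𝟭 M)) h
  rw [← D.pull_comp, h', D.pull_comp]

/-- The modification between restrictions along equal composites. -/
def pullMorCongr {I J J' K : Shape Dia}
    (Φ : Mor E (D.shift K)) {t : I ⥤ J} {s : J ⥤ K} {t' : I ⥤ J'} {s' : J' ⥤ K}
    (h : t ⋙ s = t' ⋙ s') :
    (Φ.comp (D.pullMor s)).comp (D.pullMor t) ⟶ (Φ.comp (D.pullMor s')).comp (D.pullMor t') :=
  Mor.modOfApp
    (fun M =>
      { app := fun X => eqToHom (Functor.congr_obj (pull_pull_eq h M) ((Φ.app M).obj X))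
        naturality := fun _ _ f =>
          map_comp_eqToHom_of_eq (pull_pull_eq h M) ((Φ.app M).map f) _ _ })
    (by
      intro M N r X
      have key : (D.pull (prodMap (𝟭 I) r)).map
            (eqToHom (Functor.congr_obj (pull_pull_eq h N) ((Φ.app N).obj X))) ≫
          (D.pullMor t').str r ((D.pull (prodMap s' (𝟭 N))).obj ((Φ.app N).obj X)) ≫
          (D.pull (prodMap t' (𝟭 M))).map ((D.pullMor s').str r ((Φ.app N).obj X) ≫
            (D.pull (prodMap s' (𝟭 M))).map (Φ.str r X)) =
          ((D.pullMor t).str r ((D.pull (prodMap s (𝟭 N))).obj ((Φ.app N).obj X)) ≫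
          (D.pull (prodMap t (𝟭 M))).map ((D.pullMor s).str r ((Φ.app N).obj X) ≫
            (D.pull (prodMap s (𝟭 M))).map (Φ.str r X))) ≫
            eqToHom (Functor.congr_obj (pull_pull_eq h M) ((Φ.app M).obj ((E.pull r).obj X))) := by
        rw [pullMor_str, pullMor_str, pullMor_str, pullMor_str, eqToHom_map]
        exact map_comp_eqToHom_of_comp_eq (pull_pull_eq h M) (Φ.str r X) _ _ _ _ _ _
      exact key)

/-- Naturality of `ν^*` at `ρ`, where `hν` says that `q` collapses `ν` to an identification. It is
applied with `c` and `e` the two ends of the mapping cylinder, `y` its inclusion and `q` its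
projection, to evaluate the transpose of the underlying arrow. -/
theorem map_pullNat_comp_pull_map {I J C P : Shape Dia} {c : I ⥤ C} {i : I ⥤ J} {e : J ⥤ C}
    {y : C ⥤ P} {q : C ⥤ J} {s₀ s₁ : J ⥤ P} (h₀ : c ⋙ y = i ⋙ s₀) (h₁ : s₁ = e ⋙ y)
    (hq : e ⋙ q = 𝟭 J.carrier) (hi : c ⋙ q = i) (ν : c ⟶ i ⋙ e) (σ : s₀ ⟶ s₁)
    (hσ : Functor.whiskerLeft i σ = eqToHom h₀.symm ≫ Functor.whiskerRight ν y ≫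
      eqToHom (by rw [h₁]; rfl))
    (hν : Functor.whiskerRight ν q = eqToHom (by rw [hi, Functor.assoc, hq]; rfl))
    {W : D.level P} {X : D.level J} (ρ : (D.pull y).obj W ⟶ (D.pull q).obj X)
    (p₁ : (D.pull s₁).obj W = (D.pull e).obj ((D.pull y).obj W))
    (p₂ : (D.pull e).obj ((D.pull q).obj X) = X) :
    (D.pull i).map ((D.pullNat σ).app W ≫ eqToHom p₁ ≫ (D.pull e).map ρ ≫ eqToHom p₂) =
      eqToHom (by rw [← D.pull_comp_obj, ← D.pull_comp_obj, h₀]) ≫ (D.pull c).map ρ ≫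
        eqToHom (by rw [← D.pull_comp_obj, hi]) := by
  have hn := (D.pullNat ν).naturality ρ
  rw [D.pullNat_app_pull, D.pullNat_app_pull, hν, D.pullNat_eqToHom] at hn
  have hl : (D.pullNat (Functor.whiskerLeft i σ)).app W = _ := congrArg (fun α => (D.pullNat α).app W) hσ
  rw [D.pullNat_comp_app, D.pullNat_comp_app, D.pullNat_eqToHom, D.pullNat_eqToHom] at hl
  simp only [Functor.map_comp, eqToHom_map, D.map_pullNat_app, hl]
  rw [D.pull_comp_map] at hn
  simp only [Category.assoc, eqToHom_trans, eqToHom_trans_assoc] at hn ⊢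
  rw [comp_eqToHom_iff] at hn
  rw [hn]
  simp only [Category.assoc, eqToHom_trans, eqToHom_trans_assoc]

end Prederivator

end Derivators

/-! ### The upper edge of the cofiber square and its underlying counit -/

namespace Derivators

open Shape

variable {Dia : DiagramDomain.{w}}

namespace Shape

variable {B : Shape Dia} (A : ObjectProperty B)

/-- The inclusion `a ↦ (a, 0)` into the mapping cylinder. -/
abbrev cylStart : B.full A ⥤ cyl A :=
  ObjectProperty.lift _ (fullIncl A ⋙ slot B (C := arrow Dia) Two.zero) fun x => Or.inl x.property

/-- The transformation with components `(a, 0) ⟶ (a, 1)`. -/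
def cylNat : cylStart A ⟶ fullIncl A ⋙ cylEnd A where
  app x := ObjectProperty.homMk (Prod.mkHom (𝟙 x.obj) Two.arrow)
  naturality _ _ f := ObjectProperty.hom_ext _ (Prod.ext
    ((Category.comp_id f.hom).trans (Category.id_comp f.hom).symm) (Subsingleton.elim _ _))

end Shape

namespace Prederivator

variable {D : Prederivator.{w, v, u} Dia} (hD : D.IsDerivator) {B : Shape Dia}
  (A : ObjectProperty B)

/-- The restriction of the upper edge of the cofiber square to the mapping cylinder. -/
noncomputable def IsDerivator.restrIso :
    ((hD.cofibSquare A).comp (D.pullMor (prodMap (𝟭 B) (top Dia)))).comp (D.pullMor (cylIncl A)) ≅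
      D.pullMor (cylProj A) :=
  Mor.isoOfIsIsoApp
    (pullMorCongr (hD.cofibSquare A) (cylToCofib_comp A).symm ≫
      Mor.whiskerRight (Mor.isoOfIsIsoApp (hD.lanUnit (hD.cofibSpan A) (cofibIncl A))
        fun K X => (inferInstance : IsIso (hD.cofibUnit A K X))).inv (D.pullMor (cylToCofib A)) ≫
      hD.ranCounit (D.pullMor (cylProj A)) (cylToCofib A))
    (fun K X => by
      have h : IsIso (eqToHom (Functor.congr_obj (pull_pull_eq (cylToCofib_comp A).symm K)
          (((hD.cofibSquare A).app K).obj X)) ≫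
          (D.pull (prodMap (cylToCofib A) (𝟭 K))).map (inv (hD.cofibUnit A K X)) ≫
            hD.cofibCounit A K X) := by
        infer_instance
      exact h)

/-- The upper edge of the cofiber square. -/
noncomputable abbrev IsDerivator.topEdge : Mor (D.shift B) (D.shift (B.prod (arrow Dia))) :=
  (hD.cofibSquare A).comp (D.pullMor (prodMap (𝟭 B) (top Dia)))

/-- The isomorphism `ī^* W X ≅ q^* X`. -/
noncomputable def IsDerivator.restrHom (K : Shape Dia) (X : D.level (B.prod K)) :
    (D.pull (prodMap (cylIncl A) (𝟭 K))).obj (((hD.topEdge A).app K).obj X) ⟶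
      (D.pull (prodMap (cylProj A) (𝟭 K))).obj X :=
  ((hD.restrIso A).hom.app K).app X

instance (K : Shape Dia) (X : D.level (B.prod K)) : IsIso (hD.restrHom A K X) :=
  Mor.isIso_modification_hom_app (hD.restrIso A) K X

/-- The isomorphism `q^* X ≅ ī^* W X`. -/
noncomputable def IsDerivator.restrInv (K : Shape Dia) (X : D.level (B.prod K)) :
    (D.pull (prodMap (cylProj A) (𝟭 K))).obj X ⟶
      (D.pull (prodMap (cylIncl A) (𝟭 K))).obj (((hD.topEdge A).app K).obj X) :=
  ((hD.restrIso A).inv.app K).app X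

theorem restrInv_restrHom (K : Shape Dia) (X : D.level (B.prod K)) :
    hD.restrInv A K X ≫ hD.restrHom A K X = 𝟙 _ :=
  congrArg (fun ρ => (Modification.app ρ K).app X) (hD.restrIso A).inv_hom_id

instance (K : Shape Dia) (X : D.level (B.prod K)) : IsIso (hD.restrInv A K X) :=
  Mor.isIso_modification_hom_app (hD.restrIso A).symm K X

theorem restrInv_naturality (K : Shape Dia) {X Y : D.level (B.prod K)} (f : X ⟶ Y) :
    (D.pull (prodMap (cylProj A) (𝟭 K))).map f ≫ hD.restrInv A K Y = hD.restrInv A K X ≫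
      (D.pull (prodMap (cylIncl A) (𝟭 K))).map (((hD.topEdge A).app K).map f) :=
  ((hD.restrIso A).inv.app K).naturality f

/-- No object over `(0,1)` has an arrow into the upper edge, so left extension from `cofibShape`
agrees there with left extension from the cylinder. -/
theorem univL_restrInv (K : Shape Dia) (X : D.level (B.prod K)) :
    UnivL (D.pull (prodMap (cylIncl A) (𝟭 K))) (hD.restrInv A K X) := by
  let δ : prodMap (cylToCofib A) (𝟭 K) ⋙ prodMap (cofibIncl A) (𝟭 K) ⟶
      prodMap (cylIncl A) (𝟭 K) ⋙ prodMap (prodMap (𝟭 B) (top Dia)) (𝟭 K) :=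
    𝟙 (prodMap (cylToCofib A ⋙ cofibIncl A) (𝟭 K))
  have hδ : IsIso δ := inferInstanceAs (IsIso (𝟙 (prodMap (cylToCofib A ⋙ cofibIncl A) (𝟭 K))))
  have hE : D.ExactL δ := by
    refine exactL_of_sieve hD δ ?_
    rintro ⟨⟨b, y⟩, k⟩ ⟨j, k'⟩ f
    obtain ⟨j', rfl⟩ | hj := exists_cylToCofib_or A j
    · exact ⟨(j', k'), ⟨Iso.refl _⟩⟩
    · exact absurd (Two.ne_of_hom f.1.2.2 (congrArg Prod.snd hj)) zero_ne_one
  have h₃ : IsLan (prodMap (cylIncl A) (𝟭 K)) (((hD.topEdge A).app K).obj X) :=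
    (isLan_cofibSquare hD A K X).pull_of_exactL hE
  simpa using h₃.iso_comp (hD.restrInv A K X)

/-- The map `i^* X ⟶ i^* s^* W X`. -/
noncomputable def IsDerivator.startHom (K : Shape Dia) (X : D.level (B.prod K)) :
    (D.pull (prodMap (fullIncl A) (𝟭 K))).obj X ⟶ (D.pull (prodMap (fullIncl A) (𝟭 K))).obj
      ((D.pull (prodMap (slot B (C := arrow Dia) Two.zero) (𝟭 K))).obj
        (((hD.topEdge A).app K).obj X)) :=
  eqToHom (D.pull_comp_obj (prodMap (cylStart A) (𝟭 K)) (prodMap (cylProj A) (𝟭 K)) X) ≫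
    (D.pull (prodMap (cylStart A) (𝟭 K))).map (hD.restrInv A K X) ≫
    eqToHom ((D.pull_comp_obj (prodMap (cylStart A) (𝟭 K)) (prodMap (cylIncl A) (𝟭 K)) _).symm.trans
      (D.pull_comp_obj (prodMap (fullIncl A) (𝟭 K))
        (prodMap (slot B (C := arrow Dia) Two.zero) (𝟭 K)) _))

/-- The only objects of the cylinder with an arrow to some `(b, 0)` are the `(a, 0)`. Over level `0`
the extension along `ī` is thus extension along `i`. -/
theorem univL_startHom (K : Shape Dia) (X : D.level (B.prod K)) :
    UnivL (D.pull (prodMap (fullIncl A) (𝟭 K))) (hD.startHom A K X) := by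
  let δ : prodMap (cylStart A) (𝟭 K) ⋙ prodMap (cylIncl A) (𝟭 K) ⟶
      prodMap (fullIncl A) (𝟭 K) ⋙ prodMap (slot B (C := arrow Dia) Two.zero) (𝟭 K) :=
    𝟙 (prodMap (cylStart A ⋙ cylIncl A) (𝟭 K))
  have hδ : IsIso δ := inferInstanceAs (IsIso (𝟙 (prodMap (cylStart A ⋙ cylIncl A) (𝟭 K))))
  have hE : D.ExactL δ := by
    refine exactL_of_sieve hD δ ?_
    rintro ⟨b, k⟩ ⟨⟨⟨b', y⟩, hy⟩, k'⟩ f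
    obtain rfl | rfl := y.eq_zero_or_one
    · exact ⟨(⟨b', hy.resolve_right zero_ne_one⟩, k'), ⟨Iso.refl _⟩⟩
    · exact absurd (Two.ne_of_hom f.1.2 rfl) zero_ne_one
  exact (hE.univL_eqToHom rfl rfl (univL_restrInv hD A K X) _).iso_comp (eqToHom _)

theorem startHom_naturality (K : Shape Dia) {X Y : D.level (B.prod K)} (f : X ⟶ Y) :
    (D.pull (prodMap (fullIncl A) (𝟭 K))).map f ≫ hD.startHom A K Y = hD.startHom A K X ≫
      (D.pull (prodMap (fullIncl A) (𝟭 K))).map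
        ((D.pull (prodMap (slot B (C := arrow Dia) Two.zero) (𝟭 K))).map
          (((hD.topEdge A).app K).map f)) := by
  have h₁ := map_comp_eqToHom_of_eq (D.pull_comp (prodMap (cylStart A) (𝟭 K))
    (prodMap (cylProj A) (𝟭 K))) f (D.pull_comp_obj _ _ Y) (D.pull_comp_obj _ _ X)
  have h₂ := map_comp_eqToHom_of_eq ((D.pull_comp (prodMap (cylStart A) (𝟭 K))
    (prodMap (cylIncl A) (𝟭 K))).symm.trans (D.pull_comp (prodMap (fullIncl A) (𝟭 K))
    (prodMap (slot B (C := arrow Dia) Two.zero) (𝟭 K)))) (((hD.topEdge A).app K).map f)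
    ((D.pull_comp_obj (prodMap (cylStart A) (𝟭 K)) (prodMap (cylIncl A) (𝟭 K)) _).symm.trans
      (D.pull_comp_obj (prodMap (fullIncl A) (𝟭 K))
        (prodMap (slot B (C := arrow Dia) Two.zero) (𝟭 K)) _))
    ((D.pull_comp_obj (prodMap (cylStart A) (𝟭 K)) (prodMap (cylIncl A) (𝟭 K)) _).symm.trans
      (D.pull_comp_obj (prodMap (fullIncl A) (𝟭 K))
        (prodMap (slot B (C := arrow Dia) Two.zero) (𝟭 K)) _))
  have h₃ := congrArg (D.pull (prodMap (cylStart A) (𝟭 K))).map (restrInv_naturality hD A K f)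
  rw [Functor.map_comp, Functor.map_comp] at h₃
  simp only [Functor.comp_map] at h₁ h₂
  rw [IsDerivator.startHom, IsDerivator.startHom, Category.assoc, Category.assoc]
  erw [← h₂, reassoc_of% h₁, reassoc_of% h₃]

/-- The transpose of the underlying arrow under `i_! ⊣ i^*` is the identity, which characterizes the
counit. The reason is that `q` sends `(a, 0) ⟶ (a, 1)` to an identity. -/
theorem startHom_underlying (K : Shape Dia) (X : D.level (B.prod K)) :
    hD.startHom A K X ≫ (D.pull (prodMap (fullIncl A) (𝟭 K))).map
      ((D.pullNat (prodNat (slotNat B (C := arrow Dia) Two.arrow) (𝟙 (𝟭 K)))).app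
          (((hD.topEdge A).app K).obj X) ≫
        targetMap A (hD.restrIso A).hom K X) = 𝟙 _ := by
  have h := map_pullNat_comp_pull_map (D := D) (c := prodMap (cylStart A) (𝟭 K))
    (i := prodMap (fullIncl A) (𝟭 K)) (e := prodMap (cylEnd A) (𝟭 K))
    (y := prodMap (cylIncl A) (𝟭 K)) (q := prodMap (cylProj A) (𝟭 K))
    (s₀ := prodMap (slot B (C := arrow Dia) Two.zero) (𝟭 K))
    (s₁ := prodMap (slot B (C := arrow Dia) Two.one) (𝟭 K)) rfl rfl rfl rfl
    (prodNat (cylNat A) (𝟙 (𝟭 K.carrier)))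
    (prodNat (slotNat B (C := arrow Dia) Two.arrow) (𝟙 (𝟭 K.carrier)))
    (by rw [eqToHom_refl, eqToHom_refl, Category.comp_id]; exact (Category.id_comp _).symm) rfl
    (hD.restrHom A K X)
    (D.pull_comp_obj (prodMap (cylEnd A) (𝟭 K)) (prodMap (cylIncl A) (𝟭 K)) _)
    ((D.pull_comp_obj (prodMap (cylEnd A) (𝟭 K)) (prodMap (cylProj A) (𝟭 K)) X).symm.trans
      (D.pull_id_obj (B.prod K) X))
  refine (congrArg (hD.startHom A K X ≫ ·) h).trans ?_
  rw [IsDerivator.startHom]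
  simp only [Category.assoc, eqToHom_trans_assoc, eqToHom_refl, Category.id_comp]
  rw [← Functor.map_comp_assoc, restrInv_restrHom]
  simp

/-- The isomorphism `i_! i^* X ≅ s^* W X`. -/
noncomputable def IsDerivator.sourceHom (K : Shape Dia) (X : D.level (B.prod K)) :
    (hD.lan (prodMap (fullIncl A) (𝟭 K))).obj ((D.pull (prodMap (fullIncl A) (𝟭 K))).obj X) ⟶
      (D.pull (prodMap (slot B (C := arrow Dia) Two.zero) (𝟭 K))).obj
        (((hD.topEdge A).app K).obj X) :=
  ((hD.lanAdj (prodMap (fullIncl A) (𝟭 K))).homEquiv _ _).symm (hD.startHom A K X)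

instance (K : Shape Dia) (X : D.level (B.prod K)) : IsIso (hD.sourceHom A K X) :=
  (isIso_homEquiv_symm_iff (hD.lanAdj (prodMap (fullIncl A) (𝟭 K))) _).2 (univL_startHom hD A K X)

theorem sourceHom_naturality (K : Shape Dia) {X Y : D.level (B.prod K)} (f : X ⟶ Y) :
    (hD.lan (prodMap (fullIncl A) (𝟭 K))).map ((D.pull (prodMap (fullIncl A) (𝟭 K))).map f) ≫
      hD.sourceHom A K Y = hD.sourceHom A K X ≫
        (D.pull (prodMap (slot B (C := arrow Dia) Two.zero) (𝟭 K))).map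
          (((hD.topEdge A).app K).map f) := by
  rw [IsDerivator.sourceHom, IsDerivator.sourceHom, ← Adjunction.homEquiv_naturality_left_symm,
    startHom_naturality, Adjunction.homEquiv_naturality_right_symm]

theorem sourceHom_underlying (K : Shape Dia) (X : D.level (B.prod K)) :
    hD.sourceHom A K X ≫
      (D.pullNat (prodNat (slotNat B (C := arrow Dia) Two.arrow) (𝟙 (𝟭 K)))).app
        (((hD.topEdge A).app K).obj X) ≫ targetMap A (hD.restrIso A).hom K X =
      (hD.lanAdj (prodMap (fullIncl A) (𝟭 K))).counit.app X := by
  rw [IsDerivator.sourceHom, ← Adjunction.homEquiv_naturality_right_symm]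
  refine (congrArg ((hD.lanAdj (prodMap (fullIncl A) (𝟭 K))).homEquiv _ _).symm
    (startHom_underlying hD A K X)).trans ?_
  rw [Adjunction.homEquiv_counit]
  simp

/-- The upper edge of the cofiber square is the coherent counit. -/
noncomputable def IsDerivator.coherentCounit : CoherentCounit hD A (hD.topEdge A) where
  restr := hD.restrIso A
  isIso_lan K X := (isIso_homEquiv_symm_iff (hD.lanAdj (prodMap (cylIncl A) (𝟭 K))) _).2
    (univL_restrInv hD A K X)
  source K := (NatIso.ofComponents (F := D.pull (prodMap (fullIncl A) (𝟭 K)) ⋙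
      hD.lan (prodMap (fullIncl A) (𝟭 K)))
    (G := (hD.topEdge A).app K ⋙ D.pull (prodMap (slot B (C := arrow Dia) Two.zero) (𝟭 K)))
    (fun X => asIso (hD.sourceHom A K X))
    (fun f => sourceHom_naturality hD A K f)).symm
  underlying K X := by
    have h := (IsIso.inv_comp_eq (hD.sourceHom A K X)).2 (sourceHom_underlying hD A K X).symm
    exact h

end Prederivator

end Derivators

namespace Derivators

open Shape

variable {Dia : DiagramDomain.{w}}

/-! ### The cofiber and its unit -/

namespace Prederivator

variable {D E : Prederivator.{w, v, u} Dia}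

theorem map_comp_eqToHom_of_eq_comp {C₁ C₂ C₃ : Type*} [Category C₁] [Category C₂]
    [Category C₃] {S : C₁ ⥤ C₂} {T : C₂ ⥤ C₃} {R : C₁ ⥤ C₃} (h : R = S ⋙ T)
    {X Y : C₁} (f : X ⟶ Y) {Z : C₂} {V V' : C₃} (a : V' = V) (b : V = T.obj Z)
    (c : Z = S.obj X) (b' : V' = R.obj X) (a' : R.obj Y = T.obj (S.obj Y)) :
    eqToHom a ≫ eqToHom b ≫ T.map (eqToHom c ≫ S.map f) =
      (eqToHom b' ≫ R.map f) ≫ eqToHom a' := by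
  subst h
  subst c
  simp

theorem eqToHom_comp_conj {C : Type*} [Category C] {X Y X' Y' Z V : C} (f : X ⟶ Y) (a : X' = X)
    (b : Y = Y') (c : Y' = Z) (a' : X' = V) (a'' : V = X) (b' : Y = Z) :
    (eqToHom a ≫ f ≫ eqToHom b) ≫ eqToHom c = eqToHom a' ≫ eqToHom a'' ≫ f ≫ eqToHom b' := by
  simp

theorem eqToHom_comp_map_eqToHom {C C' : Type*} [Category C] [Category C'] (F : C ⥤ C') {X Y : C}
    {Z V : C'} (a : Z = V) (b : Z = F.obj X) (c : X = Y) (d : F.obj Y = V) (e : V = V) :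
    eqToHom a ≫ eqToHom e = (eqToHom b ≫ F.map (eqToHom c)) ≫ eqToHom d := by
  simp [eqToHom_map]

theorem isIso_eqToHom_comp_map {C C' : Type*} [Category C] [Category C'] (F : C ⥤ C') {X Y : C}
    {Z V : C'} (f : X ⟶ Y) [IsIso f] (a : Z = F.obj X) (b : F.obj Y = V) :
    IsIso (eqToHom a ≫ F.map f ≫ eqToHom b) :=
  inferInstance

theorem pull_comp_prodMap {I J K : Shape Dia} {t : I ⥤ J} {s : J ⥤ K} {r : I ⥤ K}
    (h : r = t ⋙ s) (M : Shape Dia) :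
    D.pull (prodMap r (𝟭 M)) = D.pull (prodMap s (𝟭 M)) ⋙ D.pull (prodMap t (𝟭 M)) := by
  subst h
  exact D.pull_comp (prodMap t (𝟭 M)) (prodMap s (𝟭 M))

/-- The modification between restriction along a composite and the composite restriction. -/
def pullMorComp {I J K : Shape Dia} (Φ : Mor E (D.shift K)) {t : I ⥤ J} {s : J ⥤ K} {r : I ⥤ K}
    (h : r = t ⋙ s) : Φ.comp (D.pullMor r) ⟶ (Φ.comp (D.pullMor s)).comp (D.pullMor t) :=
  Mor.modOfApp
    (fun M =>
      { app := fun X => eqToHom (Functor.congr_obj (pull_comp_prodMap h M) ((Φ.app M).obj X))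
        naturality := fun _ _ f =>
          map_comp_eqToHom_of_eq (pull_comp_prodMap h M) ((Φ.app M).map f) _ _ })
    (by
      intro M N r' X
      have key : (D.pull (prodMap (𝟭 I) r')).map
            (eqToHom (Functor.congr_obj (pull_comp_prodMap h N) ((Φ.app N).obj X))) ≫
          (D.pullMor t).str r' ((D.pull (prodMap s (𝟭 N))).obj ((Φ.app N).obj X)) ≫
          (D.pull (prodMap t (𝟭 M))).map ((D.pullMor s).str r' ((Φ.app N).obj X) ≫
            (D.pull (prodMap s (𝟭 M))).map (Φ.str r' X)) =
          ((D.pullMor r).str r' ((Φ.app N).obj X) ≫ (D.pull (prodMap r (𝟭 M))).map (Φ.str r' X)) ≫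
            eqToHom (Functor.congr_obj (pull_comp_prodMap h M)
              ((Φ.app M).obj ((E.pull r').obj X))) := by
        rw [pullMor_str, pullMor_str, pullMor_str, eqToHom_map]
        exact map_comp_eqToHom_of_eq_comp (pull_comp_prodMap h M) (Φ.str r' X) _ _ _ _ _
      exact key)

theorem pull_retract {J K : Shape Dia} {t : J ⥤ K} {s : K ⥤ J} (h : t ⋙ s = 𝟭 J.carrier)
    (M : Shape Dia) :
    D.pull (prodMap s (𝟭 M)) ⋙ D.pull (prodMap t (𝟭 M)) = 𝟭 (D.level (J.prod M)) := by
  rw [← pull_comp_prodMap h.symm M]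
  exact D.pull_id (J.prod M)

/-- The restriction along a section, followed by restriction along the retraction, is the
identity. -/
def pullMorRetract {J K : Shape Dia} {t : J ⥤ K} {s : K ⥤ J}
    (h : t ⋙ s = 𝟭 J.carrier) : (D.pullMor s).comp (D.pullMor t) ⟶ Mor.id (D.shift J) :=
  Mor.modOfApp
    (fun M =>
      { app := fun X => eqToHom (Functor.congr_obj (pull_retract h M) X)
        naturality := fun _ _ f => map_comp_eqToHom_of_eq (pull_retract h M) f _ _ })
    (by
      intro M N r X
      have key : (D.pull (prodMap (𝟭 J) r)).map
            (eqToHom (Functor.congr_obj (pull_retract h N) X)) ≫ 𝟙 _ =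
          ((D.pullMor t).str r ((D.pull (prodMap s (𝟭 N))).obj X) ≫
            (D.pull (prodMap t (𝟭 M))).map ((D.pullMor s).str r X)) ≫
            eqToHom (Functor.congr_obj (pull_retract h M) ((D.pull (prodMap (𝟭 J) r)).obj X)) := by
        rw [pullMor_str, pullMor_str, eqToHom_map]
        exact eqToHom_comp_map_eqToHom _ _ _ _ _ rfl
      exact key)

/-- The modification induced by a transformation. -/
def pullMorNat {J K : Shape Dia} {t s : J ⥤ K} (β : t ⟶ s) : D.pullMor t ⟶ D.pullMor s :=
  Mor.modOfApp (fun M => D.pullNat (prodNat β (𝟙 (𝟭 M)))) (by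
    intro M N r X
    have h : (D.pull (prodMap (𝟭 J) r)).map ((D.pullNat (prodNat β (𝟙 (𝟭 N)))).app X) ≫
        (D.pullMor s).str r X = (D.pullMor t).str r X ≫
        (D.pullNat (prodNat β (𝟙 (𝟭 M)))).app ((D.pull (prodMap (𝟭 K) r)).obj X) := by
      have e : Functor.whiskerLeft (prodMap (𝟭 J) r) (prodNat β (𝟙 (𝟭 N))) =
        Functor.whiskerRight (prodNat β (𝟙 (𝟭 M))) (prodMap (𝟭 K) r) := by
        ext x
        · rfl
        · exact (r.map_id x.2).symm
      rw [D.map_pullNat_app, D.pullNat_app_pull, pullMor_str, pullMor_str]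
      erw [e]
      exact eqToHom_comp_conj _ _ _ _ _ _ _
    exact h)

variable (hD : D.IsDerivator) {B : Shape Dia} (A : ObjectProperty B)

/-- The cofiber of the coherent counit. -/
noncomputable def IsDerivator.cofiber : Mor (D.shift B) (D.shift B) :=
  (hD.cofibSquare A).comp (D.pullMor (slot B (C := Shape.square Dia) (Two.one, Two.one)))

theorem isIso_targetMap (K : Shape Dia) (X : D.level (B.prod K)) :
    IsIso (targetMap A (hD.restrIso A).hom K X) :=
  isIso_eqToHom_comp_map (D.pull (prodMap (cylEnd A) (𝟭 K))) (hD.restrHom A K X) _ _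

/-- The upper right corner of the cofiber square at `X` is `X`. -/
noncomputable def IsDerivator.cornerHom (K : Shape Dia) (X : D.level (B.prod K)) :
    (D.pull (prodMap (slot B (C := Shape.square Dia) (Two.one, Two.zero)) (𝟭 K))).obj
      (((hD.cofibSquare A).app K).obj X) ⟶ X :=
  eqToHom (D.pull_comp_obj (prodMap (slot B (C := arrow Dia) Two.one) (𝟭 K))
          (prodMap (prodMap (𝟭 B) (top Dia)) (𝟭 K)) (((hD.cofibSquare A).app K).obj X)) ≫
    targetMap A (hD.restrIso A).hom K X

instance (K : Shape Dia) (X : D.level (B.prod K)) : IsIso (hD.cornerHom A K X) :=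
  IsIso.comp_isIso' inferInstance (isIso_targetMap hD A K X)

/-- The identification of the upper right corner of the cofiber square. -/
noncomputable def IsDerivator.cornerIso :
    (hD.cofibSquare A).comp (D.pullMor (slot B (C := Shape.square Dia) (Two.one, Two.zero))) ≅
      Mor.id (D.shift B) :=
  Mor.isoOfIsIsoApp
    (pullMorComp (hD.cofibSquare A) (t := slot B (C := arrow Dia) Two.one)
        (s := prodMap (𝟭 B) (top Dia)) rfl ≫
      pullMorComp (hD.topEdge A) (t := cylEnd A) (s := cylIncl A) rfl ≫
      Mor.whiskerRight (hD.restrIso A).hom (D.pullMor (cylEnd A)) ≫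
      pullMorRetract (t := cylEnd A) (s := cylProj A) rfl)
    (fun K X => by
      have h : IsIso (hD.cornerHom A K X) := inferInstance
      exact h)

/-- The unit of the cofiber of the coherent counit. -/
noncomputable def IsDerivator.cofiberUnit : Mor.id (D.shift B) ⟶ hD.cofiber A :=
  (hD.cornerIso A).inv ≫ Mor.whiskerLeft (hD.cofibSquare A) (pullMorNat
    (slotNat B (C := Shape.square Dia)
      ((𝟙 Two.one, Two.arrow) : (Two.one, Two.zero) ⟶ (Two.one, Two.one))))

/-- The right edge of the cofiber square. -/
noncomputable def IsDerivator.rightEdge (K : Shape Dia) (X : D.level (B.prod K)) :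
    (D.pull (prodMap (slot B (C := Shape.square Dia) (Two.one, Two.zero)) (𝟭 K))).obj
      (((hD.cofibSquare A).app K).obj X) ⟶ ((hD.cofiber A).app K).obj X :=
  (D.pullNat (prodNat (slotNat B (C := Shape.square Dia)
    ((𝟙 Two.one, Two.arrow) : (Two.one, Two.zero) ⟶ (Two.one, Two.one))) (𝟙 (𝟭 K)))).app
      (((hD.cofibSquare A).app K).obj X)

theorem cornerHom_cofiberUnit (K : Shape Dia) (X : D.level (B.prod K)) :
    hD.cornerHom A K X ≫ Mor.unitApp (hD.cofiberUnit A) K X = hD.rightEdge A K X := by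
  have h₁ : hD.cornerHom A K X ≫ ((hD.cornerIso A).inv.app K).app X = 𝟙 _ :=
    congrArg (fun ρ => (Modification.app ρ K).app X) (hD.cornerIso A).hom_inv_id
  have h₂ : hD.cornerHom A K X ≫ ((hD.cornerIso A).inv.app K).app X ≫ hD.rightEdge A K X =
      hD.rightEdge A K X := by
    exact (Category.assoc _ _ _).symm.trans
      ((congrArg (· ≫ hD.rightEdge A K X) h₁).trans (Category.id_comp _))
  exact h₂

/-- The unit and the right edge differ by the isomorphism `cornerHom`, so the universal property may
be proved for the edge, which is a restriction map of `Q X`. -/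
theorem bijective_cofiberUnit_comp_iff (K : Shape Dia) (X Y : D.level (B.prod K)) :
    (Function.Bijective fun g : ((hD.cofiber A).app K).obj X ⟶ Y =>
      Mor.unitApp (hD.cofiberUnit A) K X ≫ g) ↔
      Function.Bijective fun g : ((hD.cofiber A).app K).obj X ⟶ Y => hD.rightEdge A K X ≫ g := by
  have h : (fun g : ((hD.cofiber A).app K).obj X ⟶ Y => hD.rightEdge A K X ≫ g) =
      (fun g => hD.cornerHom A K X ≫ g) ∘ fun g => Mor.unitApp (hD.cofiberUnit A) K X ≫ g := by
    funext g
    exact (congrArg (· ≫ g) (cornerHom_cofiberUnit hD A K X)).symm.trans (Category.assoc _ _ _)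
  rw [h]
  exact (Function.Bijective.of_comp_iff' ((asIso (hD.cornerHom A K X)).homFromEquiv).symm.bijective
    _).symm

end Prederivator

end Derivators

namespace Derivators

open Shape

variable {Dia : DiagramDomain.{w}}

/-! ### The cofiber vanishes -/

namespace Shape

/-- The functor `(y, z) ↦ (0, z)` on the span. -/
abbrev spanRetract (Dia : DiagramDomain.{w}) : Shape.span Dia ⥤ Shape.span Dia :=
  ObjectProperty.lift _ (spanIncl Dia ⋙ CategoryTheory.Prod.snd Two.{w} Two.{w} ⋙
    Functor.prod' ((Functor.const _).obj Two.zero) (𝟭 Two.{w}))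
    fun _ h => zero_ne_one (congrArg Prod.fst h)

theorem Two.zero_le (x : Two.{w}) : Two.zero ≤ x :=
  show (0 : Fin 2) ≤ x.down from Fin.zero_le _

theorem Two.le_one (x : Two.{w}) : x ≤ Two.one :=
  show x.down ≤ (1 : Fin 2) from Fin.le_last _

instance (x y : Shape.span Dia) : Subsingleton (x ⟶ y) :=
  ⟨fun _ _ => ObjectProperty.hom_ext _ (Prod.ext (Subsingleton.elim _ _) (Subsingleton.elim _ _))⟩

/-- The transformation with components `(0, z) ⟶ (y, z)`. -/
def spanRetractNat (Dia : DiagramDomain.{w}) : spanRetract Dia ⟶ 𝟭 _ where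
  app x := ObjectProperty.homMk (Prod.mkHom (homOfLE (Two.zero_le x.obj.1)) (𝟙 x.obj.2))
  naturality _ _ _ := Subsingleton.elim (α := (_ : Shape.span Dia) ⟶ _) _ _

/-- The object `(0, 1)` of the span. -/
abbrev spanLeft (Dia : DiagramDomain.{w}) : Shape.span Dia :=
  ⟨(Two.zero, Two.one), fun h => zero_ne_one (congrArg Prod.fst h)⟩

/-- The transformation with components `(0, z) ⟶ (0, 1)`. -/
def spanRetractTo (Dia : DiagramDomain.{w}) :
    spanRetract Dia ⟶ toPoint (Shape.span Dia) ⋙ pt (spanLeft Dia) where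
  app x := ObjectProperty.homMk (Prod.mkHom (𝟙 Two.zero) (homOfLE (Two.le_one x.obj.2)))
  naturality _ _ _ := Subsingleton.elim (α := (_ : Shape.span Dia) ⟶ _) _ _

variable {B : Shape Dia} (A : ObjectProperty B)

/-- The inclusion of the span at an object `a` of `A`. -/
abbrev spanAt {a : B} (ha : A a) : Shape.span Dia ⥤ cofibShape A :=
  ObjectProperty.lift _ (spanIncl Dia ⋙ Functor.prod' ((Functor.const _).obj a) (𝟭 _))
    fun x => ⟨x.property, fun _ => ha⟩

end Shape

namespace Prederivator

variable {D : Prederivator.{w, v, u} Dia}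

theorem isIso_pullNat_toPoint {J P : Shape Dia} {s t : J ⥤ P} (α : s ⟶ t)
    (Z : D.level (point Dia)) : IsIso ((D.pullNat α).app ((D.pull (toPoint P)).obj Z)) := by
  have : IsIso (Functor.whiskerRight α (toPoint P)) := NatIso.isIso_of_isIso_app _
  rw [D.pullNat_app_pull]
  infer_instance

/-- By `h₁`, `U` is isomorphic to its restriction along the retraction `(y, z) ↦ (0, z)`. From there
every object maps to `(0,1)`, where `U` is zero, while a constant target inverts these arrows; hence
a map to a constant diagram is forced. -/
theorem span_hom_ext (hD : D.IsDerivator) {U : D.level (Shape.span Dia)}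
    (h₀ : ZeroAt U (spanLeft Dia))
    (h₁ : ∀ x, D.InvertsArrow U ((spanRetractNat Dia).app x)) {Z : D.level (point Dia)}
    (f g : U ⟶ (D.pull (toPoint (Shape.span Dia))).obj Z) : f = g := by
  have hz : IsZero ((D.pull (toPoint (Shape.span Dia) ⋙ pt (spanLeft Dia))).obj U) := by
    rw [D.pull_comp_obj]
    exact hD.isZero_pull _ h₀
  have hi : IsIso ((D.pullNat (spanRetractNat Dia)).app U) := (hD.isIso_pullNat_iff _ U).2 h₁
  have hj := isIso_pullNat_toPoint (spanRetractTo Dia) Z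
  -- By naturality along `(0, z) ⟶ (0,1)`, both sides followed by an isomorphism factor through the
  -- zero value of `U`.
  have e : (D.pull (spanRetract Dia)).map f = (D.pull (spanRetract Dia)).map g := by
    rw [← cancel_mono ((D.pullNat (spanRetractTo Dia)).app _), (D.pullNat _).naturality,
      (D.pullNat _).naturality, hz.eq_of_src ((D.pull _).map f) ((D.pull _).map g)]
  have e' : (D.pull (𝟭 (Shape.span Dia).carrier)).map f =
      (D.pull (𝟭 (Shape.span Dia).carrier)).map g := by
    rw [← cancel_epi ((D.pullNat (spanRetractNat Dia)).app U), ← (D.pullNat _).naturality,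
      ← (D.pullNat _).naturality, e]
  rw [D.pull_id_map, D.pull_id_map] at e'
  exact (cancel_mono _).1 ((cancel_epi _).1 e')

variable (hD : D.IsDerivator) (hpt : D.IsPointed) {B : Shape Dia} (A : ObjectProperty B)

/-- The transformation from the span at `a` to the lower right corner at `a`. -/
def spanAtNat {a : B} (ha : A a) (K : Shape Dia) (k : K) :
    Functor.prod' (spanAt A ha) ((Functor.const _).obj k) ⋙ prodMap (cofibIncl A) (𝟭 K) ⟶
      toPoint (Shape.span Dia) ⋙
        pt (K := (B.prod (Shape.square Dia)).prod K) ((a, (Two.one, Two.one)), k) where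
  app x := Prod.mkHom (Prod.mkHom (𝟙 a)
    (Prod.mkHom (homOfLE (Two.le_one x.obj.1)) (homOfLE (Two.le_one x.obj.2)))) (𝟙 k)
  naturality _ _ _ := Prod.ext (Prod.ext (by rfl)
    (Prod.ext (Subsingleton.elim _ _) (Subsingleton.elim _ _))) (by rfl)

/-- An object `((b, s), k')` over the corner at `(a, k)` maps universally to `((a, s), k)`. This
lies in the shape even for `s = (0,0)`, precisely because `a` is in `A`. -/
theorem finalAt_spanAtNat {a : B} (ha : A a) (K : Shape Dia) (k : K) :
    FinalAt (spanAtNat A ha K k) := by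
  rintro ⟨⟨⟨b, s⟩, hs⟩, k'⟩ ⟨⟨f, f'⟩, f''⟩
  change b ⟶ a at f
  change k' ⟶ k at f''
  refine ⟨⟨s, hs.1⟩, Prod.mkHom (ObjectProperty.homMk (Prod.mkHom f (𝟙 s))) f'', ?_, ?_⟩
  · exact Prod.ext (Prod.ext (Category.comp_id f)
      (Prod.ext (Subsingleton.elim _ _) (Subsingleton.elim _ _))) (Category.comp_id f'')
  · rintro s' ⟨g, g''⟩ w
    have e₁ : g.hom.1 = f := (Category.comp_id _).symm.trans (congrArg (fun h => h.1.1) w)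
    have e₂ : g'' = f'' := (Category.comp_id _).symm.trans (congrArg Prod.snd w)
    refine ⟨ObjectProperty.homMk g.hom.2, Prod.ext (ObjectProperty.hom_ext _ (Prod.ext
      ((Category.comp_id f).trans e₁.symm) (Prod.ext (Subsingleton.elim _ _)
        (Subsingleton.elim _ _)))) ((Category.comp_id _).trans e₂.symm), fun m _ =>
          Subsingleton.elim _ _⟩

/-- On the cylinder the square is `q^* X`, and `q` collapses `(a, 0) ⟶ (a, 1)` to an identity. -/
theorem invertsArrow_cofibSquare {a : B} (ha : A a) (K : Shape Dia) (k : K)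
    (X : D.level (B.prod K)) (f : (Two.zero.{w} ⟶ Two.one)) :
    D.InvertsArrow (((hD.cofibSquare A).app K).obj X)
      (Prod.mkHom (Prod.mkHom (𝟙 a) (Prod.mkHom f (𝟙 Two.zero))) (𝟙 k) :
        (((a, (Two.zero, Two.zero)), k) : (B.prod (Shape.square Dia)).prod K) ⟶
          ((a, (Two.one, Two.zero)), k)) := by
  let f' : (⟨(a, Two.zero), Or.inl ha⟩ : cyl A) ⟶ ⟨(a, Two.one), Or.inr rfl⟩ :=
    ObjectProperty.homMk (Prod.mkHom (𝟙 a) f)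
  let g : (((⟨(a, Two.zero), Or.inl ha⟩ : cyl A), k) : (cyl A).prod K) ⟶
    ((⟨(a, Two.one), Or.inr rfl⟩ : cyl A), k) := Prod.mkHom f' (𝟙 k)
  have h₁ : D.InvertsArrow ((D.pull (prodMap (cylProj A) (𝟭 K))).obj X) g := by
    rw [invertsArrow_pull]
    have : IsIso ((prodMap (cylProj A) (𝟭 K)).map g) :=
      inferInstanceAs (IsIso (𝟙 ((a, k) : B.prod K)))
    exact invertsArrow_of_isIso X _
  have h₂ := (invertsArrow_of_iso (asIso (hD.restrHom A K X)) g).2 h₁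
  rw [invertsArrow_pull] at h₂
  exact (invertsArrow_pull (prodMap (prodMap (𝟭 B) (top Dia)) (𝟭 K)) _ _).1 h₂

include hpt in
theorem vanishes_cofiber (K : Shape Dia) (X : D.level (B.prod K)) :
    D.Vanishes A K (((hD.cofiber A).app K).obj X) := by
  rw [vanishes_iff hD hpt A]
  intro a k ha
  let W := ((hD.cofibSquare A).app K).obj X
  refine (zeroAt_pull (prodMap (slot B (C := Shape.square Dia) (Two.one, Two.one)) (𝟭 K)) W
    ((a, k) : B.prod K)).2 ?_
  let p := Functor.prod' (spanAt A ha) ((Functor.const (Shape.span Dia).carrier).obj k)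
  have h := (finalAt_spanAtNat A ha K k).exactL hD (isLan_cofibSquare hD A K X)
  have key : ∀ f g : (D.pull p).obj ((D.pull (prodMap (cofibIncl A) (𝟭 K))).obj W) ⟶
      (D.pull (toPoint (Shape.span Dia))).obj ((D.pull (pt (K :=
        (B.prod (Shape.square Dia)).prod K) ((a, (Two.one, Two.one)), k))).obj W), f = g := by
    refine span_hom_ext hD ?_ ?_
    · rw [zeroAt_pull, zeroAt_pull]
      exact zeroAt_cofibSquare hD hpt A K X a k
    · rintro ⟨⟨y, z⟩, hx⟩
      rw [invertsArrow_pull, invertsArrow_pull]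
      obtain rfl | rfl := y.eq_zero_or_one
      · exact invertsArrow_of_isIso (D := D) (K := (B.prod (Shape.square Dia)).prod K) W
          (𝟙 ((a, (Two.zero, z)), k))
      · obtain rfl : z = Two.zero := z.eq_zero_or_one.resolve_right fun h => hx (by rw [h])
        exact invertsArrow_cofibSquare hD A ha K k X _
  have := hD.hasZeroObject hpt (point Dia)
  -- Maps out of the colimit are maps out of the span, and these all agree; so the identity equals
  -- the zero map.
  have h₁ := h.hom_ext (f := 𝟙 _) (g := (isZero_zero _).from_ _ ≫ (isZero_zero _).to_ _) (key _ _)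
  exact (isZero_zero _).of_iso ⟨_, _, h₁.symm, (isZero_zero _).eq_of_src _ _⟩

end Prederivator

end Derivators

namespace Derivators

open Shape

variable {Dia : DiagramDomain.{w}}

/-! ### The universal property of the cofiber -/

namespace Shape

variable {B : Shape Dia} (A : ObjectProperty B)

/-- The part of the shape of the cofiber square on the objects `(b, (1, 0))` and `(b, (0, 1))`. -/
abbrev cornerShape : Shape Dia :=
  (cofibShape A).full fun x => x.obj.2 ≠ (Two.zero, Two.zero)

/-- The inclusion into the shape of the cofiber square. -/
abbrev cornerIncl : cornerShape A ⥤ cofibShape A :=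
  ObjectProperty.ι (C := (cofibShape A).carrier) fun x => x.obj.2 ≠ (Two.zero, Two.zero)

/-- The inclusion `b ↦ (b, (1, 0))`. -/
abbrev cornerSlot : B ⥤ cornerShape A :=
  ObjectProperty.lift _ (ObjectProperty.lift _
    (slot B (C := Shape.square Dia) (Two.one, Two.zero)) fun _ =>
      ⟨fun h => zero_ne_one (congrArg Prod.snd h), fun h =>
        absurd (congrArg Prod.fst h).symm zero_ne_one⟩) fun _ h =>
          zero_ne_one (congrArg Prod.fst h).symm

/-- The two corners `(1, 0)` and `(0, 1)` of the square. -/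
abbrev corners (Dia : DiagramDomain.{w}) : Shape Dia :=
  (Shape.square Dia).full fun x => x ≠ (Two.one, Two.one) ∧ x ≠ (Two.zero, Two.zero)

/-- The inclusion of the two corners at an object of `B`. -/
abbrev cornersAt (b : B) : corners Dia ⥤ cornerShape A :=
  ObjectProperty.lift _ (ObjectProperty.lift _ (ObjectProperty.ι (C := Two.{w} × Two.{w})
    (fun x => x ≠ (Two.one, Two.one) ∧ x ≠ (Two.zero, Two.zero)) ⋙
      Functor.prod' ((Functor.const _).obj b) (𝟭 _))
    fun x => ⟨x.property.1, fun h => absurd h x.property.2⟩) fun x => x.property.2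

/-- The projection to `B`. -/
abbrev squareProj (B : Shape Dia) : B.prod (Shape.square Dia) ⥤ B :=
  CategoryTheory.Prod.fst B.carrier (Two.{w} × Two.{w})

instance (x y : corners Dia) : Subsingleton (x ⟶ y) :=
  ⟨fun _ _ => ObjectProperty.hom_ext _ (Prod.ext (Subsingleton.elim _ _) (Subsingleton.elim _ _))⟩

instance (x y : Two.{w} × Two.{w}) : Subsingleton (x ⟶ y) :=
  ⟨fun _ _ => Prod.ext (Subsingleton.elim _ _) (Subsingleton.elim _ _)⟩

/-- The lower right corner is right adjoint to the projection. -/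
def squareProjAdj (B K : Shape Dia) : prodMap (squareProj B) (𝟭 K) ⊣
    prodMap (slot B (C := Shape.square Dia) (Two.one, Two.one)) (𝟭 K) where
  unit :=
    { app := fun x => Prod.mkHom (Prod.mkHom (𝟙 x.1.1) (Prod.mkHom
        (homOfLE (Two.le_one x.1.2.1)) (homOfLE (Two.le_one x.1.2.2)))) (𝟙 x.2)
      naturality := fun _ _ _ => Prod.ext (Prod.ext
        ((Category.comp_id _).trans (Category.id_comp _).symm) (Subsingleton.elim _ _))
        ((Category.comp_id _).trans (Category.id_comp _).symm) }
  counit := 𝟙 (𝟭 _)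
  left_triangle_components _ := Prod.ext (Category.comp_id _) (Category.comp_id _)
  right_triangle_components _ := Prod.ext (Prod.ext (Category.comp_id _)
    (Subsingleton.elim _ _)) (Category.comp_id _)

end Shape

namespace Prederivator

variable {D : Prederivator.{w, v, u} Dia} (hD : D.IsDerivator) (hpt : D.IsPointed) {B : Shape Dia}
  (A : ObjectProperty B)

-- The objects missing from the corners are the `(a, (0,0))` with `a` in `A`. There `Y` is zero, and
-- the limit to compare with reduces to the two corners at `a`, where the diagram is zero as well.
include hD hpt in
theorem isRan_cornerIncl (K : Shape Dia) (Y : D.level (B.prod K)) (hY : D.Vanishes A K Y) :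
    IsRan (prodMap (cornerIncl A) (𝟭 K)) ((D.pull (prodMap (cofibIncl A) (𝟭 K))).obj
      ((D.pull (prodMap (squareProj B) (𝟭 K))).obj Y)) := by
  rw [vanishes_iff hD hpt A] at hY
  refine isRan_of_points hD _ _ ?_
  rintro ⟨⟨⟨b, s⟩, hs⟩, k⟩
  by_cases h : s = (Two.zero, Two.zero)
  · subst h
    -- Membership in `cofibShape` over `(0,0)` places `b` in `A`, where `Y` vanishes.
    have hb := hs.2 rfl
    refine Or.inr ⟨?_, corners Dia, Functor.prod' (cornersAt A b) ((Functor.const _).obj k),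
      { app := fun x => Prod.mkHom (ObjectProperty.homMk (Prod.mkHom (𝟙 b)
          (Prod.mkHom (homOfLE (Two.zero_le x.obj.1)) (homOfLE (Two.zero_le x.obj.2))))) (𝟙 k)
        naturality := fun _ _ _ => Prod.ext (ObjectProperty.hom_ext _
          (Prod.ext (by rfl) (Subsingleton.elim _ _))) (by rfl) }, ?_, ?_⟩
    · rw [zeroAt_pull, zeroAt_pull]
      exact hY b k hb
    · rintro ⟨⟨⟨⟨b', s'⟩, hs'⟩, hs''⟩, k'⟩ ⟨⟨f, f'⟩, f''⟩
      change b ⟶ b' at f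
      change k ⟶ k' at f''
      refine ⟨⟨s', hs'.1, hs''⟩, Prod.mkHom (ObjectProperty.homMk (ObjectProperty.homMk
        (Prod.mkHom f (𝟙 s')))) f'', ?_, ?_⟩
      · exact Prod.ext (ObjectProperty.hom_ext _ (Prod.ext (Category.id_comp f)
          (Subsingleton.elim _ _))) (Category.id_comp f'')
      · rintro x ⟨g, g''⟩ w
        have e₁ : g.hom.hom.1 = f :=
          (Category.id_comp _).symm.trans (congrArg (fun h => h.1.hom.1) w)
        have e₂ : g'' = f'' := (Category.id_comp _).symm.trans (congrArg Prod.snd w)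
        refine ⟨ObjectProperty.homMk g.hom.hom.2, Prod.ext (ObjectProperty.hom_ext _
          (ObjectProperty.hom_ext _ (Prod.ext ((Category.id_comp f).trans e₁.symm)
            (Subsingleton.elim _ _)))) ((Category.id_comp _).trans e₂.symm), fun m _ =>
              Subsingleton.elim _ _⟩
    · rw [hD.isZero_iff hpt]
      intro x
      rw [zeroAt_pull, zeroAt_pull, zeroAt_pull, zeroAt_pull]
      exact hY b k hb
  · exact Or.inl ⟨(⟨⟨(b, s), hs⟩, h⟩, k), rfl⟩

-- There is no arrow from an object over `(1,0)` to one over `(0,1)`, so a left extension from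
-- `(1,0)` is zero at `(0,1)`, just as the cofiber square is.
include hpt in
theorem isLan_cornerSlot (K : Shape Dia) (X : D.level (B.prod K)) :
    IsLan (prodMap (cornerSlot A) (𝟭 K)) ((D.pull (prodMap (cornerIncl A) (𝟭 K))).obj
      ((D.pull (prodMap (cofibIncl A) (𝟭 K))).obj (((hD.cofibSquare A).app K).obj X))) := by
  refine isLan_of_isEmpty hD hpt _ _ ?_
  rintro ⟨⟨⟨⟨b, ⟨y, z⟩⟩, h₁⟩, h₂⟩, k⟩
  obtain rfl | rfl := y.eq_zero_or_one
  · obtain rfl : z = Two.one := z.eq_zero_or_one.resolve_left fun h => h₂ (by simp [h])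
    refine Or.inr ⟨?_, fun j => ⟨fun f => ?_⟩⟩
    · rw [zeroAt_pull, zeroAt_pull]
      exact zeroAt_cofibSquare hD hpt A K X b k
    · exact zero_ne_one (Two.ne_of_hom f.1.hom.hom.2.1 rfl)
  · obtain rfl : z = Two.zero := z.eq_zero_or_one.resolve_right fun h => h₁.1 (by simp [h])
    exact Or.inl ⟨(b, k), rfl⟩

include hpt in
theorem bijective_pull_upperRight (K : Shape Dia) (X Y : D.level (B.prod K))
    (hY : D.Vanishes A K Y) :
    Function.Bijective fun g : ((hD.cofibSquare A).app K).obj X ⟶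
        (D.pull (prodMap (squareProj B) (𝟭 K))).obj Y =>
      (D.pull (prodMap (slot B (C := Shape.square Dia) (Two.one, Two.zero)) (𝟭 K))).map g := by
  have h₁ := (isLan_iff _ _).1 (isLan_cofibSquare hD A K X)
    ((D.pull (prodMap (squareProj B) (𝟭 K))).obj Y)
  have h₂ := (isRan_iff _ _).1 (isRan_cornerIncl hD hpt A K Y hY)
    ((D.pull (prodMap (cofibIncl A) (𝟭 K))).obj (((hD.cofibSquare A).app K).obj X))
  have h₃ := (isLan_iff _ _).1 (isLan_cornerSlot hD hpt A K X)
    ((D.pull (prodMap (cornerIncl A) (𝟭 K))).obj ((D.pull (prodMap (cofibIncl A) (𝟭 K))).obj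
      ((D.pull (prodMap (squareProj B) (𝟭 K))).obj Y)))
  -- Three restrictions in turn: to `cofibShape` by the source, to the two corners by the target, to
  -- `(1,0)` by the source again.
  exact (D.bijective_pull_comp (prodMap (cornerSlot A ⋙ cornerIncl A) (𝟭 K))
    (prodMap (cofibIncl A) (𝟭 K)) _ _).2 (((D.bijective_pull_comp (prodMap (cornerSlot A) (𝟭 K))
      (prodMap (cornerIncl A) (𝟭 K)) _ _).2 (h₃.comp h₂)).comp h₁)

/-- The slot `(1,1)` is a right adjoint section of the projection, so restriction along it is left
adjoint to `p^*` with invertible counit. This holds for every `W`. -/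
theorem bijective_pull_lowerRight (K : Shape Dia) (W : D.level ((B.prod (Shape.square Dia)).prod K))
    (Y : D.level (B.prod K)) :
    Function.Bijective fun g : W ⟶ (D.pull (prodMap (squareProj B) (𝟭 K))).obj Y =>
      (D.pull (prodMap (slot B (C := Shape.square Dia) (Two.one, Two.one)) (𝟭 K))).map g := by
  have : IsIso (squareProjAdj B K).counit := inferInstanceAs (IsIso (𝟙 (𝟭 _)))
  exact D.bijective_pull_of_adj (squareProjAdj B K) Y W

include hpt in
theorem bijective_cofiberUnit_comp (K : Shape Dia) (X Y : D.level (B.prod K))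
    (hY : D.Vanishes A K Y) :
    Function.Bijective fun g : ((hD.cofiber A).app K).obj X ⟶ Y =>
      Mor.unitApp (hD.cofiberUnit A) K X ≫ g := by
  rw [bijective_cofiberUnit_comp_iff]
  let β : prodMap (slot B (C := Shape.square Dia) (Two.one, Two.zero)) (𝟭 K) ⟶
      prodMap (slot B (C := Shape.square Dia) (Two.one, Two.one)) (𝟭 K) :=
    prodNat (slotNat B (C := Shape.square Dia)
      ((𝟙 Two.one, Two.arrow) : (Two.one, Two.zero) ⟶ (Two.one, Two.one))) (𝟙 (𝟭 K.carrier))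
  let p := prodMap (squareProj B) (𝟭 K)
  let W := ((hD.cofibSquare A).app K).obj X
  have hβ : IsIso ((D.pullNat β).app ((D.pull p).obj Y)) := by
    have : IsIso (Functor.whiskerRight β p) := inferInstanceAs (IsIso (𝟙 (𝟭 (B.prod K).carrier)))
    rw [D.pullNat_app_pull]
    infer_instance
  have h₁ := bijective_pull_upperRight hD hpt A K X Y hY
  have h₂ := bijective_pull_lowerRight K W Y
  have key : Function.Bijective fun g : ((hD.cofiber A).app K).obj X ⟶
      (D.pull (prodMap (slot B (C := Shape.square Dia) (Two.one, Two.one)) (𝟭 K))).obj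
        ((D.pull p).obj Y) => hD.rightEdge A K X ≫ g := by
    -- Every map out of `L X` is the restriction to `(1,1)` of a unique map `g : Q X ⟶ p^* Y`.
    -- Naturality along `(1,0) ⟶ (1,1)` then identifies precomposition with the right edge with
    -- restriction of `g` to `(1,0)`, since `p^* Y` inverts that edge.
    refine (Function.Bijective.of_comp_iff _ h₂).1 ?_
    have h₃ := ((asIso ((D.pullNat β).app ((D.pull p).obj Y))).homToEquiv
      (Z := (D.pull (prodMap (slot B (C := Shape.square Dia) (Two.one, Two.zero)) (𝟭 K))).obj
        W)).bijective.comp h₁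
    refine (congrArg Function.Bijective (funext fun g => ?_)).mpr h₃
    exact ((D.pullNat β).naturality g).symm
  have e : (D.pull (prodMap (slot B (C := Shape.square Dia) (Two.one, Two.one)) (𝟭 K))).obj
      ((D.pull p).obj Y) = Y := (D.pull_comp_obj _ p Y).symm.trans (D.pull_id_obj (B.prod K) Y)
  rwa [e] at key

end Prederivator

end Derivators

/-! ### Assembly of the localization -/

namespace Derivators

open Shape

variable {Dia : DiagramDomain.{w}}

namespace Prederivator

variable {D : Prederivator.{w, v, u} Dia} (hD : D.IsDerivator) (hpt : D.IsPointed) {B : Shape Dia}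
  (A : ObjectProperty B)

/-- The cofiber of the coherent counit, as a morphism to the vanishing subprederivator. -/
noncomputable def vanishingReflector : Mor (D.shift B) (D.vanishing hD A) :=
  Mor.corestrict (hD.cofiber A) (fun K => D.Vanishes A K) (hD.vanishes_pull A)
    (vanishes_cofiber hD hpt A)

/-- The cofiber of the coherent counit is left adjoint to the inclusion. -/
noncomputable def vanishingAdj :
    MorAdjunction (vanishingReflector hD hpt A) (D.vanishingIncl hD A) :=
  Mor.corestrictAdj (hP := hD.vanishes_pull A) (hD.cofiberUnit A) (vanishes_cofiber hD hpt A)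
    (bijective_cofiberUnit_comp hD hpt A)

/-- The reflection onto the vanishing subprederivator is the cofiber of the coherent counit. -/
noncomputable def vanishingCofiberOfCounit :
    CofiberOfCounit hD A ((vanishingReflector hD hpt A).comp (D.vanishingIncl hD A))
      (vanishingAdj hD hpt A).unit where
  Q := hD.cofibSquare A
  counit := hD.coherentCounit A
  extension_by_zero K X :=
    (isIso_unit_iff (hD.ranAdj _) _).2 (isRan_span_cofibSquare hD hpt A K X)
  cocartesian K X := (isIso_counit_iff (hD.lanAdj _) _).2 (isLan_span_cofibSquare hD A K X)
  corner := Mor.corestrictIncl (hD.cofiber A) (fun K => D.Vanishes A K) (hD.vanishes_pull A)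
    (vanishes_cofiber hD hpt A)
  right_edge K X := by
    have h : (hD.cornerHom A K X ≫ Mor.unitApp (hD.cofiberUnit A) K X) ≫
        𝟙 (((hD.cofiber A).app K).obj X) =
        hD.rightEdge A K X ≫ 𝟙 (((hD.cofiber A).app K).obj X) :=
      congrArg (· ≫ 𝟙 _) (cornerHom_cofiberUnit hD A K X)
    exact (Category.assoc _ _ _).symm.trans h

end Prederivator

end Derivators

theorem theorem1 {Dia : DiagramDomain.{w}} (D : Prederivator.{w, v, u} Dia)
    (hD : D.IsDerivator) (hpt : D.IsPointed) (B : Shape Dia) (A : ObjectProperty B) :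
    (∃ (F : Mor (D.shift B) (D.vanishing hD A))
        (adj : MorAdjunction F (D.vanishingIncl hD A)),
      IsLocalization (F.comp (D.vanishingIncl hD A)) adj.unit ∧
      (∀ K : Shape Dia,
        ((F.comp (D.vanishingIncl hD A)).app K).essImage = D.Vanishes A K) ∧
      Nonempty (CofiberOfCounit hD A (F.comp (D.vanishingIncl hD A)) adj.unit)) ∧
    (D.vanishing hD A).IsDerivator ∧
    (D.vanishing hD A).IsPointed := by
  refine ⟨⟨Prederivator.vanishingReflector hD hpt A, Prederivator.vanishingAdj hD hpt A,
    ?_, fun K => ?_, ⟨Prederivator.vanishingCofiberOfCounit hD hpt A⟩⟩,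
    Prederivator.isDerivator_vanishing hD hpt A, Prederivator.isPointed_vanishing hD hpt A⟩
  · exact Mor.isLocalization_corestrict (hP := hD.vanishes_pull A) (hD.cofiberUnit A)
      (Prederivator.vanishes_cofiber hD hpt A) (Prederivator.bijective_cofiberUnit_comp hD hpt A)
  · exact Mor.essImage_corestrict (hP := hD.vanishes_pull A) (hD.cofiberUnit A)
      (Prederivator.vanishes_cofiber hD hpt A) (Prederivator.bijective_cofiberUnit_comp hD hpt A) K
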